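/- Let $-1<\alpha<1$, $\alpha\neq 0$, and let $k\ge 1$ be an integer. Use the Fourier transform $\hat f(\xi)=\int_{\mathbb R}f(x)e^{-\mathrm i\xi x}\,\mathrm dx$, the norms $\|f\|_{H^s}^2=\frac1{2\pi}\int_{\mathbb R}(1+\xi^2)^s|\hat f(\xi)|^2\,\mathrm d\xi$, the real inner product $(f,g)_2=\int_{\mathbb R} fg\,\mathrm dx$, and put $$m(a,b)=\frac{a+b}{2\big[|a|^\alpha a+|b|^\alpha b-|a+b|^\alpha(a+b)\big]},\qquad \widehat{P(f,g)}(\xi)=\frac1{2\pi}\int_{\mathbb R}m(\xi-\eta,\eta)\hat f(\xi-\eta)\hat g(\eta)\,\mathrm d\eta .$$ For a real-valued function $u$ of $(t,x)$ the modified energy of order $k$ is $$E^{(k)}(t)=\|\partial_x^ku(t)\|_{L^2}^2+2\big(\partial_x^ku(t),\partial_x^kP(u(t),u(t))\big)_2 ,$$ where the last pairing is understood in the principal value sense, i.e. as $\lim_{\varepsilon\to0^+}(\partial_x^ku,\partial_x^kP_\varepsilon(u,u))_2$, with $P_\varepsilon$ the pseudo-product whose symbol is $m(a,b)$ where $\varepsilon<|a|,|b|,|a+b|<1/\varepsilon$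 and $0$ elsewhere. There is a constant $C>0$, depending only on $\alpha$ and $k$, such that the following holds. Let $N\ge 3$ be an integer with $k\le N$, let $T>0$, and let $u\in C([0,T];H^N(\mathbb R))\cap C^1([0,T];H^{N-2}(\mathbb R))$ be a real-valued solution of the fractional KdV equation $$\partial_tu+u\,\partial_xu-|D|^\alpha\partial_xu=0,\qquad \widehat{|D|^\alpha f}(\xi)=|\xi|^\alpha\hat f(\xi).$$ Then for every $t\in[0,T]$ the limit defining $E^{(k)}(t)$ exists, $E^{(k)}$ is differentiable at $t$ (one-sidedly at the end points), and $$\frac{\mathrm d}{\mathrm dt}E^{(k)}(t)\le C\Big(\|u(t)\|_{H^2}\|u(t)\|_{H^3}\|u(t)\|_{H^k}^2+\|u(t)\|_{H^k}^4\Big).$$ -/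

import Mathlib

open MeasureTheory Filter Topology FourierTransform ComplexConjugate

noncomputable section

namespace FKdV

/-- The real space `L²(ℝ)`. -/
abbrev L2 : Type := Lp ℝ 2 (volume : Measure ℝ)

/-- The Fourier transform `f̂(ξ) = ∫ f(x) exp(-iξx) dx` of a real-valued `f ∈ L²(ℝ)`. Mathlib's
(Plancherel) transform on `L²` has the kernel `exp(-2πiωx)`, so it is evaluated at
`ω = ξ / (2π)`. -/
def ft (f : L2) (ξ : ℝ) : ℂ :=
  (𝓕 (Complex.ofRealCLM.compLp f : Lp ℂ 2 (volume : Measure ℝ)) : Lp ℂ 2 (volume : Measure ℝ))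
    (ξ / (2 * Real.pi))

/-- `f ∈ H^s(ℝ) = (1 - ∂ₓ²)^(-s/2) L²(ℝ)`. -/
def MemH (s : ℕ) (f : L2) : Prop :=
  Integrable (fun ξ : ℝ => (1 + ξ ^ 2) ^ s * ‖ft f ξ‖ ^ 2)

/-- The norm `‖f‖_{H^s} = ‖(1 - ∂ₓ²)^(s/2) f‖_{L²}` of `f ∈ H^s(ℝ)` (Plancherel's identity for
`f̂(ξ) = ∫ f(x) exp(-iξx) dx` has the factor `1 / (2π)`). -/
def normH (s : ℕ) (f : L2) : ℝ :=
  Real.sqrt ((1 / (2 * Real.pi)) * ∫ ξ : ℝ, (1 + ξ ^ 2) ^ s * ‖ft f ξ‖ ^ 2)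

/-- `g = σ(D) f`, where `D = -i ∂ₓ`: the Fourier multiplier with symbol `σ` maps `f` to `g`. -/
def IsMultiplier (σ : ℝ → ℂ) (f g : L2) : Prop :=
  ∀ᵐ ξ : ℝ, ft g ξ = σ ξ * ft f ξ

/-- The curve `v : [0, T] → H^s(ℝ)` is well defined and continuous. -/
def ContinuousInH (s : ℕ) (T : ℝ) (v : ℝ → L2) : Prop :=
  ∀ t ∈ Set.Icc 0 T, MemH s (v t) ∧
    Tendsto (fun τ => normH s (v τ - v t)) (𝓝[Set.Icc 0 T] t) (𝓝 0)

/-- `v'` is the derivative of the curve `v` on `[0, T]`, as a limit of difference quotients in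
`H^s(ℝ)` (one-sided at the end points). -/
def IsTimeDerivInH (s : ℕ) (T : ℝ) (v v' : ℝ → L2) : Prop :=
  ∀ t ∈ Set.Icc 0 T,
    Tendsto (fun τ => normH s ((τ - t)⁻¹ • (v τ - v t) - v' t)) (𝓝[Set.Icc 0 T \ {t}] t) (𝓝 0)

/-- `u ∈ C([0,T]; H^N(ℝ)) ∩ C¹([0,T]; H^(N-2)(ℝ))` is a real-valued solution of
`∂ₜu + u ∂ₓu - |D|^α ∂ₓu = 0`; here `ut = ∂ₜu`, `ux = ∂ₓu` and `w = |D|^α ∂ₓu`. -/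
def IsSolution (α : ℝ) (N : ℕ) (T : ℝ) (u : ℝ → L2) : Prop :=
  ContinuousInH N T u ∧
  ∃ ut : ℝ → L2, ContinuousInH (N - 2) T ut ∧ IsTimeDerivInH (N - 2) T u ut ∧
    ∀ t ∈ Set.Icc 0 T, ∃ ux w : L2,
      IsMultiplier (fun ξ => Complex.I * (ξ : ℂ)) (u t) ux ∧
      IsMultiplier (fun ξ => Complex.I * (ξ : ℂ) * ((|ξ| ^ α : ℝ) : ℂ)) (u t) w ∧
      ∀ᵐ x : ℝ, ut t x + u t x * ux x - w x = 0

/-- The symbol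
`m(a,b) = (a + b) / (2 [|a|^α a + |b|^α b - |a+b|^α (a+b)])` of the normal-form transformation. -/
def m (α a b : ℝ) : ℝ :=
  (a + b) / (2 * (|a| ^ α * a + |b| ^ α * b - |a + b| ^ α * (a + b)))

open Classical in
/-- The symbol `m`, cut off to the frequencies `ε < |a|, |b|, |a+b| < 1/ε`. -/
def mCut (α ε a b : ℝ) : ℝ :=
  if (ε < |a| ∧ |a| < 1 / ε) ∧ (ε < |b| ∧ |b| < 1 / ε) ∧ (ε < |a + b| ∧ |a + b| < 1 / ε)
  then m α a b else 0

/-- The Fourier transform of the pseudo-product `P_ε(f,g)` with the symbol `mCut α ε`. The factor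
`1 / (2π)` is the one in `(f g)^(ξ) = (1 / (2π)) ∫ f̂(ξ-η) ĝ(η) dη`. -/
def PCutHat (α ε : ℝ) (f g : L2) (ξ : ℝ) : ℂ :=
  (1 / (2 * Real.pi) : ℂ) * ∫ η : ℝ, (mCut α ε (ξ - η) η : ℂ) * ft f (ξ - η) * ft g η

/-- The inner product `(∂ₓ^k f, ∂ₓ^k P_ε(f,f))_2` of real-valued functions, by Plancherel. -/
def pairingCut (α : ℝ) (k : ℕ) (ε : ℝ) (f : L2) : ℝ :=
  ((1 / (2 * Real.pi) : ℂ) *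
    ∫ ξ : ℝ, (Complex.I * (ξ : ℂ)) ^ k * ft f ξ *
      conj ((Complex.I * (ξ : ℂ)) ^ k * PCutHat α ε f f ξ)).re

/-- `L = (∂ₓ^k f, ∂ₓ^k P(f,f))_2`, where `P` is the pseudo-product with the symbol `m`. The symbol
is singular where one of the frequencies vanishes and grows at high frequencies, so for general
`f ∈ H^k(ℝ)` the integral has no absolute convergence; it is read as a principal value. -/
def IsPairing (α : ℝ) (k : ℕ) (f : L2) (L : ℝ) : Prop :=
  Tendsto (fun ε => pairingCut α k ε f) (𝓝[>] 0) (𝓝 L)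

/-- `‖∂ₓ^k f‖²` in `L²(ℝ)`. -/
def derivNormSq (k : ℕ) (f : L2) : ℝ :=
  (1 / (2 * Real.pi)) * ∫ ξ : ℝ, ‖(Complex.I * (ξ : ℂ)) ^ k * ft f ξ‖ ^ 2

/-- The modified energy `‖∂ₓ^k f‖² + 2 (∂ₓ^k f, ∂ₓ^k P(f,f))_2`. It is meaningful when the
principal value exists, that is, when `IsPairing α k f L` for some `L`. -/
def modifiedEnergy (α : ℝ) (k : ℕ) (f : L2) : ℝ :=
  derivNormSq k f + 2 * limUnder (𝓝[>] 0) (fun ε => pairingCut α k ε f)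

end FKdV

end

/-!
# The modified energy for the fractional Korteweg–de Vries equation

All computations are done in Fourier variables. Write `F` for the transform of `u(t)`,
`ω(ξ) = |ξ|^α ξ` (`om`), and `W(ξ) = ξ w(ξ)` with the weight `w(ξ) = ξ^(2k)`. After symmetrisation
over the three frequencies the modified energy is

  `(1/2π) ∫ w |F|² - (1/3) (1/2π)² Re ∫_{a+b+c=0} M(a,b,c) F(a) F(b) F(c)`,
  `M(a,b,c) = (W(a) + W(b) + W(c)) / (ω(a) + ω(b) + ω(c))`  (`sym`).

Since `ω(a) + ω(b) + ω(c)` is bounded below by the smallest frequency (`om_gap`), and the numerator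
vanishes there to the same order, `M` is locally bounded, and the cubic integral converges absolutely
on `H^max(3,k)`. Dominated convergence then gives the principal value (`isPairing_tri`).

In the time derivative the cubic terms cancel, because `M · (ω(a) + ω(b) + ω(c))` is the numerator of
`M` (`sym_mul_om`). What remains is a quartic form (`quadForm`), whose symbol is the sum over the six
pairs of four frequencies with sum zero of `M(a, b, -(a+b)) (a+b)` (`quadSym`). One such term loses a
derivative when one frequency is high and the other low. The two high frequencies contribute with
opposite signs, however, and their difference is controlled by second differences of `W` and `ω`
(`sym_sub_le`). Hence the quartic symbol admits `k` derivatives on each of the two largest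
frequencies and at most two on the third (`abs_quadSym_le`), and Young's inequality bounds the form by
`‖u‖_{H²} ‖u‖_{H³} ‖u‖_{H^k}²` (`norm_quadForm_le`).

The time derivative cannot be computed directly, as `∂ₜu` lies in `H^(N-2)` only. The weight is
therefore replaced by `ξ^(2k) / (1 + δ ξ²)^(k+1)` (`wt`). For `δ > 0` the energy `En` is
differentiable on curves that are continuous in `H¹` and differentiable in `L²`
(`hasDerivWithinAt_En`), and the cancellation is exact (`deriv_En_eq`). The bounds for the quartic
form and for its modulus of continuity are uniform in `δ`, so that the mean value inequality allows
the limit `δ → 0` in the derivative (`hasDerivWithinAt_of_tendsto`).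
-/

open scoped ENNReal

noncomputable section

namespace FKdV

/-! ### The Fourier transform of a product -/

theorem ae_eq_of_schwartz_test {f g : ℝ → ℂ} (hf : LocallyIntegrable f) (hg : LocallyIntegrable g)
    (h : ∀ φ : SchwartzMap ℝ ℂ, ∫ x, φ x * f x = ∫ x, φ x * g x) : f =ᵐ[volume] g := by
  refine ae_eq_of_integral_contDiff_smul_eq hf hg fun φ hφ hc => ?_
  have hc' : HasCompactSupport (Complex.ofRealCLM ∘ φ) := hc.comp_left rfl
  have hs : ContDiff ℝ ((⊤ : ℕ∞) : WithTop ℕ∞) (Complex.ofRealCLM ∘ φ) := by fun_prop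
  simpa using! h (hc'.toSchwartzMap hs)

theorem integral_mul_fourier_L2 (f : Lp ℂ 2 (volume : Measure ℝ)) (φ : SchwartzMap ℝ ℂ) :
    ∫ x, φ x * (𝓕 f : Lp ℂ 2 (volume : Measure ℝ)) x = ∫ x, (𝓕 φ) x * f x := by
  have := DFunLike.congr_fun (Lp.fourier_toTemperedDistribution_eq f) φ
  rw [TemperedDistribution.fourier_apply, Lp.toTemperedDistribution_apply,
    Lp.toTemperedDistribution_apply] at this
  simpa using this.symm

theorem integral_mul_fourierInv_L2 (f : Lp ℂ 2 (volume : Measure ℝ)) (φ : SchwartzMap ℝ ℂ) :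
    ∫ x, φ x * (𝓕⁻ f : Lp ℂ 2 (volume : Measure ℝ)) x = ∫ x, (𝓕⁻ φ) x * f x := by
  have := DFunLike.congr_fun (Lp.fourierInv_toTemperedDistribution_eq f) φ
  rw [TemperedDistribution.fourierInv_apply, Lp.toTemperedDistribution_apply,
    Lp.toTemperedDistribution_apply] at this
  simpa using this.symm

theorem integral_fourier_mul_of_integrable {φ H : ℝ → ℂ} (hφ : Integrable φ) (hH : Integrable H) :
    ∫ x, 𝓕 φ x * H x = ∫ x, φ x * 𝓕 H x := by
  have := VectorFourier.integral_fourierIntegral_smul_eq_flip (L := innerₗ ℝ)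
    Real.continuous_fourierChar continuous_inner hφ hH
  simpa [Real.fourier_eq, VectorFourier.fourierIntegral] using this

theorem integral_fourierInv_mul_of_integrable {φ H : ℝ → ℂ} (hφ : Integrable φ)
    (hH : Integrable H) :
    ∫ x, 𝓕⁻ φ x * H x = ∫ x, φ x * 𝓕⁻ H x := by
  have := integral_fourier_mul_of_integrable hφ hH.comp_neg
  simp_rw [fun x => Real.fourierInv_eq_fourier_neg φ x]
  rw [← integral_neg_eq_self]
  simpa [Real.fourierInv_eq_fourier_comp_neg] using this

theorem locallyIntegrable_fourierInv {H : ℝ → ℂ} (hH : Integrable H) :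
    LocallyIntegrable (𝓕⁻ H) := by
  have hc : Continuous (𝓕 H) := VectorFourier.fourierIntegral_continuous
    Real.continuous_fourierChar (L := innerₗ ℝ) continuous_inner hH
  have : 𝓕⁻ H = fun x => 𝓕 H (-x) := by
    ext x; exact Real.fourierInv_eq_fourier_neg H x
  rw [this]
  exact (hc.comp continuous_neg).locallyIntegrable

theorem L2_locallyIntegrable (f : Lp ℂ 2 (volume : Measure ℝ)) : LocallyIntegrable f :=
  (Lp.memLp f).locallyIntegrable (by norm_num)

/-- Fourier inversion for an `L²` function with integrable transform. -/
theorem ae_eq_fourierInv (f : Lp ℂ 2 (volume : Measure ℝ))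
    (h : Integrable (𝓕 f : Lp ℂ 2 (volume : Measure ℝ))) :
    f =ᵐ[volume] 𝓕⁻ ((𝓕 f : Lp ℂ 2 (volume : Measure ℝ)) : ℝ → ℂ) := by
  refine ae_eq_of_schwartz_test (L2_locallyIntegrable f) (locallyIntegrable_fourierInv h)
    fun φ => ?_
  rw [← integral_fourierInv_mul_of_integrable φ.integrable h]
  have := integral_mul_fourierInv_L2 (𝓕 f) φ
  rw [FourierTransform.fourierInv_fourier_eq] at this
  rw [this, SchwartzMap.fourierInv_coe]

/-- The `L²` transform of the inverse transform of an integrable function. -/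
theorem fourier_ae_eq_of_ae_eq_fourierInv (f : Lp ℂ 2 (volume : Measure ℝ)) {H : ℝ → ℂ}
    (hH : Integrable H) (h : f =ᵐ[volume] 𝓕⁻ H) :
    (𝓕 f : Lp ℂ 2 (volume : Measure ℝ)) =ᵐ[volume] H := by
  refine ae_eq_of_schwartz_test (L2_locallyIntegrable _) hH.locallyIntegrable fun φ => ?_
  rw [integral_mul_fourier_L2]
  have e : ∫ x, (𝓕 φ) x * f x = ∫ x, (𝓕 φ) x * 𝓕⁻ H x :=
    integral_congr_ae (h.mono fun x hx => by simp only [hx])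
  rw [e, ← integral_fourierInv_mul_of_integrable (𝓕 φ).integrable hH, 
    ← SchwartzMap.fourierInv_coe, FourierTransform.fourierInv_fourier_eq]


/-- The transform underlying `ft`, in Mathlib's normalisation. -/
def ftL2 (f : L2) : Lp ℂ 2 (volume : Measure ℝ) :=
  𝓕 (Complex.ofRealCLM.compLp f : Lp ℂ 2 (volume : Measure ℝ))

theorem ft_apply (f : L2) (ξ : ℝ) : ft f ξ = ftL2 f (ξ / (2 * Real.pi)) := rfl

theorem stronglyMeasurable_ft (f : L2) : StronglyMeasurable (ft f) :=
  (Lp.stronglyMeasurable (ftL2 f)).comp_measurable (by fun_prop)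

theorem ae_comp_div_two_pi {p : ℝ → Prop} (h : ∀ᵐ ξ : ℝ, p ξ) :
    ∀ᵐ ξ : ℝ, p (ξ / (2 * Real.pi)) := by
  have hq : Measure.QuasiMeasurePreserving (fun ξ : ℝ => ξ / (2 * Real.pi)) volume volume := by
    refine ⟨by fun_prop, ?_⟩
    have hne : (2 * Real.pi)⁻¹ ≠ 0 := by positivity
    have : (fun ξ : ℝ => ξ / (2 * Real.pi)) = fun ξ => ξ * (2 * Real.pi)⁻¹ := by
      ext; rw [div_eq_mul_inv]
    rw [this, Real.map_volume_mul_right hne]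
    exact Measure.smul_absolutelyContinuous
  exact hq.ae h

theorem ae_ft_of_ae_ftL2 {f : L2} {G : ℝ → ℂ} (h : ftL2 f =ᵐ[volume] G) :
    ∀ᵐ ξ : ℝ, ft f ξ = G (ξ / (2 * Real.pi)) :=
  ae_comp_div_two_pi h

theorem ftL2_sub (f g : L2) : ftL2 (f - g) = ftL2 f - ftL2 g := by
  have : (Complex.ofRealCLM.compLp (f - g) : Lp ℂ 2 (volume : Measure ℝ))
      = Complex.ofRealCLM.compLp f - Complex.ofRealCLM.compLp g :=
    map_sub (Complex.ofRealCLM.compLpL 2 (volume : Measure ℝ)) f g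
  unfold ftL2
  rw [this]
  exact map_sub (Lp.fourierTransformₗᵢ ℝ ℂ) _ _

theorem ftL2_smul (c : ℝ) (f : L2) : ftL2 (c • f) = (c : ℂ) • ftL2 f := by
  have : (Complex.ofRealCLM.compLp (c • f) : Lp ℂ 2 (volume : Measure ℝ))
      = (c : ℂ) • Complex.ofRealCLM.compLp f := by
    ext1
    filter_upwards [Lp.coeFn_smul c f, Complex.ofRealCLM.coeFn_compLp f,
      Complex.ofRealCLM.coeFn_compLp (c • f),
      Lp.coeFn_smul (c : ℂ) (Complex.ofRealCLM.compLp f : Lp ℂ 2 (volume : Measure ℝ))]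
      with x h1 h2 h3 h4
    rw [h3, h4, h1, Pi.smul_apply, Pi.smul_apply, h2]
    simp
  unfold ftL2
  rw [this]
  exact map_smul (Lp.fourierTransformₗᵢ ℝ ℂ) _ _

theorem ft_sub (f g : L2) : ∀ᵐ ξ : ℝ, ft (f - g) ξ = ft f ξ - ft g ξ := by
  refine ae_ft_of_ae_ftL2 (G := fun ξ => ftL2 f ξ - ftL2 g ξ) ?_
  rw [ftL2_sub]
  exact Lp.coeFn_sub _ _

theorem ft_smul (c : ℝ) (f : L2) : ∀ᵐ ξ : ℝ, ft (c • f) ξ = c * ft f ξ := by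
  refine ae_ft_of_ae_ftL2 (G := fun ξ => c * ftL2 f ξ) ?_
  rw [ftL2_smul]
  exact Lp.coeFn_smul _ _

theorem integrable_ftL2 {f : L2} (h : Integrable (ft f)) : Integrable (ftL2 f) := by
  have hne : 2 * Real.pi ≠ 0 := by positivity
  have := h.comp_mul_right' hne
  refine this.congr (Eventually.of_forall fun x => ?_)
  simp only [ft_apply]
  rw [mul_div_assoc, div_self hne, mul_one]

theorem integrable_norm_sq_ft (f : L2) : Integrable (fun ξ => ‖ft f ξ‖ ^ 2) := by
  have h := (Lp.memLp (ftL2 f)).integrable_norm_pow (p := 2) (by norm_num)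
  exact (h.comp_div (R := 2 * Real.pi) (by positivity) )

theorem conj_fourierInv (H : ℝ → ℂ) (x : ℝ) :
    𝓕⁻ (fun ξ => conj (H (-ξ))) x = conj (𝓕⁻ H x) := by
  rw [Real.fourierInv_eq', Real.fourierInv_eq', ← integral_conj, ← integral_neg_eq_self]
  congr 1
  ext ξ
  simp [← Complex.exp_conj, Complex.conj_ofNat]

/-- The transform of a real function is Hermitian. -/
theorem ft_neg {f : L2} (h : Integrable (ft f)) : ∀ᵐ ξ : ℝ, ft f (-ξ) = conj (ft f ξ) := by
  have hi := integrable_ftL2 h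
  have h1 := ae_eq_fourierInv _ hi
  have h2 : (Complex.ofRealCLM.compLp f : Lp ℂ 2 (volume : Measure ℝ))
      =ᵐ[volume] 𝓕⁻ (fun ξ => conj (ftL2 f (-ξ))) := by
    filter_upwards [h1, Complex.ofRealCLM.coeFn_compLp f] with x hx hr
    rw [conj_fourierInv]
    unfold ftL2
    rw [← hx, hr]
    simp
  have hi' : Integrable (fun ξ => conj (ftL2 f (-ξ))) :=
    (Complex.conjCLE.toContinuousLinearMap.integrable_comp hi.comp_neg)
  have h3 := fourier_ae_eq_of_ae_eq_fourierInv _ hi' h2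
  filter_upwards [ae_ft_of_ae_ftL2 h3] with ξ hξ
  rw [hξ, ft_apply, Complex.conj_conj, neg_div]

/-- The transform of a product is a convolution. -/
theorem ft_mul {f g h : L2} (hf : Integrable (ft f)) (hg : Integrable (ft g))
    (hfg : ∀ᵐ x : ℝ, h x = f x * g x) :
    ∀ᵐ ξ : ℝ, ft h ξ = (1 / (2 * Real.pi) : ℂ) * ∫ η : ℝ, ft f (ξ - η) * ft g η := by
  have hif := integrable_ftL2 hf
  have hig := integrable_ftL2 hg
  set H : ℝ → ℂ := MeasureTheory.convolution (ftL2 f) (ftL2 g) (ContinuousLinearMap.mul ℂ ℂ) volume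
    with hH
  have hHi : Integrable H := hif.integrable_convolution _ hig
  have h2 : (Complex.ofRealCLM.compLp h : Lp ℂ 2 (volume : Measure ℝ)) =ᵐ[volume] 𝓕⁻ H := by
    filter_upwards [ae_eq_fourierInv _ hif, ae_eq_fourierInv _ hig,
      Complex.ofRealCLM.coeFn_compLp f, Complex.ofRealCLM.coeFn_compLp g,
      Complex.ofRealCLM.coeFn_compLp h, hfg] with x h1 h2 h3 h4 h5 h6
    rw [Real.fourierInv_eq_fourier_neg, hH, Real.fourier_mul_convolution_eq hif hig,
      ← Real.fourierInv_eq_fourier_neg, ← Real.fourierInv_eq_fourier_neg]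
    unfold ftL2
    rw [← h1, ← h2, h3, h4, h5, h6]
    simp
  filter_upwards [ae_ft_of_ae_ftL2 (fourier_ae_eq_of_ae_eq_fourierInv _ hHi h2)] with ξ hξ
  have hpi : 0 < 2 * Real.pi := by positivity
  rw [hξ, hH, convolution_eq_swap]
  have := Measure.integral_comp_div (fun η => ftL2 f (ξ / (2 * Real.pi) - η) * ftL2 g η) (2 * Real.pi)
  simp only [ft_apply, sub_div]
  rw [this, abs_of_pos hpi]
  simp only [ContinuousLinearMap.mul_apply']
  rw [Complex.real_smul, ← mul_assoc]
  push_cast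
  rw [one_div, inv_mul_cancel₀, one_mul]
  exact_mod_cast hpi.ne'

/-! ### The resonance function and the cubic symbol -/

/-- The symbol `|ξ|^α ξ` of the dispersive term. -/
def om (α x : ℝ) : ℝ := |x| ^ α * x

theorem om_neg (α x : ℝ) : om α (-x) = -om α x := by simp [om]

theorem om_of_pos (α : ℝ) {x : ℝ} (hx : 0 < x) : om α x = x ^ α * x := by
  rw [om, abs_of_pos hx]

/-- The symbol `(W(a) + W(b) + W(c)) / (ω(a) + ω(b) + ω(c))` on the plane `a + b + c = 0`. -/
def sym (α : ℝ) (W : ℝ → ℝ) (a b c : ℝ) : ℝ :=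
  (W a + W b + W c) / (om α a + om α b + om α c)

theorem sym_swap (α : ℝ) (W : ℝ → ℝ) (a b c : ℝ) : sym α W b a c = sym α W a b c := by
  unfold sym; congr 1 <;> ring

theorem sym_swap' (α : ℝ) (W : ℝ → ℝ) (a b c : ℝ) : sym α W a c b = sym α W a b c := by
  unfold sym; congr 1 <;> ring

theorem sym_neg {α : ℝ} {W : ℝ → ℝ} (hW : ∀ x, W (-x) = -W x) (a b c : ℝ) :
    sym α W (-a) (-b) (-c) = sym α W a b c := by
  unfold sym
  rw [hW, hW, hW, om_neg, om_neg, om_neg, ← neg_div_neg_eq]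
  congr 1 <;> ring

theorem sym_zero {α : ℝ} {W : ℝ → ℝ} (hW : ∀ x, W (-x) = -W x) (a : ℝ) :
    sym α W a 0 (-a) = 0 := by
  have h0 : W 0 = 0 := by have := hW 0; rw [neg_zero] at this; linarith
  unfold sym
  rw [hW, h0]; simp

/-- A property of triples with sum zero that is invariant under permutations and reflection
holds in general once it holds for `a ≥ b ≥ 0 ≥ c`. -/
theorem triple_induction {P : ℝ → ℝ → ℝ → Prop}
    (swap : ∀ a b c, P a b c → P b a c) (swap' : ∀ a b c, P a b c → P a c b)
    (neg : ∀ a b c, P a b c → P (-a) (-b) (-c))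
    (base : ∀ a b, 0 ≤ b → b ≤ a → P a b (-(a + b))) (a b c : ℝ) (h : a + b + c = 0) :
    P a b c := by
  have base2 : ∀ a b, 0 ≤ a → 0 ≤ b → P a b (-(a + b)) := by
    intro a b ha hb
    rcases le_total a b with hab | hab
    · have := swap _ _ _ (base b a ha hab); rwa [add_comm b a] at this
    · exact base a b hb hab
  have base3 : ∀ a b c, a + b + c = 0 → 0 ≤ a → 0 ≤ b → P a b c := by
    intro a b c h ha hb
    have : c = -(a + b) := by linarith
    rw [this]; exact base2 a b ha hb
  have base4 : ∀ a b c, a + b + c = 0 → 0 ≤ a → P a b c := by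
    intro a b c h ha
    rcases le_total 0 b with hb | hb
    · exact base3 a b c h ha hb
    rcases le_total 0 c with hc | hc
    · exact swap' _ _ _ (base3 a c b (by linarith) ha hc)
    have := base3 (-b) (-c) (-a) (by linarith) (by linarith) (by linarith)
    have := neg _ _ _ this
    simp only [neg_neg] at this
    exact swap _ _ _ (swap' _ _ _ this)
  rcases le_total 0 a with ha | ha
  · exact base4 a b c h ha
  · have := neg _ _ _ (base4 (-a) (-b) (-c) (by linarith) (by linarith))
    simpa only [neg_neg] using this

/-- For `α > 0`: `y ↦ y^α` is concave, and `a + b` lies between `a` and `2 a`. -/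
theorem om_gap_of_pos {α : ℝ} (h0 : 0 < α) (h1 : α < 1) {a b : ℝ} (hb : 0 < b) (hba : b ≤ a) :
    (2 ^ α - 1) * b * a ^ α ≤ om α (a + b) - om α a - om α b := by
  have ha : 0 < a := hb.trans_le hba
  rw [om_of_pos α ha, om_of_pos α hb, om_of_pos α (by positivity)]
  have hc := (Real.concaveOn_rpow h0.le h1.le).2 (Set.mem_Ici.2 ha.le)
    (Set.mem_Ici.2 (by linarith : 0 ≤ 2 * a))
    (by rw [sub_nonneg]; exact (div_le_one ha).2 hba : 0 ≤ 1 - b / a)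
    (by positivity : 0 ≤ b / a) (by ring)
  simp only [smul_eq_mul] at hc
  have e : (1 - b / a) * a + b / a * (2 * a) = a + b := by field_simp; ring
  rw [e, Real.mul_rpow (by norm_num) ha.le] at hc
  have h2 : b ^ α ≤ (a + b) ^ α := Real.rpow_le_rpow hb.le (by linarith) h0.le
  have h3 : a * ((1 - b / a) * a ^ α + b / a * (2 ^ α * a ^ α)) ≤ a * (a + b) ^ α :=
    mul_le_mul_of_nonneg_left hc ha.le
  have e2 : a * ((1 - b / a) * a ^ α + b / a * (2 ^ α * a ^ α))
      = a * a ^ α + (2 ^ α - 1) * b * a ^ α := by field_simp; ring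
  rw [e2] at h3
  have h4 := mul_le_mul_of_nonneg_left h2 hb.le
  nlinarith

/-- For `α < 0`: Bernoulli's inequality for the exponent `1 + α ∈ (0, 1)`. -/
theorem om_gap_of_neg {α : ℝ} (h0 : -1 < α) (h1 : α < 0) {a b : ℝ} (hb : 0 < b) (hba : b ≤ a) :
    -α * b * b ^ α ≤ om α a + om α b - om α (a + b) := by
  have ha : 0 < a := hb.trans_le hba
  rw [om_of_pos α ha, om_of_pos α hb, om_of_pos α (by positivity)]
  have hB := rpow_one_add_le_one_add_mul_self (s := b / a) (p := 1 + α)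
    (by have : 0 < b / a := by positivity
        linarith) (by linarith) (by linarith)
  have e : a + b = a * (1 + b / a) := by field_simp
  have e1 : (a + b) ^ α * (a + b) = a ^ α * a * (1 + b / a) ^ (1 + α) := by
    have : (a + b) ^ α * (a + b) = (a + b) ^ (1 + α) := by
      rw [add_comm 1 α, Real.rpow_add_one (by positivity)]
    rw [this, e, Real.mul_rpow ha.le (by positivity), add_comm 1 α, Real.rpow_add_one ha.ne']
  rw [e1]
  have h2 : a ^ α ≤ b ^ α := Real.rpow_le_rpow_of_nonpos hb hba h1.le
  have h3 : a ^ α * a * (1 + b / a) ^ (1 + α) ≤ a ^ α * a * (1 + (1 + α) * (b / a)) :=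
    mul_le_mul_of_nonneg_left hB (by positivity)
  have e3 : a ^ α * a * (1 + (1 + α) * (b / a)) = a ^ α * a + (1 + α) * b * a ^ α := by
    field_simp
  rw [e3] at h3
  have h4 : (1 + α) * b * a ^ α ≤ (1 + α) * b * b ^ α :=
    mul_le_mul_of_nonneg_left h2 (mul_nonneg (by linarith) hb.le)
  nlinarith

/-- `τ` lies, up to a factor `2`, between the smallest and the largest of `|a|, |b|, |c|`. -/
def Between (τ a b c : ℝ) : Prop :=
  0 < τ ∧ (|a| ≤ 2 * τ ∨ |b| ≤ 2 * τ ∨ |c| ≤ 2 * τ) ∧ (τ ≤ 2 * |a| ∨ τ ≤ 2 * |b| ∨ τ ≤ 2 * |c|)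

theorem Between.swap {τ a b c : ℝ} (h : Between τ a b c) : Between τ b a c := by
  unfold Between at *; tauto

theorem Between.swap' {τ a b c : ℝ} (h : Between τ a b c) : Between τ a c b := by
  unfold Between at *; tauto

theorem Between.neg {τ a b c : ℝ} (h : Between τ a b c) : Between τ (-a) (-b) (-c) := by
  unfold Between at *; simpa only [abs_neg]

theorem Between.of_sorted {τ a b : ℝ} (hb : 0 ≤ b) (hba : b ≤ a)
    (h : Between τ a b (-(a + b))) : 0 < τ ∧ b ≤ 2 * τ ∧ τ ≤ 4 * a := by
  obtain ⟨h0, h1, h2⟩ := h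
  rw [abs_neg, abs_of_nonneg hb, abs_of_nonneg (hb.trans hba),
    abs_of_nonneg (by linarith)] at h1 h2
  refine ⟨h0, ?_, ?_⟩
  · rcases h1 with h | h | h <;> linarith
  · rcases h2 with h | h | h <;> linarith

/-- The constant in the lower bound for the resonance function. -/
def gapConst (α : ℝ) : ℝ := if 0 < α then (2 ^ α - 1) / 4 else -α / 2

theorem gapConst_pos {α : ℝ} (h0 : α ≠ 0) : 0 < gapConst α := by
  unfold gapConst
  split_ifs with h
  · have := Real.one_lt_rpow (x := 2) (by norm_num) h
    linarith
  · have : α < 0 := lt_of_le_of_ne (not_lt.1 h) h0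
    linarith

theorem om_gap_sorted {α : ℝ} (hm : -1 < α) (h1 : α < 1) (h0 : α ≠ 0) {a b τ : ℝ}
    (hb : 0 < b) (hba : b ≤ a) (hτ : Between τ a b (-(a + b))) :
    gapConst α * b * τ ^ α ≤ |om α a + om α b + om α (-(a + b))| := by
  obtain ⟨ht, h2, h3⟩ := hτ.of_sorted hb.le hba
  have ha : 0 < a := hb.trans_le hba
  rw [om_neg]
  unfold gapConst
  split_ifs with h
  · have hg := om_gap_of_pos h h1 hb hba
    have h4 : τ ^ α ≤ 4 * a ^ α := by
      calc τ ^ α ≤ (4 * a) ^ α := Real.rpow_le_rpow ht.le h3 h.le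
        _ = 4 ^ α * a ^ α := Real.mul_rpow (by norm_num) ha.le
        _ ≤ 4 ^ (1 : ℝ) * a ^ α := by gcongr; norm_num
        _ = _ := by norm_num
    have hc : (0 : ℝ) < 2 ^ α - 1 := by
      have := Real.one_lt_rpow (x := 2) (by norm_num) h
      linarith
    have : (2 ^ α - 1) / 4 * b * τ ^ α ≤ (2 ^ α - 1) * b * a ^ α := by
      calc (2 ^ α - 1) / 4 * b * τ ^ α ≤ (2 ^ α - 1) / 4 * b * (4 * a ^ α) := by gcongr
        _ = _ := by ring
    refine this.trans (hg.trans ?_)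
    rw [← abs_neg]
    exact le_trans (by linarith) (le_abs_self _)
  · have hn : α < 0 := lt_of_le_of_ne (not_lt.1 h) h0
    have hg := om_gap_of_neg hm hn hb hba
    have h4 : τ ^ α ≤ 2 * b ^ α := by
      calc τ ^ α ≤ (b / 2) ^ α := Real.rpow_le_rpow_of_nonpos (by positivity) (by linarith) hn.le
        _ = 2 ^ (-α) * b ^ α := by
            rw [Real.div_rpow hb.le (by norm_num), Real.rpow_neg (by norm_num)]; field_simp
        _ ≤ 2 ^ (1 : ℝ) * b ^ α := by gcongr <;> linarith
        _ = _ := by norm_num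
    have hc : 0 < -α := by linarith
    have : -α / 2 * b * τ ^ α ≤ -α * b * b ^ α := by
      calc -α / 2 * b * τ ^ α ≤ -α / 2 * b * (2 * b ^ α) := by gcongr
        _ = _ := by ring
    refine this.trans (hg.trans (le_trans (by linarith) (le_abs_self _)))

/-- Lower bound for the resonance function `ω(a) + ω(b) + ω(c)`, `a + b + c = 0`, by the smallest
frequency times `τ^α`. That `τ` may be chosen anywhere between the smallest and the largest
frequency treats both signs of `α` at once. -/
theorem om_gap {α : ℝ} (hm : -1 < α) (h1 : α < 1) (h0 : α ≠ 0) (a b c : ℝ) (h : a + b + c = 0) :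
    ∀ s τ : ℝ, 0 ≤ s → s ≤ |a| → s ≤ |b| → s ≤ |c| → Between τ a b c →
      gapConst α * s * τ ^ α ≤ |om α a + om α b + om α c| := by
  refine triple_induction (P := fun a b c => ∀ s τ : ℝ, 0 ≤ s → s ≤ |a| → s ≤ |b| → s ≤ |c| →
    Between τ a b c → gapConst α * s * τ ^ α ≤ |om α a + om α b + om α c|) ?_ ?_ ?_ ?_ a b c h
  · intro a b c H s τ hs ha hb hc ht
    rw [add_comm (om α b)]
    exact H s τ hs hb ha hc ht.swap
  · intro a b c H s τ hs ha hb hc ht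
    rw [add_right_comm]
    exact H s τ hs ha hc hb ht.swap'
  · intro a b c H s τ hs ha hb hc ht
    rw [abs_neg] at ha hb hc
    have := H s τ hs ha hb hc (by simpa using ht.neg)
    rw [om_neg, om_neg, om_neg, ← abs_neg]
    convert this using 2
    ring
  · intro a b hb hba s τ hs ha' hb' hc' ht
    rcases hs.eq_or_lt with rfl | hs
    · simp
    rw [abs_of_nonneg hb] at hb'
    have hbp : 0 < b := hs.trans_le hb'
    refine le_trans ?_ (om_gap_sorted hm h1 h0 hbp hba ht)
    have := gapConst_pos h0
    have := ht.1
    gcongr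

/-- `W` is odd and `|W'(x)| ≤ A |x|^p`, in integrated form. -/
structure IsWeight (W : ℝ → ℝ) (A p : ℝ) : Prop where
  odd : ∀ x, W (-x) = -W x
  lip : ∀ x y R, |x| ≤ R → |y| ≤ R → |W x - W y| ≤ A * R ^ p * |x - y|

theorem IsWeight.zero {W : ℝ → ℝ} {A p : ℝ} (h : IsWeight W A p) : W 0 = 0 := by
  have := h.odd 0; rw [neg_zero] at this; linarith

/-- The numerator vanishes to first order in the smallest frequency, and so does the
denominator. -/
theorem sym_le {α : ℝ} (hm : -1 < α) (h1 : α < 1) (h0 : α ≠ 0) {W : ℝ → ℝ} {A p : ℝ}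
    (hA : 0 ≤ A) (hW : IsWeight W A p) (a b c : ℝ) (h : a + b + c = 0) :
    ∀ τ R : ℝ, |a| ≤ R → |b| ≤ R → |c| ≤ R → Between τ a b c →
      |sym α W a b c| ≤ 2 / gapConst α * A * R ^ p * τ ^ (-α) := by
  refine triple_induction (P := fun a b c => ∀ τ R : ℝ, |a| ≤ R → |b| ≤ R → |c| ≤ R →
    Between τ a b c → |sym α W a b c| ≤ 2 / gapConst α * A * R ^ p * τ ^ (-α))
    ?_ ?_ ?_ ?_ a b c h
  · intro a b c H τ R ha hb hc ht
    rw [sym_swap]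
    exact H τ R hb ha hc ht.swap
  · intro a b c H τ R ha hb hc ht
    rw [sym_swap']
    exact H τ R ha hc hb ht.swap'
  · intro a b c H τ R ha hb hc ht
    rw [abs_neg] at ha hb hc
    rw [sym_neg hW.odd]
    exact H τ R ha hb hc (by simpa using ht.neg)
  · intro a b hb hba τ R ha' hb' hc' ht
    have hg := gapConst_pos h0
    have htp := ht.1
    have hR : 0 ≤ R := (abs_nonneg _).trans ha'
    rcases hb.eq_or_lt with rfl | hbp
    · rw [add_zero, sym_zero hW.odd, abs_zero]
      positivity
    have hgap := om_gap_sorted hm h1 h0 hbp hba ht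
    unfold sym
    rw [abs_div]
    have hpos : 0 < gapConst α * b * τ ^ α := by positivity
    rw [div_le_iff₀ (hpos.trans_le hgap)]
    have hn : |W a + W b + W (-(a + b))| ≤ 2 * A * R ^ p * b := by
      have e1 := hW.lip a (a + b) R ha' (by rwa [abs_neg] at hc')
      have e2 := hW.lip b 0 R hb' (by simpa using hR)
      rw [hW.zero] at e2
      have : |a - (a + b)| = b := by rw [sub_add_cancel_left, abs_neg, abs_of_pos hbp]
      rw [this] at e1
      rw [sub_zero, sub_zero, abs_of_pos hbp] at e2
      rw [hW.odd]
      calc |W a + W b + -W (a + b)| = |(W a - W (a + b)) + W b| := by congr 1; ring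
        _ ≤ _ := abs_add_le _ _
        _ ≤ _ := by linarith
    refine hn.trans ?_
    calc 2 * A * R ^ p * b
        = 2 / gapConst α * A * R ^ p * τ ^ (-α) * (gapConst α * b * τ ^ α) := by
          rw [Real.rpow_neg htp.le]; field_simp
      _ ≤ _ := by gcongr

/-! ### Second differences and damped weights -/

theorem abs_sub_le_of_deriv {f f' : ℝ → ℝ} {s : Set ℝ} (hs : Convex ℝ s) {K : ℝ}
    (hf : ∀ x ∈ s, HasDerivAt f (f' x) x) (hK : ∀ x ∈ s, |f' x| ≤ K) {x y : ℝ} (hx : x ∈ s)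
    (hy : y ∈ s) : |f x - f y| ≤ K * |x - y| :=
  hs.norm_image_sub_le_of_norm_hasDerivWithin_le (fun x hx => (hf x hx).hasDerivWithinAt) hK hy hx

/-- A second difference is controlled by the second derivative. -/
theorem abs_second_diff_le {f f' f'' : ℝ → ℝ} {s : Set ℝ} (hs : Convex ℝ s) {K : ℝ}
    (hf : ∀ x ∈ s, HasDerivAt f (f' x) x) (hf' : ∀ x ∈ s, HasDerivAt f' (f'' x) x)
    (hK : ∀ x ∈ s, |f'' x| ≤ K) {x b c : ℝ} (h0 : x ∈ s) (hb : x + b ∈ s) (hc : x + c ∈ s)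
    (hbc : x + b + c ∈ s) :
    |f (x + b + c) - f (x + b) - f (x + c) + f x| ≤ K * |b| * |c| := by
  have hseg : ∀ t ∈ segment ℝ x (x + c), t ∈ s ∧ t + b ∈ s := by
    intro t ht
    refine ⟨hs.segment_subset h0 hc ht, ?_⟩
    obtain ⟨u, v, hu, hv, huv, rfl⟩ := ht
    refine hs.segment_subset hb hbc ⟨u, v, hu, hv, huv, ?_⟩
    simp only [smul_eq_mul]
    linear_combination (b * huv)
  have := abs_sub_le_of_deriv (f := fun t => f (t + b) - f t) (f' := fun t => f' (t + b) - f' t)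
    (convex_segment x (x + c)) (K := K * |b|)
    (fun t ht => ((hf _ (hseg t ht).2).comp_add_const t b).sub (hf _ (hseg t ht).1))
    (fun t ht => by
      have := abs_sub_le_of_deriv hs hf' hK (hseg t ht).2 (hseg t ht).1
      simpa using this)
    (right_mem_segment ℝ x (x + c)) (left_mem_segment ℝ x (x + c))
  rw [add_sub_cancel_left] at this
  convert this using 2
  ring_nf

/-- Second differences of `ω` on `[r, ∞)`. -/
theorem abs_om_second_diff_le {α : ℝ} (hm : -1 < α) (h1 : α < 1) {x b c r : ℝ} (hr : 0 < r)
    (h0 : r ≤ x) (hb : r ≤ x + b) (hc : r ≤ x + c) (hbc : r ≤ x + b + c) :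
    |om α (x + b + c) - om α (x + b) - om α (x + c) + om α x| ≤ 2 * r ^ (α - 1) * |b| * |c| := by
  have key := abs_second_diff_le (f := fun x => x ^ (α + 1)) (f' := fun x => (α + 1) * x ^ α)
    (f'' := fun x => (α + 1) * (α * x ^ (α - 1))) (convex_Ici r) (K := 2 * r ^ (α - 1))
    (fun x hx => by
      have hx : 0 < x := hr.trans_le hx
      simpa using Real.hasDerivAt_rpow_const (x := x) (p := α + 1) (Or.inl hx.ne'))
    (fun x hx => by
      have hx : 0 < x := hr.trans_le hx
      exact (Real.hasDerivAt_rpow_const (x := x) (p := α) (Or.inl hx.ne')).const_mul _)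
    (fun x hx => by
      have hx0 : 0 < x := hr.trans_le hx
      have e : x ^ (α - 1) ≤ r ^ (α - 1) :=
        Real.rpow_le_rpow_of_nonpos hr hx (by linarith)
      rw [abs_mul, abs_mul, abs_of_pos (Real.rpow_pos_of_pos hx0 _), abs_of_pos (by linarith)]
      have h3 : |α| ≤ 1 := abs_le.2 ⟨by linarith, by linarith⟩
      have h4 : 0 < x ^ (α - 1) := Real.rpow_pos_of_pos hx0 _
      calc (α + 1) * (|α| * x ^ (α - 1)) ≤ 2 * (1 * x ^ (α - 1)) := by gcongr; linarith
        _ ≤ _ := by rw [one_mul]; gcongr)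
    (Set.mem_Ici.2 h0) (Set.mem_Ici.2 hb) (Set.mem_Ici.2 hc) (Set.mem_Ici.2 hbc)
  have e : ∀ y, r ≤ y → om α y = y ^ (α + 1) := fun y hy => by
    have : 0 < y := hr.trans_le hy
    rw [om_of_pos α this, Real.rpow_add_one this.ne']
  rw [e _ h0, e _ hb, e _ hc, e _ hbc]
  exact key

theorem isWeight_of_hasDerivAt {W W' : ℝ → ℝ} {A p : ℝ} (hA : 0 ≤ A) (hp : 0 ≤ p)
    (hodd : ∀ x, W (-x) = -W x) (hW : ∀ x, HasDerivAt W (W' x) x)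
    (hb : ∀ x, |W' x| ≤ A * |x| ^ p) : IsWeight W A p := by
  refine ⟨hodd, fun x y R hx hy => ?_⟩
  refine abs_sub_le_of_deriv (convex_Icc (-R) R) (fun x _ => hW x) (fun x hx => ?_)
    (abs_le.1 hx) (abs_le.1 hy)
  refine (hb x).trans ?_
  have : |x| ≤ R := abs_le.2 hx
  gcongr

/-- `|W''(x)| ≤ A |x|^(p-1)`, in integrated form. -/
def SecondDiffBound (W : ℝ → ℝ) (A p : ℝ) : Prop :=
  ∀ x b c R, 0 < R → |x| ≤ R → |x + b| ≤ R → |x + c| ≤ R → |x + b + c| ≤ R →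
    |W (x + b + c) - W (x + b) - W (x + c) + W x| ≤ A * R ^ (p - 1) * |b| * |c|

/-- The weight `ξ^(2k)`, damped at frequencies beyond `δ^(-1/2)`. For `δ > 0` the exponent `k + 1`
makes `ξ w(ξ)` decay like `1/ξ`; for `δ = 0` the weight is `ξ^(2k)` itself. -/
def wt (k : ℕ) (δ x : ℝ) : ℝ := x ^ (2 * k) / (1 + δ * x ^ 2) ^ (k + 1)

/-- The odd function `ξ ↦ ξ w(ξ)` for the damped weight `w`. -/
def Wt (k : ℕ) (δ x : ℝ) : ℝ := x * wt k δ x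

theorem Wt_neg (k : ℕ) (δ x : ℝ) : Wt k δ (-x) = -Wt k δ x := by
  simp [Wt, wt, pow_mul]

/-- The derivative of `Wt k δ`. -/
def Wt' (k : ℕ) (δ x : ℝ) : ℝ :=
  x ^ (2 * k) * ((2 * k + 1) - δ * x ^ 2) / (1 + δ * x ^ 2) ^ (k + 2)

theorem hasDerivAt_Wt {k : ℕ} {δ : ℝ} (hδ : 0 ≤ δ) (x : ℝ) :
    HasDerivAt (Wt k δ) (Wt' k δ x) x := by
  have hD : 0 < 1 + δ * x ^ 2 := by positivity
  have h1 : HasDerivAt (fun x : ℝ => 1 + δ * x ^ 2) (δ * (2 * x)) x := by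
    have := ((hasDerivAt_pow 2 x).const_mul δ).const_add 1
    simpa using this
  have h2 := (hasDerivAt_pow (2 * k + 1) x).div (h1.pow (k + 1)) (pow_ne_zero _ hD.ne')
  have e : Wt k δ = fun x => x ^ (2 * k + 1) / (1 + δ * x ^ 2) ^ (k + 1) := by
    ext x; rw [Wt, wt, pow_succ]; ring
  rw [e]
  refine h2.congr_deriv ?_
  simp only [Nat.add_sub_cancel, Wt', Pi.pow_apply]
  rw [div_eq_div_iff (by positivity) (by positivity)]
  push_cast
  ring

theorem abs_Wt'_le {k : ℕ} {δ : ℝ} (hδ : 0 ≤ δ) (x : ℝ) :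
    |Wt' k δ x| ≤ (2 * k + 1) * |x| ^ (2 * k) / (1 + δ * x ^ 2) ^ (k + 1) := by
  have hD : 0 < 1 + δ * x ^ 2 := by positivity
  have hy : 0 ≤ δ * x ^ 2 := by positivity
  have hk : (0 : ℝ) ≤ k := by positivity
  rw [Wt', abs_div, abs_mul, abs_pow, abs_of_pos (pow_pos hD _)]
  have : |2 * (k : ℝ) + 1 - δ * x ^ 2| ≤ (2 * k + 1) * (1 + δ * x ^ 2) := by
    rw [abs_le]; constructor <;> nlinarith
  rw [div_le_div_iff₀ (by positivity) (by positivity)]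
  calc |x| ^ (2 * k) * |2 * (k : ℝ) + 1 - δ * x ^ 2| * (1 + δ * x ^ 2) ^ (k + 1)
      ≤ |x| ^ (2 * k) * ((2 * k + 1) * (1 + δ * x ^ 2)) * (1 + δ * x ^ 2) ^ (k + 1) := by gcongr
    _ = _ := by ring

theorem isWeight_Wt {k : ℕ} {δ : ℝ} (hδ : 0 ≤ δ) : IsWeight (Wt k δ) (2 * k + 1) (2 * k) := by
  refine isWeight_of_hasDerivAt (by positivity) (by positivity) (Wt_neg k δ)
    (hasDerivAt_Wt hδ) fun x => (abs_Wt'_le hδ x).trans ?_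
  have : (1 : ℝ) ≤ (1 + δ * x ^ 2) ^ (k + 1) := one_le_pow₀ (by nlinarith [sq_nonneg x])
  have e : |x| ^ (2 * (k : ℝ)) = |x| ^ (2 * k) := by
    rw [← Real.rpow_natCast]; push_cast; rfl
  rw [e]
  exact div_le_self (by positivity) this

/-- With damping, the weight also has every smaller growth. -/
theorem isWeight_Wt_of_pos {k : ℕ} {δ : ℝ} (hδ : 0 < δ) {p : ℝ} (hp : 0 ≤ p) (hpk : p ≤ 2 * k) :
    IsWeight (Wt k δ) ((2 * k + 1) * (1 + (δ ^ k)⁻¹)) p := by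
  refine isWeight_of_hasDerivAt (by positivity) hp (Wt_neg k δ)
    (hasDerivAt_Wt hδ.le) fun x => (abs_Wt'_le hδ.le x).trans ?_
  have hD : 1 ≤ 1 + δ * x ^ 2 := by nlinarith [sq_nonneg x]
  have h1 : (1 : ℝ) ≤ (1 + δ * x ^ 2) ^ (k + 1) := one_le_pow₀ hD
  have hx := abs_nonneg x
  rcases le_total |x| 1 with h | h
  · have e : |x| ^ (2 * k) ≤ |x| ^ p := by
      rcases hx.eq_or_lt with h0 | h0
      · rw [← h0]
        rcases Nat.eq_zero_or_pos k with rfl | hk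
        · have : p = 0 := by push_cast at hpk; linarith
          rw [this]; simp
        · rw [zero_pow (by omega)]; positivity
      · rw [← Real.rpow_natCast]
        exact Real.rpow_le_rpow_of_exponent_ge h0 h (by push_cast; exact hpk)
    calc _ ≤ (2 * k + 1) * |x| ^ (2 * k) := div_le_self (by positivity) h1
      _ ≤ (2 * k + 1) * |x| ^ p := by gcongr
      _ ≤ _ := by
        rw [mul_assoc]
        gcongr
        exact le_mul_of_one_le_left (by positivity) (by simp; positivity)
  · have e : 1 ≤ |x| ^ p := Real.one_le_rpow h hp
    have h2 : δ ^ k * |x| ^ (2 * k) ≤ (1 + δ * x ^ 2) ^ (k + 1) := by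
      calc δ ^ k * |x| ^ (2 * k) = (δ * x ^ 2) ^ k := by rw [mul_pow, pow_mul, sq_abs]
        _ ≤ (1 + δ * x ^ 2) ^ k := by gcongr; linarith
        _ ≤ _ := pow_le_pow_right₀ hD (by omega)
    have h3 : (2 * k + 1) * |x| ^ (2 * k) / (1 + δ * x ^ 2) ^ (k + 1)
        ≤ (2 * k + 1) * (δ ^ k)⁻¹ := by
      rw [div_le_iff₀ (by positivity)]
      calc (2 * (k : ℝ) + 1) * |x| ^ (2 * k)
          = (2 * k + 1) * (δ ^ k)⁻¹ * (δ ^ k * |x| ^ (2 * k)) := by field_simp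
        _ ≤ _ := by gcongr
    refine h3.trans ?_
    calc (2 * (k : ℝ) + 1) * (δ ^ k)⁻¹ ≤ (2 * k + 1) * (1 + (δ ^ k)⁻¹) * 1 := by
          rw [mul_one]; gcongr; linarith
      _ ≤ _ := by gcongr

/-- The second derivative of `Wt k δ`. The truncated exponent `2 * k - 1` is harmless, since
the definition is used for `k ≥ 1` only. -/
def Wt'' (k : ℕ) (δ x : ℝ) : ℝ :=
  x ^ (2 * k - 1) * (2 * k * ((2 * k + 1) - δ * x ^ 2) * (1 + δ * x ^ 2)
    - 2 * (δ * x ^ 2) * (1 + δ * x ^ 2)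
    - 2 * (k + 2) * (δ * x ^ 2) * ((2 * k + 1) - δ * x ^ 2)) / (1 + δ * x ^ 2) ^ (k + 3)

theorem hasDerivAt_Wt' {k : ℕ} (hk : 1 ≤ k) {δ : ℝ} (hδ : 0 ≤ δ) (x : ℝ) :
    HasDerivAt (Wt' k δ) (Wt'' k δ x) x := by
  obtain ⟨j, rfl⟩ := Nat.exists_eq_add_of_le' hk
  have hD : 0 < 1 + δ * x ^ 2 := by positivity
  have h0 : HasDerivAt (fun x : ℝ => δ * x ^ 2) (δ * (2 * x)) x := by
    simpa using ((hasDerivAt_pow 2 x).const_mul δ)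
  have h1 : HasDerivAt (fun x : ℝ => 1 + δ * x ^ 2) (δ * (2 * x)) x := h0.const_add 1
  have h2 := ((hasDerivAt_pow (2 * (j + 1)) x).mul
    (h0.const_sub (2 * ((j + 1 : ℕ) : ℝ) + 1))).div
    (h1.pow (j + 1 + 2)) (pow_ne_zero _ hD.ne')
  refine h2.congr_deriv ?_
  have e : 2 * (j + 1) - 1 = 2 * j + 1 := by omega
  simp only [Wt'', Pi.pow_apply, Pi.mul_apply, e]
  rw [div_eq_div_iff (by positivity) (by positivity)]
  have e2 : j + 1 + 2 - 1 = j + 2 := by omega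
  rw [e2]
  push_cast
  ring

theorem abs_Wt''_le {k : ℕ} {δ : ℝ} (hδ : 0 ≤ δ) (x : ℝ) :
    |Wt'' k δ x| ≤ (2 * k + 6) ^ 2 * |x| ^ (2 * k - 1) := by
  have hD : 1 ≤ 1 + δ * x ^ 2 := by nlinarith [sq_nonneg x]
  have hy : 0 ≤ δ * x ^ 2 := by positivity
  have hk : (0 : ℝ) ≤ k := by positivity
  rw [Wt'', abs_div, abs_mul, abs_pow, abs_of_pos (pow_pos (by linarith : 0 < 1 + δ * x ^ 2) _)]
  set y := δ * x ^ 2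
  set K : ℝ := (k : ℝ) with hK
  have : |2 * K * (2 * K + 1 - y) * (1 + y) - 2 * y * (1 + y) - 2 * (K + 2) * y * (2 * K + 1 - y)|
      ≤ (2 * K + 6) ^ 2 * (1 + y) ^ 2 := by
    have hKy := mul_nonneg hk hy
    have hKK := mul_nonneg hk hk
    have hyy := mul_nonneg hy hy
    have hKyy := mul_nonneg hk hyy
    have hKKy := mul_nonneg hKK hy
    have hKKyy := mul_nonneg hKK hyy
    rw [abs_le]; constructor <;> nlinarith
  rw [div_le_iff₀ (by positivity)]
  calc _ ≤ |x| ^ (2 * k - 1) * ((2 * K + 6) ^ 2 * (1 + y) ^ 2) := by gcongr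
    _ = (2 * K + 6) ^ 2 * |x| ^ (2 * k - 1) * (1 + y) ^ 2 := by ring
    _ ≤ _ := by gcongr; omega

theorem secondDiffBound_Wt {k : ℕ} (hk : 1 ≤ k) {δ : ℝ} (hδ : 0 ≤ δ) :
    SecondDiffBound (Wt k δ) ((2 * k + 6) ^ 2) (2 * k) := by
  intro x b c R hR h0 hb hc hbc
  refine abs_second_diff_le (convex_Icc (-R) R) (fun x _ => hasDerivAt_Wt hδ x)
    (fun x _ => hasDerivAt_Wt' hk hδ x) (fun x hx => (abs_Wt''_le hδ x).trans ?_)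
    (abs_le.1 h0) (abs_le.1 hb) (abs_le.1 hc) (abs_le.1 hbc)
  have : |x| ≤ R := abs_le.2 hx
  have e : R ^ (2 * (k : ℝ) - 1) = R ^ (2 * k - 1) := by
    rw [← Real.rpow_natCast, Nat.cast_sub (by omega)]; push_cast; rfl
  rw [e]
  gcongr

/-! ### The quartic symbol -/

theorem sym_zero' {α : ℝ} {W : ℝ → ℝ} (hW : ∀ x, W (-x) = -W x) (a : ℝ) :
    sym α W a 0 (-(a + 0)) = 0 := by rw [add_zero]; exact sym_zero hW a

/-- The interaction of two high frequencies `x`, `y = -(x + b + c)` with two low frequencies `b`,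
`c`. The two terms on the left are of size `|x|^(p+1) τ^(-α)`; their difference gains the factor
`τ / |x|`, because it consists of second differences of `W` and `ω`. -/
theorem sym_sub_le_of_pos {α : ℝ} (hm : -1 < α) (h1 : α < 1) (h0 : α ≠ 0) {W : ℝ → ℝ} {A p : ℝ}
    (hA : 0 ≤ A) (hW : IsWeight W A p) (hW2 : SecondDiffBound W A p) {x b c τ : ℝ} (hτ : 0 < τ)
    (hb : |b| ≤ τ) (hc : |c| ≤ τ) (hx : 4 * τ ≤ x) :
    |sym α W x b (-(x + b)) * (x + b) - sym α W (x + c) b (-(x + c + b)) * (x + c)|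
      ≤ (A * 2 ^ p * (4 / gapConst α) + A * 2 ^ (p - 1) / gapConst α
        + A * 2 ^ p * 4 * 2 ^ (1 - α) / gapConst α ^ 2) * (x ^ p * τ ^ (1 - α)) := by
  have hg := gapConst_pos h0
  have hxp : 0 < x := by linarith
  obtain ⟨hb1, hb2⟩ := abs_le.1 hb
  obtain ⟨hc1, hc2⟩ := abs_le.1 hc
  rcases eq_or_ne b 0 with rfl | hb0
  · rw [sym_zero' hW.odd, sym_zero' hW.odd]
    simp only [zero_mul, sub_zero, abs_zero]
    positivity
  have hbp : 0 < |b| := abs_pos.2 hb0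
  have ax : |x| = x := abs_of_pos hxp
  have axc : |x + c| = x + c := abs_of_pos (by linarith)
  have axb : |x + b| = x + b := abs_of_pos (by linarith)
  have axcb : |x + c + b| = x + c + b := abs_of_pos (by linarith)
  have bt1 : Between τ x b (-(x + b)) :=
    ⟨hτ, Or.inr (Or.inl (by linarith)), Or.inl (by rw [ax]; linarith)⟩
  have bt2 : Between τ (x + c) b (-(x + c + b)) :=
    ⟨hτ, Or.inr (Or.inl (by linarith)), Or.inl (by rw [axc]; linarith)⟩
  have btx : Between x x b (-(x + b)) :=
    ⟨hxp, Or.inr (Or.inl (by linarith)), Or.inl (by rw [ax]; linarith)⟩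
  -- the numerators and denominators of the two symbols
  set n1 := W x + W b + W (-(x + b)) with hn1
  set n2 := W (x + c) + W b + W (-(x + c + b)) with hn2
  set d1 := om α x + om α b + om α (-(x + b)) with hd1
  set d2 := om α (x + c) + om α b + om α (-(x + c + b)) with hd2
  have hs1 : |sym α W x b (-(x + b))| ≤ 2 / gapConst α * A * (2 * x) ^ p * τ ^ (-α) :=
    sym_le hm h1 h0 hA hW _ _ _ (by ring) τ (2 * x) (by linarith) (by linarith)
      (by rw [abs_neg]; linarith) bt1
  have hs2 : |sym α W (x + c) b (-(x + c + b))| ≤ 2 / gapConst α * A * (2 * x) ^ p * τ ^ (-α) :=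
    sym_le hm h1 h0 hA hW _ _ _ (by ring) τ (2 * x) (by linarith) (by linarith)
      (by rw [abs_neg]; linarith) bt2
  -- `d1` is bounded below in two ways: in the term with `d1 - d2` the factor `x^α` has to
  -- compensate the growth of `ω''(x)`, while the others are stated in terms of `τ^α`
  have hd1x : gapConst α * |b| * x ^ α ≤ |d1| :=
    om_gap hm h1 h0 _ _ _ (by ring) _ _ hbp.le (by linarith) le_rfl
      (by rw [abs_neg]; linarith) btx
  have hd1τ : gapConst α * |b| * τ ^ α ≤ |d1| :=
    om_gap hm h1 h0 _ _ _ (by ring) _ _ hbp.le (by linarith) le_rfl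
      (by rw [abs_neg]; linarith) bt1
  have hd2τ : gapConst α * |b| * τ ^ α ≤ |d2| :=
    om_gap hm h1 h0 _ _ _ (by ring) _ _ hbp.le (by linarith) le_rfl
      (by rw [abs_neg]; linarith) bt2
  have hnn : |n1 - n2| ≤ A * (2 * x) ^ (p - 1) * |b| * |c| := by
    have := hW2 x b c (2 * x) (by linarith) (by linarith) (by linarith) (by linarith)
      (by rw [add_right_comm]; linarith)
    convert this using 2
    rw [hn1, hn2, hW.odd, hW.odd, add_right_comm x c b]
    ring
  have hdd : |d1 - d2| ≤ 2 * (x / 2) ^ (α - 1) * |b| * |c| := by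
    have := abs_om_second_diff_le hm h1 (x := x) (b := b) (c := c) (r := x / 2) (by linarith)
      (by linarith) (by linarith) (by linarith) (by linarith)
    convert this using 2
    rw [hd1, hd2, om_neg, om_neg, add_right_comm x c b]
    ring
  have hn2b : |n2| ≤ 2 * A * (2 * x) ^ p * |b| := by
    have e1 := hW.lip (x + c) (x + c + b) (2 * x) (by linarith) (by linarith)
    have e2 := hW.lip b 0 (2 * x) (by linarith) (by simpa using by linarith)
    rw [hW.zero, sub_zero, sub_zero] at e2
    rw [sub_add_cancel_left, abs_neg] at e1
    calc |n2| = |(W (x + c) - W (x + c + b)) + W b| := by rw [hn2, hW.odd]; congr 1; ring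
      _ ≤ _ := abs_add_le _ _
      _ ≤ _ := by linarith
  have hd1p : 0 < |d1| := lt_of_lt_of_le (by positivity) hd1τ
  have hd2p : 0 < |d2| := lt_of_lt_of_le (by positivity) hd2τ
  have t1 : |(n1 - n2) / d1| ≤ A * (2 * x) ^ (p - 1) * |b| * |c| / (gapConst α * |b| * τ ^ α) := by
    rw [abs_div]
    gcongr
  have t2 : |n2 * (d1 - d2) / (d1 * d2)| ≤ (2 * A * (2 * x) ^ p * |b|)
      * (2 * (x / 2) ^ (α - 1) * |b| * |c|)
      / ((gapConst α * |b| * x ^ α) * (gapConst α * |b| * τ ^ α)) := by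
    rw [abs_div, abs_mul, abs_mul]
    gcongr
  have hdiff : sym α W x b (-(x + b)) - sym α W (x + c) b (-(x + c + b))
      = (n1 - n2) / d1 - n2 * (d1 - d2) / (d1 * d2) := by
    have := abs_pos.1 hd1p
    have := abs_pos.1 hd2p
    change n1 / d1 - n2 / d2 = _
    field_simp
    ring
  have e1 : (2 * x) ^ (p - 1) = 2 ^ (p - 1) * (x ^ p / x) := by
    rw [Real.mul_rpow (by norm_num) hxp.le, Real.rpow_sub_one hxp.ne']
  have e2 : (x / 2) ^ (α - 1) = 2 ^ (1 - α) * (x ^ α / x) := by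
    rw [Real.div_rpow hxp.le (by norm_num), Real.rpow_sub_one hxp.ne',
      show (1 - α) = -(α - 1) by ring, Real.rpow_neg (by norm_num)]
    field_simp
  have e3 : (2 * x) ^ p = 2 ^ p * x ^ p := Real.mul_rpow (by norm_num) hxp.le
  have e4 : τ ^ (1 - α) = τ * τ ^ (-α) := by
    rw [show (1 - α) = -α + 1 by ring, Real.rpow_add_one hτ.ne']; ring
  have e5 : (τ ^ α)⁻¹ = τ ^ (-α) := (Real.rpow_neg hτ.le α).symm
  have f1 : A * (2 * x) ^ (p - 1) * |b| * |c| / (gapConst α * |b| * τ ^ α) * x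
      = A * 2 ^ (p - 1) / gapConst α * (x ^ p * (|c| * τ ^ (-α))) := by
    rw [e1, ← e5]; field_simp
  have f2 : (2 * A * (2 * x) ^ p * |b|) * (2 * (x / 2) ^ (α - 1) * |b| * |c|)
      / ((gapConst α * |b| * x ^ α) * (gapConst α * |b| * τ ^ α)) * x
      = A * 2 ^ p * 4 * 2 ^ (1 - α) / gapConst α ^ 2 * (x ^ p * (|c| * τ ^ (-α))) := by
    rw [e2, e3, ← e5]; field_simp; ring
  have hτα : 0 < τ ^ (-α) := Real.rpow_pos_of_pos hτ _
  have hxpp : 0 < x ^ p := Real.rpow_pos_of_pos hxp _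
  have hcτ : x ^ p * (|c| * τ ^ (-α)) ≤ x ^ p * τ ^ (1 - α) := by rw [e4]; gcongr
  set H1 := sym α W x b (-(x + b))
  set H2 := sym α W (x + c) b (-(x + c + b))
  have hH : |H1 - H2| * x ≤ (A * 2 ^ (p - 1) / gapConst α
        + A * 2 ^ p * 4 * 2 ^ (1 - α) / gapConst α ^ 2) * (x ^ p * τ ^ (1 - α)) := by
    have : |H1 - H2| ≤ A * (2 * x) ^ (p - 1) * |b| * |c| / (gapConst α * |b| * τ ^ α)
        + (2 * A * (2 * x) ^ p * |b|) * (2 * (x / 2) ^ (α - 1) * |b| * |c|)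
      / ((gapConst α * |b| * x ^ α) * (gapConst α * |b| * τ ^ α)) := by
      rw [hdiff]
      exact (abs_sub _ _).trans (add_le_add t1 t2)
    calc |H1 - H2| * x ≤ _ * x := mul_le_mul_of_nonneg_right this hxp.le
      _ = (A * 2 ^ (p - 1) / gapConst α + A * 2 ^ p * 4 * 2 ^ (1 - α) / gapConst α ^ 2)
          * (x ^ p * (|c| * τ ^ (-α))) := by rw [add_mul, f1, f2]; ring
      _ ≤ _ := by gcongr
  have hHb : |H1| * |b| ≤ A * 2 ^ p * (2 / gapConst α) * (x ^ p * τ ^ (1 - α)) := by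
    calc |H1| * |b| ≤ (2 / gapConst α * A * (2 * x) ^ p * τ ^ (-α)) * τ := by gcongr
      _ = _ := by rw [e3, e4]; ring
  have hHc : |H2| * |c| ≤ A * 2 ^ p * (2 / gapConst α) * (x ^ p * τ ^ (1 - α)) := by
    calc |H2| * |c| ≤ (2 / gapConst α * A * (2 * x) ^ p * τ ^ (-α)) * τ := by gcongr
      _ = _ := by rw [e3, e4]; ring
  calc |H1 * (x + b) - H2 * (x + c)| = |(H1 - H2) * x + H1 * b - H2 * c| := by congr 1; ring
    _ ≤ |(H1 - H2) * x| + |H1 * b| + |H2 * c| :=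
        (abs_sub _ _).trans (add_le_add (abs_add_le _ _) le_rfl)
    _ = |H1 - H2| * x + |H1| * |b| + |H2| * |c| := by rw [abs_mul, abs_mul, abs_mul, ax]
    _ ≤ _ := by
      have : A * 2 ^ p * (4 / gapConst α) = 2 * (A * 2 ^ p * (2 / gapConst α)) := by ring
      rw [this]
      linarith

/-- The constant in the estimates of the quartic symbol. -/
def diffConst (α A p : ℝ) : ℝ :=
  A * 2 ^ p * (4 / gapConst α) + A * 2 ^ (p - 1) / gapConst α
    + A * 2 ^ p * 4 * 2 ^ (1 - α) / gapConst α ^ 2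

/-- The gain of one derivative in the interaction of two high and two low frequencies. -/
theorem sym_sub_le {α : ℝ} (hm : -1 < α) (h1 : α < 1) (h0 : α ≠ 0) {W : ℝ → ℝ} {A p : ℝ}
    (hA : 0 ≤ A) (hW : IsWeight W A p) (hW2 : SecondDiffBound W A p) {x b c τ : ℝ} (hτ : 0 < τ)
    (hb : |b| ≤ τ) (hc : |c| ≤ τ) (hx : 4 * τ ≤ |x|) :
    |sym α W x b (-(x + b)) * (x + b) - sym α W (x + c) b (-(x + c + b)) * (x + c)|
      ≤ diffConst α A p * (|x| ^ p * τ ^ (1 - α)) := by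
  rcases le_total 0 x with h | h
  · rw [abs_of_nonneg h] at hx ⊢
    exact sym_sub_le_of_pos hm h1 h0 hA hW hW2 hτ hb hc hx
  · rw [abs_of_nonpos h] at hx ⊢
    have := sym_sub_le_of_pos hm h1 h0 hA hW hW2 (x := -x) (b := -b) (c := -c) hτ
      (by rwa [abs_neg]) (by rwa [abs_neg]) hx
    have e1 : sym α W (-x) (-b) (-(-x + -b)) = sym α W x b (-(x + b)) := by
      rw [← sym_neg hW.odd]; congr 1 <;> ring
    have e2 : sym α W (-x + -c) (-b) (-(-x + -c + -b)) = sym α W (x + c) b (-(x + c + b)) := by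
      rw [← sym_neg hW.odd]; congr 1 <;> ring
    rw [e1, e2, ← abs_neg] at this
    refine le_trans (le_of_eq ?_) this
    congr 1; ring

/-- The symbol of one of the six pairings of four frequencies with sum zero. -/
def pairSym (α : ℝ) (W : ℝ → ℝ) (a b : ℝ) : ℝ := sym α W a b (-(a + b)) * (a + b)

theorem pairSym_comm (α : ℝ) (W : ℝ → ℝ) (a b : ℝ) : pairSym α W a b = pairSym α W b a := by
  unfold pairSym; rw [sym_swap, add_comm]

/-- The symmetrised symbol of the quartic term. -/
def quadSym (α : ℝ) (W : ℝ → ℝ) (x y b c : ℝ) : ℝ :=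
  pairSym α W x y + pairSym α W x b + pairSym α W x c + pairSym α W y b + pairSym α W y c
    + pairSym α W b c

theorem abs_pairSym_le {α : ℝ} (hm : -1 < α) (h1 : α < 1) (h0 : α ≠ 0) {W : ℝ → ℝ} {A p : ℝ}
    (hA : 0 ≤ A) (hW : IsWeight W A p) {a b τ R L : ℝ} (ha : |a| ≤ R) (hb : |b| ≤ R)
    (hL : |a + b| ≤ L * τ) (hbt : Between τ a b (-(a + b))) :
    |pairSym α W a b| ≤ 2 / gapConst α * A * L * 2 ^ p * (R ^ p * τ ^ (1 - α)) := by
  have hR : 0 ≤ R := (abs_nonneg a).trans ha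
  have hg := gapConst_pos h0
  have hτ := hbt.1
  have h := sym_le hm h1 h0 hA hW a b (-(a + b)) (by ring) τ (2 * R) (by linarith) (by linarith)
    (by rw [abs_neg]; exact (abs_add_le _ _).trans (by linarith)) hbt
  rw [pairSym, abs_mul]
  have e4 : τ ^ (1 - α) = τ * τ ^ (-α) := by
    rw [show (1 - α) = -α + 1 by ring, Real.rpow_add_one hτ.ne']; ring
  calc _ ≤ (2 / gapConst α * A * (2 * R) ^ p * τ ^ (-α)) * (L * τ) := by gcongr
    _ = _ := by rw [Real.mul_rpow (by norm_num) hR, e4]; ring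

/-- The constant in `abs_quadSym_le_sorted`. -/
def quadConst (α A p : ℝ) : ℝ := 72 / gapConst α * A * 2 ^ p + 2 * diffConst α A p

theorem diffConst_nonneg {α A p : ℝ} (h0 : α ≠ 0) (hA : 0 ≤ A) : 0 ≤ diffConst α A p := by
  have := gapConst_pos h0
  unfold diffConst
  positivity

theorem quadConst_nonneg {α A p : ℝ} (h0 : α ≠ 0) (hA : 0 ≤ A) : 0 ≤ quadConst α A p := by
  have := gapConst_pos h0
  have := diffConst_nonneg (p := p) h0 hA
  unfold quadConst
  positivity

/-- For frequencies sorted by modulus the quartic symbol is bounded by the largest frequency to the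
power `p` and the third largest to the power `1 - α`: no derivative is lost on the high
frequencies. -/
theorem abs_quadSym_le_sorted {α : ℝ} (hm : -1 < α) (h1 : α < 1) (h0 : α ≠ 0) {W : ℝ → ℝ}
    {A p : ℝ} (hA : 0 ≤ A) (hW : IsWeight W A p) (hW2 : SecondDiffBound W A p) {x y b c : ℝ}
    (hsum : x + y + b + c = 0) (hyx : |y| ≤ |x|) (hby : |b| ≤ |y|) (hcb : |c| ≤ |b|) :
    |quadSym α W x y b c| ≤ quadConst α A p * (|x| ^ p * |b| ^ (1 - α)) := by
  have hg := gapConst_pos h0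
  have hD := diffConst_nonneg (p := p) h0 hA
  have hQ := quadConst_nonneg (p := p) h0 hA
  rcases eq_or_ne b 0 with rfl | hb0
  · have hc : c = 0 := by simpa using hcb
    have hy : y = -x := by linarith
    subst hc hy
    simp only [quadSym, pairSym, sym_zero' hW.odd]
    simp only [add_neg_cancel, mul_zero, zero_mul, add_zero, abs_zero]
    positivity
  set τ := |b| with hτd
  have hτ : 0 < τ := abs_pos.2 hb0
  set Z := |x| ^ p * τ ^ (1 - α) with hZ
  have hZ0 : 0 ≤ Z := by positivity
  set B := 2 / gapConst α * A * 2 ^ p with hB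
  have hB0 : 0 ≤ B := by positivity
  have hxy : |pairSym α W x y| ≤ 2 * B * Z := by
    have hl : |x + y| ≤ 2 * τ := by
      have : x + y = -(b + c) := by linarith
      rw [this, abs_neg]; exact (abs_add_le _ _).trans (by linarith)
    refine (abs_pairSym_le hm h1 h0 hA hW (R := |x|) le_rfl hyx hl
      ⟨hτ, Or.inr (Or.inr (by rwa [abs_neg])), Or.inl (by linarith)⟩).trans
      (le_of_eq (by rw [hB, hZ]; ring))
  have hbc : |pairSym α W b c| ≤ 2 * B * Z := by
    refine (abs_pairSym_le hm h1 h0 hA hW (R := |x|) (by linarith) (by linarith)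
      ((abs_add_le _ _).trans (by linarith) : |b + c| ≤ 2 * τ)
      ⟨hτ, Or.inl (by linarith), Or.inl (by linarith)⟩).trans
      (le_of_eq (by rw [hB, hZ]; ring))
  have hmix : |pairSym α W x b + pairSym α W y b| + |pairSym α W x c + pairSym α W y c|
      ≤ (32 * B + 2 * diffConst α A p) * Z := by
    rcases le_or_gt (4 * τ) |x| with hx | hx
    -- two high and two low frequencies: the terms cancel in pairs
    · have key : ∀ b c : ℝ, |b| ≤ τ → |c| ≤ τ → x + y + b + c = 0 →
          |pairSym α W x b + pairSym α W y b| ≤ diffConst α A p * Z := by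
        intro b c hb hc hs
        have hy : y = -(x + c + b) := by linarith
        have e : pairSym α W y b = -(sym α W (x + c) b (-(x + c + b)) * (x + c)) := by
          rw [pairSym, hy, sym_swap', sym_swap, sym_swap']
          rw [show -(-(x + c + b) + b) = x + c by ring, show -(x + c + b) + b = -(x + c) by ring]
          rw [sym_swap']
          ring
        rw [e, ← sub_eq_add_neg]
        exact sym_sub_le hm h1 h0 hA hW hW2 hτ hb hc hx
      have k1 := key b c le_rfl hcb hsum
      have k2 := key c b hcb le_rfl (by linarith)
      have : 0 ≤ 32 * B * Z := by positivity
      linarith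
    -- at least three frequencies are comparable: every term is admissible by itself
    · have key : ∀ a d : ℝ, |a| ≤ |x| → |d| ≤ τ → τ ≤ |a| → |pairSym α W a d| ≤ 8 * B * Z := by
        intro a d ha hd had
        refine (abs_pairSym_le hm h1 h0 hA hW (R := |x|) (L := 8) ha (by linarith)
          ((abs_add_le _ _).trans (by linarith))
          ⟨hτ, Or.inr (Or.inl (by linarith)), Or.inl (by linarith)⟩).trans
          (le_of_eq (by rw [hB, hZ]; ring))
      have k1 := key x b le_rfl le_rfl (by linarith)
      have k2 := key y b hyx le_rfl hby
      have k3 := key x c le_rfl hcb (by linarith)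
      have k4 := key y c hyx hcb hby
      have := abs_add_le (pairSym α W x b) (pairSym α W y b)
      have := abs_add_le (pairSym α W x c) (pairSym α W y c)
      have : 0 ≤ 2 * diffConst α A p * Z := by positivity
      linarith
  calc |quadSym α W x y b c| = |pairSym α W x y + pairSym α W b c
        + (pairSym α W x b + pairSym α W y b) + (pairSym α W x c + pairSym α W y c)| := by
        unfold quadSym; congr 1; ring
    _ ≤ |pairSym α W x y| + |pairSym α W b c|
        + |pairSym α W x b + pairSym α W y b| + |pairSym α W x c + pairSym α W y c| :=
        (abs_add_le _ _).trans (add_le_add ((abs_add_le _ _).trans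
          (add_le_add (abs_add_le _ _) le_rfl)) le_rfl)
    _ ≤ (36 * B + 2 * diffConst α A p) * Z := by linarith
    _ = _ := by rw [quadConst, hB]; ring

/-- Sorting principle: a property of quadruples invariant under adjacent transpositions may be
checked on quadruples ordered by absolute value. -/
theorem quadruple_induction {P : ℝ → ℝ → ℝ → ℝ → Prop}
    (s12 : ∀ a b c d, P a b c d → P b a c d) (s23 : ∀ a b c d, P a b c d → P a c b d)
    (s34 : ∀ a b c d, P a b c d → P a b d c)
    (base : ∀ a b c d, |b| ≤ |a| → |c| ≤ |b| → |d| ≤ |c| → P a b c d) (a b c d : ℝ) :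
    P a b c d := by
  have i1 : ∀ a b c d, |b| ≤ |a| → |c| ≤ |b| → P a b c d := by
    intro a b c d h1 h2
    rcases le_total |d| |c| with h | h
    · exact base _ _ _ _ h1 h2 h
    rcases le_total |d| |b| with h' | h'
    · exact s34 _ _ _ _ (base _ _ _ _ h1 h' h)
    rcases le_total |d| |a| with h'' | h''
    · exact s34 _ _ _ _ (s23 _ _ _ _ (base _ _ _ _ h'' h' h2))
    · exact s34 _ _ _ _ (s23 _ _ _ _ (s12 _ _ _ _ (base _ _ _ _ h'' h1 h2)))
  have i2 : ∀ a b c d, |b| ≤ |a| → P a b c d := by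
    intro a b c d h1
    rcases le_total |c| |b| with h | h
    · exact i1 _ _ _ _ h1 h
    rcases le_total |c| |a| with h' | h'
    · exact s23 _ _ _ _ (i1 _ _ _ _ h' h)
    · exact s23 _ _ _ _ (s12 _ _ _ _ (i1 _ _ _ _ h' h1))
  rcases le_total |b| |a| with h | h
  · exact i2 _ _ _ _ h
  · exact s12 _ _ _ _ (i2 _ _ _ _ h)

/-- One term of the quartic majorant: `k` derivatives on each of the first two factors, two
derivatives on one of the last two. -/
def quadTerm (k : ℕ) (x y b c : ℝ) : ℝ :=
  |x| ^ k * |y| ^ k * ((1 + b ^ 2) + (1 + c ^ 2))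

theorem quadTerm_nonneg (k : ℕ) (x y b c : ℝ) : 0 ≤ quadTerm k x y b c := by
  unfold quadTerm; positivity

/-- The symmetric majorant of the quartic symbol. -/
def quadMaj (k : ℕ) (x y b c : ℝ) : ℝ :=
  quadTerm k x y b c + quadTerm k x b y c + quadTerm k x c y b + quadTerm k y b x c
    + quadTerm k y c x b + quadTerm k b c x y

theorem rpow_le_one_add_sq {b s : ℝ} (hb : 0 ≤ b) (hs : 0 ≤ s) (hs2 : s ≤ 2) :
    b ^ s ≤ 1 + b ^ 2 := by
  rcases le_total b 1 with h | h
  · have := Real.rpow_le_one hb h hs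
    nlinarith [sq_nonneg b]
  · have := Real.rpow_le_rpow_of_exponent_le h (by simpa using hs2 : s ≤ (2 : ℕ))
    rw [Real.rpow_natCast] at this
    linarith

/-- The bound for sorted frequencies in symmetric form. The two largest of four frequencies with sum
zero are comparable, so that the derivatives can be shared between them. -/
theorem abs_quadSym_le {α : ℝ} (hm : -1 < α) (h1 : α < 1) (h0 : α ≠ 0) {W : ℝ → ℝ}
    {A : ℝ} (hA : 0 ≤ A) {k : ℕ} (hW : IsWeight W A (2 * k)) (hW2 : SecondDiffBound W A (2 * k))
    (x y b c : ℝ) (hsum : x + y + b + c = 0) :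
    |quadSym α W x y b c| ≤ quadConst α A (2 * k) * 3 ^ k * quadMaj k x y b c := by
  have hQ := quadConst_nonneg (p := 2 * k) h0 hA
  revert hsum
  refine quadruple_induction (P := fun x y b c => x + y + b + c = 0 →
    |quadSym α W x y b c| ≤ quadConst α A (2 * k) * 3 ^ k * quadMaj k x y b c)
    ?_ ?_ ?_ ?_ x y b c
  · intro a b c d H hs
    have e1 : quadSym α W b a c d = quadSym α W a b c d := by
      unfold quadSym; rw [pairSym_comm α W b a]; ring
    have e2 : quadMaj k b a c d = quadMaj k a b c d := by unfold quadMaj quadTerm; ring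
    rw [e1, e2]; exact H (by linarith)
  · intro a b c d H hs
    have e1 : quadSym α W a c b d = quadSym α W a b c d := by
      unfold quadSym; rw [pairSym_comm α W c b]; ring
    have e2 : quadMaj k a c b d = quadMaj k a b c d := by unfold quadMaj quadTerm; ring
    rw [e1, e2]; exact H (by linarith)
  · intro a b c d H hs
    have e1 : quadSym α W a b d c = quadSym α W a b c d := by
      unfold quadSym; rw [pairSym_comm α W d c]; ring
    have e2 : quadMaj k a b d c = quadMaj k a b c d := by unfold quadMaj quadTerm; ring
    rw [e1, e2]; exact H (by linarith)
  · intro x y b c hyx hby hcb hs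
    have h := abs_quadSym_le_sorted hm h1 h0 hA hW hW2 hs hyx hby hcb
    have hx : |x| ≤ 3 * |y| := by
      have : x = -(y + b + c) := by linarith
      rw [this, abs_neg]
      have h1 := abs_add_le (y + b) c
      have h2 := abs_add_le y b
      linarith
    have e1 : |x| ^ (2 * (k : ℝ)) ≤ 3 ^ k * (|x| ^ k * |y| ^ k) := by
      have : |x| ^ (2 * (k : ℝ)) = |x| ^ k * |x| ^ k := by
        rw [← pow_add, ← two_mul, ← Real.rpow_natCast]; push_cast; rfl
      rw [this]
      calc |x| ^ k * |x| ^ k ≤ |x| ^ k * (3 * |y|) ^ k := by gcongr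
        _ = _ := by rw [mul_pow]; ring
    have e2 : |b| ^ (1 - α) ≤ 1 + b ^ 2 := by
      have := rpow_le_one_add_sq (abs_nonneg b) (s := 1 - α) (by linarith) (by linarith)
      rwa [sq_abs] at this
    have e3 : quadTerm k x y b c ≤ quadMaj k x y b c := by
      unfold quadMaj
      have n1 := quadTerm_nonneg k x b y c
      have n2 := quadTerm_nonneg k x c y b
      have n3 := quadTerm_nonneg k y b x c
      have n4 := quadTerm_nonneg k y c x b
      have n5 := quadTerm_nonneg k b c x y
      linarith
    calc _ ≤ quadConst α A (2 * k) * (|x| ^ (2 * (k : ℝ)) * |b| ^ (1 - α)) := h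
      _ ≤ quadConst α A (2 * k) * ((3 ^ k * (|x| ^ k * |y| ^ k)) * (1 + b ^ 2)) := by gcongr
      _ = quadConst α A (2 * k) * 3 ^ k * ((|x| ^ k * |y| ^ k) * (1 + b ^ 2)) := by ring
      _ ≤ quadConst α A (2 * k) * 3 ^ k * quadTerm k x y b c := by
          refine mul_le_mul_of_nonneg_left ?_ (by positivity)
          exact mul_le_mul_of_nonneg_left (by nlinarith [sq_nonneg c]) (by positivity)
      _ ≤ _ := by gcongr

/-! ### Bounds for the cubic symbol -/

theorem rpow_le_one_add {b s : ℝ} (hb : 0 ≤ b) (hs : 0 ≤ s) (hs1 : s ≤ 1) : b ^ s ≤ 1 + b := by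
  rcases le_total b 1 with h | h
  · have := Real.rpow_le_one hb h hs
    linarith
  · have := Real.rpow_le_rpow_of_exponent_le h hs1
    rw [Real.rpow_one] at this
    linarith

/-- One term of the cubic majorant. -/
def cubTerm (k : ℕ) (a b c : ℝ) : ℝ := (1 + |a| ^ k) * (1 + |b| ^ k) * (1 + c ^ 2)

/-- The symmetric majorant of the cubic symbol. -/
def cubMaj (k : ℕ) (a b c : ℝ) : ℝ := cubTerm k a b c + cubTerm k a c b + cubTerm k b c a

theorem cubTerm_nonneg (k : ℕ) (a b c : ℝ) : 0 ≤ cubTerm k a b c := by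
  unfold cubTerm; positivity

/-- A bound for the cubic symbol that does not depend on the damping. -/
theorem abs_sym_le_cubMaj {α : ℝ} (hm : -1 < α) (h1 : α < 1) (h0 : α ≠ 0) {W : ℝ → ℝ}
    {A : ℝ} (hA : 0 ≤ A) {k : ℕ} (hk : 1 ≤ k) (hW : IsWeight W A (2 * k))
    (a b c : ℝ) (h : a + b + c = 0) :
    |sym α W a b c| ≤ 2 / gapConst α * A * 2 ^ k * cubMaj k a b c := by
  have hg := gapConst_pos h0
  refine triple_induction (P := fun a b c =>
    |sym α W a b c| ≤ 2 / gapConst α * A * 2 ^ k * cubMaj k a b c) ?_ ?_ ?_ ?_ a b c h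
  · intro a b c H
    rw [sym_swap]
    refine H.trans (le_of_eq ?_)
    unfold cubMaj cubTerm; ring
  · intro a b c H
    rw [sym_swap']
    refine H.trans (le_of_eq ?_)
    unfold cubMaj cubTerm; ring
  · intro a b c H
    rw [sym_neg hW.odd]
    refine H.trans (le_of_eq ?_)
    unfold cubMaj cubTerm; simp only [abs_neg, neg_sq]
  · intro a b hb hba
    have hmaj : 0 ≤ cubMaj k a b (-(a + b)) :=
      add_nonneg (add_nonneg (cubTerm_nonneg _ _ _ _) (cubTerm_nonneg _ _ _ _))
        (cubTerm_nonneg _ _ _ _)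
    rcases hb.eq_or_lt with rfl | hbp
    · rw [sym_zero' hW.odd, abs_zero]; positivity
    have ha : 0 < a := hbp.trans_le hba
    set R := a + b with hR
    have hRp : 0 < R := by positivity
    have hk' : (1 : ℝ) ≤ k := by exact_mod_cast hk
    have ab : |b| = b := abs_of_pos hbp
    have aa : |a| = a := abs_of_pos ha
    have ac : |-R| = R := by rw [abs_neg, abs_of_pos hRp]
    -- `τ` is the smallest frequency for `α < 0` and the largest one for `α > 0`
    have key : ∃ τ, Between τ a b (-R) ∧
        R ^ (2 * (k : ℝ)) * τ ^ (-α) ≤ (1 + R ^ (2 * (k : ℝ))) * (1 + b ^ 2) := by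
      have hRk : 0 ≤ R ^ (2 * (k : ℝ)) := by positivity
      rcases lt_or_gt_of_ne h0 with hα | hα
      · refine ⟨b, ⟨hbp, Or.inr (Or.inl (by linarith)), Or.inr (Or.inl (by linarith))⟩, ?_⟩
        have := rpow_le_one_add_sq hb (s := -α) (by linarith) (by linarith)
        gcongr
        linarith
      · refine ⟨R, ⟨hRp, Or.inl (by linarith), Or.inr (Or.inr (by linarith))⟩, ?_⟩
        rw [← Real.rpow_add hRp]
        have : R ^ (2 * (k : ℝ) + -α) ≤ 1 + R ^ (2 * (k : ℝ)) := by
          rcases le_total R 1 with h | h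
          · have := Real.rpow_le_one hRp.le h (by linarith : 0 ≤ 2 * (k : ℝ) + -α)
            linarith
          · have := Real.rpow_le_rpow_of_exponent_le h
              (by linarith : 2 * (k : ℝ) + -α ≤ 2 * (k : ℝ))
            linarith
        refine this.trans (le_mul_of_one_le_right (by positivity) (by nlinarith))
    obtain ⟨τ, hτ, hτR⟩ := key
    have hs := sym_le hm h1 h0 hA hW a b (-R) (by ring) τ R (by linarith) (by linarith)
      (by linarith) hτ
    have e1 : R ^ (2 * (k : ℝ)) = R ^ k * R ^ k := by
      rw [← pow_add, ← two_mul, ← Real.rpow_natCast]; push_cast; rfl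
    have e2 : 1 + R ^ (2 * (k : ℝ)) ≤ 2 ^ k * ((1 + a ^ k) * (1 + R ^ k)) := by
      have h3 : R ^ k ≤ 2 ^ k * a ^ k := by rw [← mul_pow]; gcongr; linarith
      have h4 : (1 : ℝ) ≤ 2 ^ k := one_le_pow₀ (by norm_num)
      have h5 : 0 ≤ R ^ k := by positivity
      have h6 : 0 ≤ a ^ k := by positivity
      rw [e1]
      calc 1 + R ^ k * R ^ k ≤ 2 ^ k * 1 + 2 ^ k * a ^ k * R ^ k := by
            rw [mul_one]; gcongr
        _ ≤ _ := by nlinarith [mul_nonneg h6 h5]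
    calc _ ≤ 2 / gapConst α * A * R ^ (2 * (k : ℝ)) * τ ^ (-α) := hs
      _ = 2 / gapConst α * A * (R ^ (2 * (k : ℝ)) * τ ^ (-α)) := by ring
      _ ≤ 2 / gapConst α * A * ((2 ^ k * ((1 + a ^ k) * (1 + R ^ k))) * (1 + b ^ 2)) := by
          refine mul_le_mul_of_nonneg_left ?_ (by positivity)
          exact hτR.trans (mul_le_mul_of_nonneg_right e2 (by positivity))
      _ = 2 / gapConst α * A * 2 ^ k * cubTerm k a (-R) b := by
          unfold cubTerm; rw [aa, ac]; ring
      _ ≤ _ := by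
          gcongr
          have n1 := cubTerm_nonneg k a b (-R)
          have n2 := cubTerm_nonneg k b (-R) a
          unfold cubMaj
          linarith

/-- For a damped weight the cubic symbol loses at most one derivative, on a factor of choice. -/
theorem abs_sym_Wt_le {α : ℝ} (hm : -1 < α) (h1 : α < 1) (h0 : α ≠ 0) {k : ℕ} (hk : 1 ≤ k)
    {δ : ℝ} (hδ : 0 < δ) : ∃ K : ℝ, 0 ≤ K ∧ ∀ a b c : ℝ, a + b + c = 0 →
      |sym α (Wt k δ) a b c| ≤ K * (1 + |b|) := by
  have hg := gapConst_pos h0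
  have hk' : (1 : ℝ) ≤ k := by exact_mod_cast hk
  -- the smallest growth for which the factor `τ^(-α)` is compensated
  set p := max α 0 with hp
  have hp0 : 0 ≤ p := le_max_right _ _
  have hpk : p ≤ 2 * k := max_le (by linarith) (by linarith)
  set A : ℝ := (2 * k + 1) * (1 + (δ ^ k)⁻¹) with hAd
  have hA : 0 ≤ A := by positivity
  have hW := isWeight_Wt_of_pos (k := k) hδ hp0 hpk
  refine ⟨2 / gapConst α * A, by positivity, ?_⟩
  set K := 2 / gapConst α * A with hK
  have hK0 : 0 ≤ K := by positivity
  suffices H : ∀ a b c : ℝ, a + b + c = 0 → |sym α (Wt k δ) a b c| ≤ K * (1 + |a|) ∧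
      |sym α (Wt k δ) a b c| ≤ K * (1 + |b|) ∧ |sym α (Wt k δ) a b c| ≤ K * (1 + |c|) from
    fun a b c h => (H a b c h).2.1
  intro a b c h
  refine triple_induction (P := fun a b c => |sym α (Wt k δ) a b c| ≤ K * (1 + |a|) ∧
      |sym α (Wt k δ) a b c| ≤ K * (1 + |b|) ∧ |sym α (Wt k δ) a b c| ≤ K * (1 + |c|))
      ?_ ?_ ?_ ?_ a b c h
  · intro a b c H
    rw [sym_swap]; tauto
  · intro a b c H
    rw [sym_swap']; tauto
  · intro a b c H
    rw [sym_neg hW.odd]; simpa only [abs_neg] using H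
  · intro a b hb hba
    have ab : |b| = b := abs_of_nonneg hb
    have aa : |a| = a := abs_of_nonneg (hb.trans hba)
    have ac : |-(a + b)| = a + b := by rw [abs_neg, abs_of_nonneg (by linarith)]
    suffices H : |sym α (Wt k δ) a b (-(a + b))| ≤ K * (1 + b) by
      rw [aa, ab, ac]
      refine ⟨H.trans ?_, H, H.trans ?_⟩
      · gcongr
      · gcongr; linarith
    rcases hb.eq_or_lt with rfl | hbp
    · rw [sym_zero' hW.odd, abs_zero]; positivity
    have hRp : 0 < a + b := by linarith
    have key : ∃ τ, Between τ a b (-(a + b)) ∧ (a + b) ^ p * τ ^ (-α) ≤ 1 + b := by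
      rcases lt_or_gt_of_ne h0 with hα | hα
      · refine ⟨b, ⟨hbp, Or.inr (Or.inl (by linarith)), Or.inr (Or.inl (by linarith))⟩, ?_⟩
        rw [hp, max_eq_right hα.le, Real.rpow_zero, one_mul]
        exact rpow_le_one_add hb (by linarith) (by linarith)
      · refine ⟨a + b, ⟨hRp, Or.inl (by linarith), Or.inr (Or.inr (by linarith))⟩, ?_⟩
        rw [hp, max_eq_left hα.le, ← Real.rpow_add hRp, add_neg_cancel, Real.rpow_zero]
        linarith
    obtain ⟨τ, hτ, hτR⟩ := key
    have hs := sym_le hm h1 h0 hA hW a b (-(a + b)) (by ring) τ (a + b) (by linarith)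
      (by linarith) (by linarith) hτ
    calc _ ≤ 2 / gapConst α * A * (a + b) ^ p * τ ^ (-α) := hs
      _ = K * ((a + b) ^ p * τ ^ (-α)) := by rw [hK]; ring
      _ ≤ _ := by gcongr

theorem m_eq (α a b : ℝ) : m α a b = (a + b) / (2 * (om α a + om α b + om α (-(a + b)))) := by
  rw [om_neg]; rfl

/-- The truncated symbol is bounded. -/
theorem abs_mCut_le {α : ℝ} (hm : -1 < α) (h1 : α < 1) (h0 : α ≠ 0) {ε : ℝ} (hε : 0 < ε) :
    ∃ K : ℝ, 0 ≤ K ∧ ∀ a b : ℝ, |mCut α ε a b| ≤ K := by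
  have hg := gapConst_pos h0
  refine ⟨1 / ε / (2 * (gapConst α * ε * ε ^ |α|)), by positivity, fun a b => ?_⟩
  unfold mCut
  split_ifs with h
  · obtain ⟨⟨ha1, ha2⟩, ⟨hb1, hb2⟩, hc1, hc2⟩ := h
    have hap : 0 < |a| := hε.trans ha1
    have hgap := om_gap hm h1 h0 a b (-(a + b)) (by ring) ε |a| hε.le ha1.le hb1.le
      (by rw [abs_neg]; exact hc1.le) ⟨hap, Or.inl (by linarith), Or.inl (by linarith)⟩
    have hpow : ε ^ |α| ≤ |a| ^ α := by
      rcases lt_or_gt_of_ne h0 with hα | hα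
      · rw [abs_of_neg hα, Real.rpow_neg hε.le, ← Real.inv_rpow hε.le, ← one_div]
        exact Real.rpow_le_rpow_of_nonpos hap ha2.le hα.le
      · rw [abs_of_pos hα]
        exact Real.rpow_le_rpow hε.le ha1.le hα.le
    rw [m_eq, abs_div, abs_mul, abs_of_pos (by norm_num : (0 : ℝ) < 2)]
    gcongr
    refine le_trans ?_ hgap
    gcongr
  · simp only [abs_zero]; positivity

/-! ### Integrals over frequencies with sum zero -/

theorem measurePreserving_neg_add_sub (s : ℝ) :
    MeasurePreserving (fun x : ℝ => -(s + x)) volume volume := by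
  have := (Measure.measurePreserving_neg (volume : Measure ℝ)).comp
    (measurePreserving_add_left (volume : Measure ℝ) s)
  exact this

/-- The reflection `(x, y) ↦ (x, -(x + y))`, which permutes three frequencies with sum zero. -/
def refl3 : ℝ × ℝ ≃ᵐ ℝ × ℝ :=
  MeasurableEquiv.ofInvolutive (fun p => (p.1, -(p.1 + p.2)))
    (fun p => by ext <;> simp) (by fun_prop)

theorem measurePreserving_refl3 : MeasurePreserving refl3 volume volume :=
  (MeasurePreserving.id volume).skew_product (g := fun x y : ℝ => -(x + y)) (by fun_prop)
    (Eventually.of_forall fun x => (measurePreserving_neg_add_sub x).map_eq)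

theorem measurePreserving_swap : MeasurePreserving
    (MeasurableEquiv.prodComm : ℝ × ℝ ≃ᵐ ℝ × ℝ) volume volume :=
  Measure.measurePreserving_swap

theorem integral3_swap {E : Type*} [NormedAddCommGroup E] [NormedSpace ℝ E] (f : ℝ → ℝ → ℝ → E) :
    ∫ p : ℝ × ℝ, f p.2 p.1 (-(p.1 + p.2)) = ∫ p : ℝ × ℝ, f p.1 p.2 (-(p.1 + p.2)) := by
  rw [← measurePreserving_swap.integral_comp' (fun p : ℝ × ℝ => f p.1 p.2 (-(p.1 + p.2)))]
  refine integral_congr_ae (Eventually.of_forall fun p => ?_)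
  change _ = f p.2 p.1 (-(p.2 + p.1))
  simp only [add_comm p.2]

theorem integral3_refl {E : Type*} [NormedAddCommGroup E] [NormedSpace ℝ E] (f : ℝ → ℝ → ℝ → E) :
    ∫ p : ℝ × ℝ, f p.1 (-(p.1 + p.2)) p.2 = ∫ p : ℝ × ℝ, f p.1 p.2 (-(p.1 + p.2)) := by
  rw [← measurePreserving_refl3.integral_comp' (fun p : ℝ × ℝ => f p.1 p.2 (-(p.1 + p.2)))]
  refine integral_congr_ae (Eventually.of_forall fun p => ?_)
  change _ = f p.1 (-(p.1 + p.2)) (-(p.1 + -(p.1 + p.2)))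
  simp

theorem lintegral3_swap (f : ℝ → ℝ → ℝ → ℝ≥0∞) :
    ∫⁻ p : ℝ × ℝ, f p.2 p.1 (-(p.1 + p.2)) = ∫⁻ p : ℝ × ℝ, f p.1 p.2 (-(p.1 + p.2)) := by
  rw [← measurePreserving_swap.lintegral_comp_emb (MeasurableEquiv.measurableEmbedding _)
    (fun p : ℝ × ℝ => f p.1 p.2 (-(p.1 + p.2)))]
  refine lintegral_congr fun p => ?_
  change _ = f p.2 p.1 (-(p.2 + p.1))
  simp only [add_comm p.2]

theorem lintegral3_refl (f : ℝ → ℝ → ℝ → ℝ≥0∞) :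
    ∫⁻ p : ℝ × ℝ, f p.1 (-(p.1 + p.2)) p.2 = ∫⁻ p : ℝ × ℝ, f p.1 p.2 (-(p.1 + p.2)) := by
  rw [← measurePreserving_refl3.lintegral_comp_emb (MeasurableEquiv.measurableEmbedding _)
    (fun p : ℝ × ℝ => f p.1 p.2 (-(p.1 + p.2)))]
  refine lintegral_congr fun p => ?_
  change _ = f p.1 (-(p.1 + p.2)) (-(p.1 + -(p.1 + p.2)))
  simp

theorem integrable3_swap {E : Type*} [NormedAddCommGroup E] {f : ℝ → ℝ → ℝ → E}
    (h : Integrable fun p : ℝ × ℝ => f p.1 p.2 (-(p.1 + p.2))) :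
    Integrable fun p : ℝ × ℝ => f p.2 p.1 (-(p.1 + p.2)) := by
  refine ((measurePreserving_swap.integrable_comp_emb
    (MeasurableEquiv.measurableEmbedding _)).2 h).congr (Eventually.of_forall fun p => ?_)
  change f p.2 p.1 (-(p.2 + p.1)) = _
  simp only [add_comm p.2]

theorem integrable3_refl {E : Type*} [NormedAddCommGroup E] {f : ℝ → ℝ → ℝ → E}
    (h : Integrable fun p : ℝ × ℝ => f p.1 p.2 (-(p.1 + p.2))) :
    Integrable fun p : ℝ × ℝ => f p.1 (-(p.1 + p.2)) p.2 := by
  refine ((measurePreserving_refl3.integrable_comp_emb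
    (MeasurableEquiv.measurableEmbedding _)).2 h).congr (Eventually.of_forall fun p => ?_)
  change f p.1 (-(p.1 + p.2)) (-(p.1 + -(p.1 + p.2))) = _
  simp

/-- The fourth of four frequencies with sum zero. -/
def fourth (q : (ℝ × ℝ) × ℝ) : ℝ := -(q.1.1 + q.1.2 + q.2)

theorem measurable_fourth : Measurable fourth := by unfold fourth; fun_prop

/-- The exchange of the first two frequencies. -/
def swap12 : (ℝ × ℝ) × ℝ ≃ᵐ (ℝ × ℝ) × ℝ :=
  MeasurableEquiv.prodCongr MeasurableEquiv.prodComm (MeasurableEquiv.refl ℝ)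

theorem measurePreserving_swap12 : MeasurePreserving swap12 volume volume :=
  measurePreserving_swap.prod (MeasurePreserving.id volume)

/-- The exchange of the second and third frequencies. -/
def swap23 : (ℝ × ℝ) × ℝ ≃ᵐ (ℝ × ℝ) × ℝ :=
  (MeasurableEquiv.prodAssoc.trans
    (MeasurableEquiv.prodCongr (MeasurableEquiv.refl ℝ) MeasurableEquiv.prodComm)).trans
    MeasurableEquiv.prodAssoc.symm

theorem measurePreserving_swap23 : MeasurePreserving swap23 volume volume :=
  ((volume_preserving_prodAssoc (α₁ := ℝ) (β₁ := ℝ) (γ₁ := ℝ)).trans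
    ((MeasurePreserving.id volume).prod measurePreserving_swap)).trans
    (volume_preserving_prodAssoc (α₁ := ℝ) (β₁ := ℝ) (γ₁ := ℝ)).symm

/-- The reflection exchanging the last two of four frequencies with sum zero. -/
def swap34 : (ℝ × ℝ) × ℝ ≃ᵐ (ℝ × ℝ) × ℝ :=
  MeasurableEquiv.ofInvolutive (fun q => (q.1, -(q.1.1 + q.1.2 + q.2)))
    (fun q => Prod.ext rfl (by simp only; ring)) (by fun_prop)

theorem measurePreserving_swap34 : MeasurePreserving swap34 volume volume :=
  (MeasurePreserving.id volume).skew_product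
    (g := fun (p : ℝ × ℝ) (y : ℝ) => -(p.1 + p.2 + y)) (by fun_prop)
    (Eventually.of_forall fun p => (measurePreserving_neg_add_sub (p.1 + p.2)).map_eq)

theorem fourth_swap12 (q : (ℝ × ℝ) × ℝ) : fourth (swap12 q) = fourth q := by
  change -(q.1.2 + q.1.1 + q.2) = -(q.1.1 + q.1.2 + q.2); ring

theorem fourth_swap23 (q : (ℝ × ℝ) × ℝ) : fourth (swap23 q) = fourth q := by
  change -(q.1.1 + q.2 + q.1.2) = -(q.1.1 + q.1.2 + q.2); ring

theorem fourth_swap34 (q : (ℝ × ℝ) × ℝ) : fourth (swap34 q) = q.2 := by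
  change -(q.1.1 + q.1.2 + -(q.1.1 + q.1.2 + q.2)) = q.2; ring

section Lintegral

variable (f : ℝ → ℝ → ℝ → ℝ → ℝ≥0∞)

/-- The integral over four frequencies with sum zero, parametrised by the first three. -/
def J (f : ℝ → ℝ → ℝ → ℝ → ℝ≥0∞) : ℝ≥0∞ :=
  ∫⁻ q : (ℝ × ℝ) × ℝ, f q.1.1 q.1.2 q.2 (fourth q)

theorem J_swap12 : J (fun a b c d => f b a c d) = J f := by
  unfold J
  rw [← measurePreserving_swap12.lintegral_comp_emb (MeasurableEquiv.measurableEmbedding _)]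
  exact lintegral_congr fun q => by rw [fourth_swap12]; rfl

theorem J_swap23 : J (fun a b c d => f a c b d) = J f := by
  unfold J
  rw [← measurePreserving_swap23.lintegral_comp_emb (MeasurableEquiv.measurableEmbedding _)]
  exact lintegral_congr fun q => by rw [fourth_swap23]; rfl

theorem J_swap34 : J (fun a b c d => f a b d c) = J f := by
  unfold J
  rw [← measurePreserving_swap34.lintegral_comp_emb (MeasurableEquiv.measurableEmbedding _)]
  exact lintegral_congr fun q => by rw [fourth_swap34]; rfl

end Lintegral

section Integral

variable {E : Type*} [NormedAddCommGroup E] [NormedSpace ℝ E] (f : ℝ → ℝ → ℝ → ℝ → E)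

/-- The integral over four frequencies with sum zero of a vector-valued function. -/
def I4 (f : ℝ → ℝ → ℝ → ℝ → E) : E := ∫ q : (ℝ × ℝ) × ℝ, f q.1.1 q.1.2 q.2 (fourth q)

theorem I4_swap12 : I4 (fun a b c d => f b a c d) = I4 f := by
  unfold I4
  rw [← measurePreserving_swap12.integral_comp']
  exact integral_congr_ae (Eventually.of_forall fun q => by simp only [fourth_swap12]; rfl)

theorem I4_swap23 : I4 (fun a b c d => f a c b d) = I4 f := by
  unfold I4
  rw [← measurePreserving_swap23.integral_comp']
  exact integral_congr_ae (Eventually.of_forall fun q => by simp only [fourth_swap23]; rfl)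

theorem I4_swap34 : I4 (fun a b c d => f a b d c) = I4 f := by
  unfold I4
  rw [← measurePreserving_swap34.integral_comp']
  exact integral_congr_ae (Eventually.of_forall fun q => by simp only [fourth_swap34]; rfl)

end Integral

section Integrability

variable {E : Type*} [NormedAddCommGroup E] {f : ℝ → ℝ → ℝ → ℝ → E}

/-- Absolute convergence of `I4 f`. -/
def Int4 (f : ℝ → ℝ → ℝ → ℝ → E) : Prop :=
  Integrable fun q : (ℝ × ℝ) × ℝ => f q.1.1 q.1.2 q.2 (fourth q)

theorem Int4.swap12 (h : Int4 f) : Int4 (fun a b c d => f b a c d) := by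
  refine ((measurePreserving_swap12.integrable_comp_emb
    (MeasurableEquiv.measurableEmbedding _)).2 h).congr (Eventually.of_forall fun q => ?_)
  simp only [Function.comp, fourth_swap12]; rfl

theorem Int4.swap23 (h : Int4 f) : Int4 (fun a b c d => f a c b d) := by
  refine ((measurePreserving_swap23.integrable_comp_emb
    (MeasurableEquiv.measurableEmbedding _)).2 h).congr (Eventually.of_forall fun q => ?_)
  simp only [Function.comp, fourth_swap23]; rfl

theorem Int4.swap34 (h : Int4 f) : Int4 (fun a b c d => f a b d c) := by
  refine ((measurePreserving_swap34.integrable_comp_emb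
    (MeasurableEquiv.measurableEmbedding _)).2 h).congr (Eventually.of_forall fun q => ?_)
  simp only [Function.comp, fourth_swap34]; rfl

end Integrability

/-- The `L²` norm of a nonnegative function. -/
def l2 (g : ℝ → ℝ≥0∞) : ℝ≥0∞ := (∫⁻ ξ, g ξ ^ (2 : ℝ)) ^ (1 / (2 : ℝ))

theorem lintegral_mul_le_l2 {f g : ℝ → ℝ≥0∞} (hf : Measurable f) (hg : Measurable g) :
    ∫⁻ ξ, f ξ * g ξ ≤ l2 f * l2 g :=
  ENNReal.lintegral_mul_le_Lp_mul_Lq volume Real.HolderConjugate.two_two hf.aemeasurable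
    hg.aemeasurable

theorem lintegral_mul_reflect_le {f g : ℝ → ℝ≥0∞} (hf : Measurable f) (hg : Measurable g)
    (s : ℝ) : ∫⁻ ξ, f ξ * g (-(s + ξ)) ≤ l2 f * l2 g := by
  have hm : Measurable fun ξ : ℝ => -(s + ξ) := by fun_prop
  refine (lintegral_mul_le_l2 hf (hg.comp hm)).trans_eq ?_
  congr 1
  unfold l2
  congr 1
  exact (measurePreserving_neg_add_sub s).lintegral_comp (hg.pow_const _)

/-- Young's inequality `L¹ * L² * L²` for a cubic form. -/
theorem young3 {f g h : ℝ → ℝ≥0∞} (hf : Measurable f) (hg : Measurable g) (hh : Measurable h) :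
    ∫⁻ p : ℝ × ℝ, f p.1 * (g p.2 * h (-(p.1 + p.2))) ≤ (∫⁻ ξ, f ξ) * (l2 g * l2 h) := by
  rw [Measure.volume_eq_prod, lintegral_prod _ (by fun_prop)]
  calc ∫⁻ x, ∫⁻ y, f x * (g y * h (-(x + y)))
      = ∫⁻ x, f x * ∫⁻ y, g y * h (-(x + y)) := by
        refine lintegral_congr fun x => ?_
        rw [lintegral_const_mul _ (by fun_prop)]
    _ ≤ ∫⁻ x, f x * (l2 g * l2 h) :=
        lintegral_mono fun x => mul_le_mul_right (lintegral_mul_reflect_le hg hh x) _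
    _ = _ := lintegral_mul_const _ hf

/-- Young's inequality `L¹ * L¹ * L² * L²` for a quartic form. -/
theorem young4 {f g h i : ℝ → ℝ≥0∞} (hf : Measurable f) (hg : Measurable g) (hh : Measurable h)
    (hi : Measurable i) :
    J (fun a b c d => f a * g b * (h c * i d))
      ≤ (∫⁻ ξ, f ξ) * (∫⁻ ξ, g ξ) * (l2 h * l2 i) := by
  have hm := measurable_fourth
  unfold J
  rw [Measure.volume_eq_prod, lintegral_prod _ (by fun_prop)]
  calc ∫⁻ p : ℝ × ℝ, ∫⁻ y, f p.1 * g p.2 * (h y * i (fourth (p, y)))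
      = ∫⁻ p : ℝ × ℝ, f p.1 * g p.2 * ∫⁻ y, h y * i (-(p.1 + p.2 + y)) := by
        refine lintegral_congr fun x => ?_
        rw [lintegral_const_mul _ (by fun_prop)]
        rfl
    _ ≤ ∫⁻ p : ℝ × ℝ, f p.1 * g p.2 * (l2 h * l2 i) :=
        lintegral_mono fun x => mul_le_mul_right (lintegral_mul_reflect_le hh hi _) _
    _ = _ := by
        rw [lintegral_mul_const _ (by fun_prop), Measure.volume_eq_prod,
          lintegral_prod_mul hf.aemeasurable hg.aemeasurable]

/-! ### Sobolev norms of the transform -/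

/-- The modulus of the transform. -/
def aft (f : L2) (ξ : ℝ) : ℝ≥0∞ := ‖ft f ξ‖ₑ

theorem measurable_ft (f : L2) : Measurable (ft f) := (stronglyMeasurable_ft f).measurable

theorem measurable_aft (f : L2) : Measurable (aft f) := (measurable_ft f).enorm

/-- The `H^s` norm, without the factor `(2π)^(-1/2)`, as an extended real number. -/
def en (s : ℕ) (f : L2) : ℝ≥0∞ :=
  (∫⁻ ξ : ℝ, ENNReal.ofReal ((1 + ξ ^ 2) ^ s) * aft f ξ ^ (2 : ℝ)) ^ (1 / (2 : ℝ))

theorem normH_nonneg (s : ℕ) (f : L2) : 0 ≤ normH s f := Real.sqrt_nonneg _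

/-- The extended norm is finite on `H^s`, where `normH` carries no junk value. -/
theorem en_eq {s : ℕ} {f : L2} (h : MemH s f) :
    en s f = ENNReal.ofReal (Real.sqrt (2 * Real.pi) * normH s f) := by
  have hpi : 0 < 2 * Real.pi := by positivity
  have e1 : ∫⁻ ξ : ℝ, ENNReal.ofReal ((1 + ξ ^ 2) ^ s) * aft f ξ ^ (2 : ℝ)
      = ENNReal.ofReal (∫ ξ : ℝ, (1 + ξ ^ 2) ^ s * ‖ft f ξ‖ ^ 2) := by
    rw [ofReal_integral_eq_lintegral_ofReal h (Eventually.of_forall fun ξ => by positivity)]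
    refine lintegral_congr fun ξ => ?_
    rw [ENNReal.ofReal_mul (by positivity), aft, ← ofReal_norm,
      ENNReal.ofReal_rpow_of_nonneg (norm_nonneg _) (by norm_num)]
    norm_num
  have hI : 0 ≤ ∫ ξ : ℝ, (1 + ξ ^ 2) ^ s * ‖ft f ξ‖ ^ 2 :=
    integral_nonneg fun ξ => by positivity
  rw [en, e1, ENNReal.ofReal_rpow_of_nonneg hI (by norm_num), ← Real.sqrt_eq_rpow, normH,
    ← Real.sqrt_mul hpi.le, ← mul_assoc, mul_one_div, div_self hpi.ne', one_mul]

theorem en_ne_top {s : ℕ} {f : L2} (h : MemH s f) : en s f ≠ ∞ := by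
  rw [en_eq h]; exact ENNReal.ofReal_ne_top

theorem en_mono {s r : ℕ} (h : s ≤ r) (f : L2) : en s f ≤ en r f := by
  unfold en
  refine ENNReal.rpow_le_rpow (lintegral_mono fun ξ => ?_) (by norm_num)
  refine mul_le_mul_left (ENNReal.ofReal_le_ofReal ?_) _
  exact pow_le_pow_right₀ (by nlinarith [sq_nonneg ξ]) h

theorem MemH.mono {s r : ℕ} (h : s ≤ r) {f : L2} (hf : MemH r f) : MemH s f := by
  refine Integrable.mono' hf ?_ (Eventually.of_forall fun ξ => ?_)
  · have := measurable_ft f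
    fun_prop
  · rw [Real.norm_of_nonneg (by positivity)]
    have : 1 ≤ 1 + ξ ^ 2 := by nlinarith [sq_nonneg ξ]
    gcongr

theorem memH_zero (f : L2) : MemH 0 f := by
  simpa [MemH] using integrable_norm_sq_ft f

theorem MemH.sub {s : ℕ} {f g : L2} (hf : MemH s f) (hg : MemH s g) : MemH s (f - g) := by
  refine Integrable.mono' ((hf.const_mul 2).add (hg.const_mul 2)) ?_ ?_
  · have := measurable_ft (f - g)
    fun_prop
  · filter_upwards [ft_sub f g] with ξ hξ
    rw [Real.norm_of_nonneg (by positivity), hξ, Pi.add_apply]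
    have h1 := norm_sub_le (ft f ξ) (ft g ξ)
    have h2 : ‖ft f ξ - ft g ξ‖ ^ 2 ≤ 2 * ‖ft f ξ‖ ^ 2 + 2 * ‖ft g ξ‖ ^ 2 := by
      nlinarith [norm_nonneg (ft f ξ - ft g ξ), sq_nonneg (‖ft f ξ‖ - ‖ft g ξ‖)]
    have h3 : 0 ≤ (1 + ξ ^ 2) ^ s := by positivity
    nlinarith

theorem MemH.smul {s : ℕ} {f : L2} (hf : MemH s f) (c : ℝ) : MemH s (c • f) := by
  refine (hf.const_mul (c ^ 2)).congr ?_
  filter_upwards [ft_smul c f] with ξ hξ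
  rw [hξ, norm_mul, mul_pow]
  simp
  ring

theorem normH_mono {s r : ℕ} (h : s ≤ r) {f : L2} (hf : MemH r f) : normH s f ≤ normH r f := by
  unfold normH
  refine Real.sqrt_le_sqrt (mul_le_mul_of_nonneg_left ?_ (by positivity))
  refine integral_mono (hf.mono h) hf fun ξ => ?_
  have : 1 ≤ 1 + ξ ^ 2 := by nlinarith [sq_nonneg ξ]
  dsimp only
  gcongr

theorem l2_weight_le {s : ℕ} {f : L2} {v : ℝ → ℝ} (hv : ∀ ξ, 0 ≤ v ξ)
    (h : ∀ ξ, v ξ ^ 2 ≤ (1 + ξ ^ 2) ^ s) :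
    l2 (fun ξ => ENNReal.ofReal (v ξ) * aft f ξ) ≤ en s f := by
  unfold l2 en
  refine ENNReal.rpow_le_rpow (lintegral_mono fun ξ => ?_) (by norm_num)
  dsimp only
  rw [ENNReal.mul_rpow_of_nonneg _ _ (by norm_num)]
  refine mul_le_mul_left ?_ _
  rw [ENNReal.ofReal_rpow_of_nonneg (hv ξ) (by norm_num)]
  refine ENNReal.ofReal_le_ofReal ?_
  exact_mod_cast h ξ

/-- The norm of the embedding of `H¹` into functions with integrable transform. -/
def embConst : ℝ≥0∞ := l2 (fun ξ => ENNReal.ofReal (Real.sqrt (1 + ξ ^ 2))⁻¹)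

theorem embConst_ne_top : embConst ≠ ∞ := by
  unfold embConst l2
  refine ENNReal.rpow_ne_top_of_nonneg (by norm_num) ?_
  have e : ∀ ξ : ℝ, ENNReal.ofReal (Real.sqrt (1 + ξ ^ 2))⁻¹ ^ (2 : ℝ)
      = ENNReal.ofReal ((1 + ξ ^ 2)⁻¹) := by
    intro ξ
    rw [ENNReal.ofReal_rpow_of_nonneg (by positivity) (by norm_num)]
    congr 1
    have : ((Real.sqrt (1 + ξ ^ 2))⁻¹) ^ (2 : ℕ) = (1 + ξ ^ 2)⁻¹ := by
      rw [inv_pow, Real.sq_sqrt (by positivity)]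
    exact_mod_cast this
  simp_rw [e]
  rw [← ofReal_integral_eq_lintegral_ofReal integrable_inv_one_add_sq
    (Eventually.of_forall fun ξ => by positivity)]
  exact ENNReal.ofReal_ne_top

/-- A weighted `L¹` bound of the transform, by the Cauchy–Schwarz inequality. -/
theorem l1_weight_le (j : ℕ) (f : L2) :
    ∫⁻ ξ : ℝ, ENNReal.ofReal ((1 + ξ ^ 2) ^ j) * aft f ξ ≤ embConst * en (2 * j + 1) f := by
  have hm := measurable_aft f
  have key := lintegral_mul_le_l2
    (f := fun ξ : ℝ => ENNReal.ofReal (Real.sqrt (1 + ξ ^ 2))⁻¹)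
    (g := fun ξ => ENNReal.ofReal (Real.sqrt (1 + ξ ^ 2) * (1 + ξ ^ 2) ^ j) * aft f ξ)
    (by fun_prop) (by fun_prop)
  have h2 : l2 (fun ξ => ENNReal.ofReal (Real.sqrt (1 + ξ ^ 2) * (1 + ξ ^ 2) ^ j) * aft f ξ)
      ≤ en (2 * j + 1) f := by
    refine l2_weight_le (fun ξ => by positivity) fun ξ => le_of_eq ?_
    rw [mul_pow, Real.sq_sqrt (by positivity)]
    ring
  refine le_trans (le_of_eq ?_) (key.trans (mul_le_mul_right h2 _))
  refine lintegral_congr fun ξ => ?_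
  have hs : 0 < Real.sqrt (1 + ξ ^ 2) := by positivity
  rw [← mul_assoc, ← ENNReal.ofReal_mul (by positivity), ← mul_assoc, inv_mul_cancel₀ hs.ne',
    one_mul]

theorem l1_le (f : L2) : ∫⁻ ξ : ℝ, aft f ξ ≤ embConst * en 1 f := by
  simpa using l1_weight_le 0 f

theorem integrable_ft {f : L2} (h : MemH 1 f) : Integrable (ft f) := by
  refine ⟨(stronglyMeasurable_ft f).aestronglyMeasurable, ?_⟩
  refine (l1_le f).trans_lt (ENNReal.mul_lt_top ?_ ?_)
  · exact embConst_ne_top.lt_top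
  · exact (en_ne_top h).lt_top

/-! ### The quartic form -/

/-- Upper bound for the contribution of `quadTerm k c d a b` to a quartic integral. -/
def quadTermBound (k : ℕ) (f g h i : ℝ → ℝ≥0∞) : ℝ≥0∞ :=
  ((∫⁻ ξ, ENNReal.ofReal (1 + ξ ^ 2) * f ξ) * (∫⁻ ξ, g ξ)
    + (∫⁻ ξ, f ξ) * (∫⁻ ξ, ENNReal.ofReal (1 + ξ ^ 2) * g ξ))
  * (l2 (fun ξ => ENNReal.ofReal (|ξ| ^ k) * h ξ) * l2 (fun ξ => ENNReal.ofReal (|ξ| ^ k) * i ξ))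

theorem J_quadTerm_le (k : ℕ) {f g h i : ℝ → ℝ≥0∞} (hf : Measurable f) (hg : Measurable g)
    (hh : Measurable h) (hi : Measurable i) :
    J (fun a b c d => ENNReal.ofReal (quadTerm k c d a b) * (f a * g b * (h c * i d)))
      ≤ quadTermBound k f g h i := by
  have hm := measurable_fourth
  have e : J (fun a b c d => ENNReal.ofReal (quadTerm k c d a b) * (f a * g b * (h c * i d)))
    = J (fun a b c d => (ENNReal.ofReal (1 + a ^ 2) * f a) * g b
          * ((ENNReal.ofReal (|c| ^ k) * h c) * (ENNReal.ofReal (|d| ^ k) * i d)))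
      + J (fun a b c d => f a * (ENNReal.ofReal (1 + b ^ 2) * g b)
          * ((ENNReal.ofReal (|c| ^ k) * h c) * (ENNReal.ofReal (|d| ^ k) * i d))) := by
    unfold J
    rw [← lintegral_add_left (by fun_prop)]
    refine lintegral_congr fun q => ?_
    simp only [quadTerm]
    rw [ENNReal.ofReal_mul (by positivity), ENNReal.ofReal_mul (by positivity),
      ENNReal.ofReal_add (by positivity) (by positivity)]
    ring
  rw [e, quadTermBound, add_mul]
  exact add_le_add (young4 (by fun_prop) hg (by fun_prop) (by fun_prop))
    (young4 hf (by fun_prop) (by fun_prop) (by fun_prop))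

theorem J_add {F G : ℝ → ℝ → ℝ → ℝ → ℝ≥0∞}
    (hF : Measurable fun q : (ℝ × ℝ) × ℝ => F q.1.1 q.1.2 q.2 (fourth q)) :
    J (fun a b c d => F a b c d + G a b c d) = J F + J G :=
  lintegral_add_left hF _

theorem J_quadMaj_le (k : ℕ) {f g h i : ℝ → ℝ≥0∞} (hf : Measurable f) (hg : Measurable g)
    (hh : Measurable h) (hi : Measurable i) :
    J (fun a b c d => ENNReal.ofReal (quadMaj k a b c d) * (f a * g b * (h c * i d)))
      ≤ quadTermBound k h i f g + quadTermBound k g i f h + quadTermBound k g h f i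
        + quadTermBound k f i g h + quadTermBound k f h g i + quadTermBound k f g h i := by
  have hm := measurable_fourth
  have mT : ∀ a b c d : (ℝ × ℝ) × ℝ → ℝ, Measurable a → Measurable b → Measurable c →
      Measurable d → Measurable fun q => quadTerm k (a q) (b q) (c q) (d q) := by
    intro a b c d ha hb hc hd
    unfold quadTerm
    fun_prop
  have m11 : Measurable fun q : (ℝ × ℝ) × ℝ => q.1.1 := by fun_prop
  have m12 : Measurable fun q : (ℝ × ℝ) × ℝ => q.1.2 := by fun_prop
  have m2 : Measurable fun q : (ℝ × ℝ) × ℝ => q.2 := by fun_prop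
  set P : ℝ → ℝ → ℝ → ℝ → ℝ≥0∞ := fun a b c d => f a * g b * (h c * i d) with hP
  have e : J (fun a b c d => ENNReal.ofReal (quadMaj k a b c d) * P a b c d)
    = J (fun a b c d => ENNReal.ofReal (quadTerm k a b c d) * P a b c d)
      + J (fun a b c d => ENNReal.ofReal (quadTerm k a c b d) * P a b c d)
      + J (fun a b c d => ENNReal.ofReal (quadTerm k a d b c) * P a b c d)
      + J (fun a b c d => ENNReal.ofReal (quadTerm k b c a d) * P a b c d)
      + J (fun a b c d => ENNReal.ofReal (quadTerm k b d a c) * P a b c d)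
      + J (fun a b c d => ENNReal.ofReal (quadTerm k c d a b) * P a b c d) := by
    have mP : Measurable fun q : (ℝ × ℝ) × ℝ => P q.1.1 q.1.2 q.2 (fourth q) := by
      simp only [hP]; fun_prop
    have t1 := ((mT _ _ _ _ m11 m12 m2 hm).ennreal_ofReal).mul mP
    have t2 := ((mT _ _ _ _ m11 m2 m12 hm).ennreal_ofReal).mul mP
    have t3 := ((mT _ _ _ _ m11 hm m12 m2).ennreal_ofReal).mul mP
    have t4 := ((mT _ _ _ _ m12 m2 m11 hm).ennreal_ofReal).mul mP
    have t5 := ((mT _ _ _ _ m12 hm m11 m2).ennreal_ofReal).mul mP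
    rw [← J_add t1, ← J_add (t1.add t2), ← J_add ((t1.add t2).add t3),
      ← J_add (((t1.add t2).add t3).add t4), ← J_add ((((t1.add t2).add t3).add t4).add t5)]
    refine lintegral_congr fun q => ?_
    have n := quadTerm_nonneg k
    simp only [quadMaj]
    rw [ENNReal.ofReal_add (add_nonneg (add_nonneg (add_nonneg (add_nonneg (n _ _ _ _) (n _ _ _ _)) (n _ _ _ _)) (n _ _ _ _)) (n _ _ _ _)) (n _ _ _ _),
      ENNReal.ofReal_add (add_nonneg (add_nonneg (add_nonneg (n _ _ _ _) (n _ _ _ _)) (n _ _ _ _)) (n _ _ _ _)) (n _ _ _ _),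
      ENNReal.ofReal_add (add_nonneg (add_nonneg (n _ _ _ _) (n _ _ _ _)) (n _ _ _ _)) (n _ _ _ _),
      ENNReal.ofReal_add (add_nonneg (n _ _ _ _) (n _ _ _ _)) (n _ _ _ _),
      ENNReal.ofReal_add (n _ _ _ _) (n _ _ _ _)]
    ring
  rw [e]
  have s12 := fun F : ℝ → ℝ → ℝ → ℝ → ℝ≥0∞ => J_swap12 F
  have s23 := fun F : ℝ → ℝ → ℝ → ℝ → ℝ≥0∞ => J_swap23 F
  have s34 := fun F : ℝ → ℝ → ℝ → ℝ → ℝ≥0∞ => J_swap34 F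
  -- the six terms are brought to the form of `J_quadTerm_le` by permuting the variables
  refine add_le_add (add_le_add (add_le_add (add_le_add (add_le_add ?_ ?_) ?_) ?_) ?_) ?_
  · rw [← s23, ← s12, ← s34, ← s23]
    refine le_trans (le_of_eq ?_) (J_quadTerm_le k hh hi hf hg)
    unfold J
    refine lintegral_congr fun q => ?_
    simp only [hP]
    ring
  · rw [← s12, ← s34, ← s23]
    refine le_trans (le_of_eq ?_) (J_quadTerm_le k hg hi hf hh)
    unfold J
    refine lintegral_congr fun q => ?_
    simp only [hP]
    ring
  · rw [← s12, ← s23]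
    refine le_trans (le_of_eq ?_) (J_quadTerm_le k hg hh hf hi)
    unfold J
    refine lintegral_congr fun q => ?_
    simp only [hP]
    ring
  · rw [← s34, ← s23]
    refine le_trans (le_of_eq ?_) (J_quadTerm_le k hf hi hg hh)
    unfold J
    refine lintegral_congr fun q => ?_
    simp only [hP]
    ring
  · rw [← s23]
    refine le_trans (le_of_eq ?_) (J_quadTerm_le k hf hh hg hi)
    unfold J
    refine lintegral_congr fun q => ?_
    simp only [hP]
    ring
  · exact J_quadTerm_le k hf hg hh hi

theorem IsWeight.mono {W : ℝ → ℝ} {A B p : ℝ} (h : IsWeight W A p) (hAB : A ≤ B) :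
    IsWeight W B p := by
  refine ⟨h.odd, fun x y R hx hy => (h.lip x y R hx hy).trans ?_⟩
  have : 0 ≤ R := (abs_nonneg x).trans hx
  gcongr

/-- A constant that serves in all bounds for the weights `Wt k δ`, uniformly in `δ`. -/
def wtConst (k : ℕ) : ℝ := (2 * k + 6) ^ 2

theorem wtConst_nonneg (k : ℕ) : 0 ≤ wtConst k := by unfold wtConst; positivity

theorem isWeight_Wt' {k : ℕ} {δ : ℝ} (hδ : 0 ≤ δ) : IsWeight (Wt k δ) (wtConst k) (2 * k) := by
  refine (isWeight_Wt hδ).mono ?_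
  have : (0 : ℝ) ≤ k := by positivity
  unfold wtConst
  nlinarith

theorem measurable_Wt (k : ℕ) (δ : ℝ) : Measurable (Wt k δ) := by
  unfold Wt wt; fun_prop

theorem measurable_om (α : ℝ) : Measurable (om α) := by
  unfold om; fun_prop

theorem measurable_sym {X : Type*} [MeasurableSpace X] (α : ℝ) (k : ℕ) (δ : ℝ) {a b c : X → ℝ}
    (ha : Measurable a) (hb : Measurable b) (hc : Measurable c) :
    Measurable fun x => sym α (Wt k δ) (a x) (b x) (c x) := by
  have := measurable_Wt k δ
  have := measurable_om α
  unfold sym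
  fun_prop

theorem measurable_pairSym {X : Type*} [MeasurableSpace X] (α : ℝ) (k : ℕ) (δ : ℝ) {a b : X → ℝ}
    (ha : Measurable a) (hb : Measurable b) :
    Measurable fun x => pairSym α (Wt k δ) (a x) (b x) := by
  unfold pairSym
  exact (measurable_sym α k δ ha hb (ha.add hb).neg).mul (ha.add hb)

theorem measurable_quadSym {X : Type*} [MeasurableSpace X] (α : ℝ) (k : ℕ) (δ : ℝ)
    {a b c d : X → ℝ} (ha : Measurable a) (hb : Measurable b) (hc : Measurable c)
    (hd : Measurable d) : Measurable fun x => quadSym α (Wt k δ) (a x) (b x) (c x) (d x) := by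
  have h := fun {a b : X → ℝ} (ha : Measurable a) (hb : Measurable b) =>
    measurable_pairSym α k δ ha hb
  unfold quadSym
  exact (((((h ha hb).add (h ha hc)).add (h ha hd)).add (h hb hc)).add (h hb hd)).add (h hc hd)

/-- `f` has the size of the transform of a function with `H^max(3,k)` norm `n`. -/
structure SizeLe (k : ℕ) (f : ℝ → ℝ≥0∞) (n : ℝ≥0∞) : Prop where
  l1 : ∫⁻ ξ, f ξ ≤ embConst * n
  l1w : ∫⁻ ξ, ENNReal.ofReal (1 + ξ ^ 2) * f ξ ≤ embConst * n
  l2w : l2 (fun ξ => ENNReal.ofReal (|ξ| ^ k) * f ξ) ≤ n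

theorem abs_pow_sq_le (k : ℕ) (ξ : ℝ) : (|ξ| ^ k) ^ 2 ≤ (1 + ξ ^ 2) ^ k := by
  rw [← pow_mul, mul_comm k 2, pow_mul, sq_abs]
  gcongr
  linarith

theorem l2_abs_pow_le (k : ℕ) (f : L2) :
    l2 (fun ξ => ENNReal.ofReal (|ξ| ^ k) * aft f ξ) ≤ en k f :=
  l2_weight_le (fun ξ => by positivity) (abs_pow_sq_le k)

theorem l1w_le (f : L2) : ∫⁻ ξ : ℝ, ENNReal.ofReal (1 + ξ ^ 2) * aft f ξ ≤ embConst * en 3 f := by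
  simpa using l1_weight_le 1 f

theorem sizeLe_aft {N k : ℕ} (h3 : 3 ≤ N) (hk : k ≤ N) (f : L2) : SizeLe k (aft f) (en N f) where
  l1 := (l1_le f).trans (mul_le_mul_right (en_mono (by omega) f) _)
  l1w := (l1w_le f).trans (mul_le_mul_right (en_mono h3 f) _)
  l2w := (l2_abs_pow_le k f).trans (en_mono hk f)

theorem SizeLe.congr {k : ℕ} {f g : ℝ → ℝ≥0∞} {n : ℝ≥0∞} (h : SizeLe k f n)
    (hfg : g =ᵐ[volume] f) : SizeLe k g n where
  l1 := (lintegral_congr_ae hfg).trans_le h.l1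
  l1w := (lintegral_congr_ae (hfg.mono fun x hx => by simp only [hx])).trans_le h.l1w
  l2w := by
    refine le_trans (le_of_eq ?_) h.l2w
    unfold l2
    congr 1
    exact lintegral_congr_ae (hfg.mono fun x hx => by simp only [hx])

theorem quadTermBound_le {k : ℕ} {f g h i : ℝ → ℝ≥0∞} {nf ng nh ni : ℝ≥0∞}
    (hf : SizeLe k f nf) (hg : SizeLe k g ng) (hh : SizeLe k h nh) (hi : SizeLe k i ni) :
    quadTermBound k f g h i ≤ 2 * embConst ^ 2 * (nf * ng * (nh * ni)) := by
  unfold quadTermBound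
  calc _ ≤ ((embConst * nf) * (embConst * ng) + (embConst * nf) * (embConst * ng)) * (nh * ni) := by
        gcongr
        exacts [hf.l1w, hg.l1, hf.l1, hg.l1w, hh.l2w, hi.l2w]
    _ = _ := by ring

theorem J_quadMaj_le_of_size {k : ℕ} {f g h i : ℝ → ℝ≥0∞} {nf ng nh ni : ℝ≥0∞}
    (mf : Measurable f) (mg : Measurable g) (mh : Measurable h) (mi : Measurable i)
    (hf : SizeLe k f nf) (hg : SizeLe k g ng) (hh : SizeLe k h nh) (hi : SizeLe k i ni) :
    J (fun a b c d => ENNReal.ofReal (quadMaj k a b c d) * (f a * g b * (h c * i d)))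
      ≤ 12 * embConst ^ 2 * (nf * ng * (nh * ni)) := by
  refine (J_quadMaj_le k mf mg mh mi).trans ?_
  have b1 := quadTermBound_le hh hi hf hg
  have b2 := quadTermBound_le hg hi hf hh
  have b3 := quadTermBound_le hg hh hf hi
  have b4 := quadTermBound_le hf hi hg hh
  have b5 := quadTermBound_le hf hh hg hi
  have b6 := quadTermBound_le hf hg hh hi
  refine (add_le_add (add_le_add (add_le_add (add_le_add (add_le_add b1 b2) b3) b4) b5) b6).trans
    (le_of_eq ?_)
  ring

/-- The integrand of the quartic term in the derivative of the energy. -/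
def quadInt (α : ℝ) (k : ℕ) (δ : ℝ) (f : L2) (a b c d : ℝ) : ℂ :=
  (quadSym α (Wt k δ) a b c d : ℂ) * (ft f a * ft f b * (ft f c * ft f d))

/-- The quartic term in the derivative of the energy, up to a factor. -/
def quadForm (α : ℝ) (k : ℕ) (δ : ℝ) (f : L2) : ℂ := I4 (quadInt α k δ f)

theorem measurable_quadInt (α : ℝ) (k : ℕ) (δ : ℝ) (f : L2) :
    Measurable fun q : (ℝ × ℝ) × ℝ => quadInt α k δ f q.1.1 q.1.2 q.2 (fourth q) := by
  have hm := measurable_fourth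
  have hf := measurable_ft f
  have hs := measurable_quadSym α k δ (X := (ℝ × ℝ) × ℝ) (a := fun q => q.1.1)
    (b := fun q => q.1.2) (c := fun q => q.2) (d := fourth) (by fun_prop) (by fun_prop)
    (by fun_prop) hm
  have hs' := Complex.measurable_ofReal.comp hs
  unfold quadInt
  exact hs'.mul (by fun_prop)

section Bounds

variable {α : ℝ} (hm : -1 < α) (h1 : α < 1) (h0 : α ≠ 0) {k : ℕ} (hk : 1 ≤ k)

/-- The constant in the uniform bound for the quartic symbol. -/
def symConst (α : ℝ) (k : ℕ) : ℝ := quadConst α (wtConst k) (2 * k) * 3 ^ k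

theorem symConst_nonneg {α : ℝ} (h0 : α ≠ 0) (k : ℕ) : 0 ≤ symConst α k := by
  have := quadConst_nonneg (p := 2 * k) h0 (wtConst_nonneg k)
  unfold symConst
  positivity

include hm h1 h0 hk

theorem abs_quadSym_Wt_le {δ : ℝ} (hδ : 0 ≤ δ) (q : (ℝ × ℝ) × ℝ) :
    |quadSym α (Wt k δ) q.1.1 q.1.2 q.2 (fourth q)|
      ≤ symConst α k * quadMaj k q.1.1 q.1.2 q.2 (fourth q) :=
  abs_quadSym_le hm h1 h0 (wtConst_nonneg k) (isWeight_Wt' hδ) (secondDiffBound_Wt hk hδ) _ _ _ _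
    (by unfold fourth; ring)

theorem enorm_quadSym_le {δ : ℝ} (hδ : 0 ≤ δ) (q : (ℝ × ℝ) × ℝ) :
    ‖(quadSym α (Wt k δ) q.1.1 q.1.2 q.2 (fourth q) : ℂ)‖ₑ
      ≤ ENNReal.ofReal (symConst α k)
        * ENNReal.ofReal (quadMaj k q.1.1 q.1.2 q.2 (fourth q)) := by
  rw [← ENNReal.ofReal_mul (symConst_nonneg h0 k), ← ofReal_norm, Complex.norm_real]
  exact ENNReal.ofReal_le_ofReal (abs_quadSym_Wt_le hm h1 h0 hk hδ q)

theorem lintegral_quadInt_le {δ : ℝ} (hδ : 0 ≤ δ) (f : L2) :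
    ∫⁻ q : (ℝ × ℝ) × ℝ, ‖quadInt α k δ f q.1.1 q.1.2 q.2 (fourth q)‖ₑ
      ≤ ENNReal.ofReal (symConst α k) * (6 * quadTermBound k (aft f) (aft f) (aft f) (aft f)) := by
  have mf := measurable_aft f
  calc _ ≤ ∫⁻ q : (ℝ × ℝ) × ℝ, ENNReal.ofReal (symConst α k)
        * (ENNReal.ofReal (quadMaj k q.1.1 q.1.2 q.2 (fourth q)) * (aft f q.1.1 * aft f q.1.2
          * (aft f q.2 * aft f (fourth q)))) := by
        refine lintegral_mono fun q => ?_
        simp only [quadInt]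
        rw [enorm_mul, ← mul_assoc (ENNReal.ofReal (symConst α k))]
        refine mul_le_mul' (enorm_quadSym_le hm h1 h0 hk hδ q) (le_of_eq ?_)
        simp only [enorm_mul, aft]
    _ ≤ _ := by
        rw [lintegral_const_mul' _ _ ENNReal.ofReal_ne_top]
        refine mul_le_mul_right ((J_quadMaj_le k mf mf mf mf).trans (le_of_eq ?_)) _
        ring

theorem integrable_quadInt {N : ℕ} (h3 : 3 ≤ N) (hkN : k ≤ N) {δ : ℝ} (hδ : 0 ≤ δ) {f : L2}
    (hf : MemH N f) : Int4 (quadInt α k δ f) := by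
  refine ⟨(measurable_quadInt α k δ f).aestronglyMeasurable, ?_⟩
  refine (lintegral_quadInt_le hm h1 h0 hk hδ f).trans_lt ?_
  have hs := sizeLe_aft h3 hkN f
  have := embConst_ne_top
  have := en_ne_top hf
  refine ENNReal.mul_lt_top ENNReal.ofReal_lt_top (ENNReal.mul_lt_top (by norm_num)
    ((quadTermBound_le hs hs hs hs).trans_lt ?_))
  finiteness

/-- The quartic estimate, uniform in the damping: two factors in `H^k`, the other two in `H²` and
`H³` through the embedding into functions with integrable transform. -/
theorem norm_quadForm_le : ∃ C : ℝ, 0 ≤ C ∧ ∀ (N : ℕ), 3 ≤ N → k ≤ N → ∀ δ : ℝ, 0 ≤ δ →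
    ∀ f : L2, MemH N f →
      ‖quadForm α k δ f‖ ≤ C * (normH 2 f * normH 3 f * normH k f ^ 2) := by
  set e := embConst.toReal with he
  set r := Real.sqrt (2 * Real.pi) with hr
  refine ⟨symConst α k * 12 * e ^ 2 * r ^ 4, ?_, fun N h3 hkN δ hδ f hf => ?_⟩
  · have := symConst_nonneg h0 k
    positivity
  have n2 := normH_nonneg 2 f
  have n3 := normH_nonneg 3 f
  have nk := normH_nonneg k f
  have hs := symConst_nonneg h0 k
  have he0 : 0 ≤ e := ENNReal.toReal_nonneg
  have hee : embConst = ENNReal.ofReal e := (ENNReal.ofReal_toReal embConst_ne_top).symm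
  have hb : ‖quadForm α k δ f‖ₑ ≤ ENNReal.ofReal (symConst α k * 12 * e ^ 2 * r ^ 4
      * (normH 2 f * normH 3 f * normH k f ^ 2)) := by
    refine (enorm_integral_le_lintegral_enorm _).trans
      ((lintegral_quadInt_le hm h1 h0 hk hδ f).trans ?_)
    have h6 : quadTermBound k (aft f) (aft f) (aft f) (aft f)
        ≤ 2 * embConst ^ 2 * (en 3 f * en 2 f * (en k f * en k f)) := by
      unfold quadTermBound
      have e1 := (l1_le f).trans (mul_le_mul_right (en_mono (by norm_num : 1 ≤ 2) f) _)
      have e2 := l1w_le f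
      have e3 := l2_abs_pow_le k f
      calc _ ≤ ((embConst * en 3 f) * (embConst * en 2 f) + (embConst * en 2 f) * (embConst * en 3 f))
            * (en k f * en k f) := by gcongr
        _ = _ := by ring
    refine (mul_le_mul_right (mul_le_mul_right h6 6) _).trans (le_of_eq ?_)
    rw [en_eq (hf.mono h3), en_eq (hf.mono (by omega : 2 ≤ N)), en_eq (hf.mono hkN), hee, ← hr]
    rw [← ENNReal.ofReal_pow he0, show (2 : ℝ≥0∞) = ENNReal.ofReal 2 by simp,
      show (6 : ℝ≥0∞) = ENNReal.ofReal 6 by simp, ← ENNReal.ofReal_mul (by positivity),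
      ← ENNReal.ofReal_mul (by positivity), ← ENNReal.ofReal_mul (by positivity),
      ← ENNReal.ofReal_mul (by positivity), ← ENNReal.ofReal_mul (by positivity),
      ← ENNReal.ofReal_mul (by positivity), ← ENNReal.ofReal_mul (by positivity)]
    congr 1
    ring
  rw [← ofReal_norm] at hb
  exact (ENNReal.ofReal_le_ofReal_iff (by positivity)).1 hb

/-- The quartic form is Lipschitz on bounded sets of `H^N`, uniformly in the damping: the difference
of two fourth powers telescopes into terms with one factor `f - g`. -/
theorem norm_quadForm_sub_le {N : ℕ} (h3 : 3 ≤ N) (hkN : k ≤ N) : ∃ C : ℝ, 0 ≤ C ∧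
    ∀ δ : ℝ, 0 ≤ δ → ∀ f g : L2, MemH N f → MemH N g →
      ‖quadForm α k δ f - quadForm α k δ g‖
        ≤ C * (normH N (f - g) * (normH N f + normH N g) ^ 3) := by
  set e := embConst.toReal with he
  set r := Real.sqrt (2 * Real.pi) with hr
  refine ⟨symConst α k * 48 * e ^ 2 * r ^ 4, ?_, fun δ hδ f g hf hg => ?_⟩
  · have := symConst_nonneg h0 k
    positivity
  have nf := normH_nonneg N f
  have ng := normH_nonneg N g
  have nd := normH_nonneg N (f - g)
  have hs := symConst_nonneg h0 k
  have he0 : 0 ≤ e := ENNReal.toReal_nonneg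
  have hee : embConst = ENNReal.ofReal e := (ENNReal.ofReal_toReal embConst_ne_top).symm
  set D : ℝ → ℝ≥0∞ := fun ξ => ‖ft f ξ - ft g ξ‖ₑ with hD
  have mF := measurable_aft f
  have mG := measurable_aft g
  have mf := measurable_ft f
  have mg := measurable_ft g
  have mD : Measurable D := (mf.sub mg).enorm
  have sF := sizeLe_aft h3 hkN f
  have sG := sizeLe_aft h3 hkN g
  have sD : SizeLe k D (en N (f - g)) := by
    refine (sizeLe_aft h3 hkN (f - g)).congr ?_
    filter_upwards [ft_sub f g] with ξ hξ
    simp only [hD, aft, hξ]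
  have hsub : quadForm α k δ f - quadForm α k δ g = ∫ q : (ℝ × ℝ) × ℝ,
      (quadInt α k δ f q.1.1 q.1.2 q.2 (fourth q) - quadInt α k δ g q.1.1 q.1.2 q.2 (fourth q)) :=
    (integral_sub (integrable_quadInt hm h1 h0 hk h3 hkN hδ hf)
      (integrable_quadInt hm h1 h0 hk h3 hkN hδ hg)).symm
  have hb : ‖quadForm α k δ f - quadForm α k δ g‖ₑ ≤ ENNReal.ofReal (symConst α k * 48 * e ^ 2
      * r ^ 4 * (normH N (f - g) * (normH N f + normH N g) ^ 3)) := by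
    rw [hsub]
    refine (enorm_integral_le_lintegral_enorm _).trans ?_
    set F := aft f
    set G := aft g
    have key : ∀ q : (ℝ × ℝ) × ℝ, ‖quadInt α k δ f q.1.1 q.1.2 q.2 (fourth q)
        - quadInt α k δ g q.1.1 q.1.2 q.2 (fourth q)‖ₑ ≤ ENNReal.ofReal (symConst α k)
        * (ENNReal.ofReal (quadMaj k q.1.1 q.1.2 q.2 (fourth q))
            * (D q.1.1 * F q.1.2 * (F q.2 * F (fourth q)))
          + ENNReal.ofReal (quadMaj k q.1.1 q.1.2 q.2 (fourth q))
            * (G q.1.1 * D q.1.2 * (F q.2 * F (fourth q)))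
          + ENNReal.ofReal (quadMaj k q.1.1 q.1.2 q.2 (fourth q))
            * (G q.1.1 * G q.1.2 * (D q.2 * F (fourth q)))
          + ENNReal.ofReal (quadMaj k q.1.1 q.1.2 q.2 (fourth q))
            * (G q.1.1 * G q.1.2 * (G q.2 * D (fourth q)))) := by
      intro q
      have e1 : quadInt α k δ f q.1.1 q.1.2 q.2 (fourth q)
          - quadInt α k δ g q.1.1 q.1.2 q.2 (fourth q)
          = (quadSym α (Wt k δ) q.1.1 q.1.2 q.2 (fourth q) : ℂ)
            * ((ft f q.1.1 - ft g q.1.1) * ft f q.1.2 * (ft f q.2 * ft f (fourth q))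
              + ft g q.1.1 * (ft f q.1.2 - ft g q.1.2) * (ft f q.2 * ft f (fourth q))
              + ft g q.1.1 * ft g q.1.2 * ((ft f q.2 - ft g q.2) * ft f (fourth q))
              + ft g q.1.1 * ft g q.1.2 * (ft g q.2 * (ft f (fourth q) - ft g (fourth q)))) := by
        unfold quadInt; ring
      rw [e1, enorm_mul, ← mul_add, ← mul_add, ← mul_add]
      rw [← mul_assoc (ENNReal.ofReal (symConst α k))]
      refine mul_le_mul' (enorm_quadSym_le hm h1 h0 hk hδ q) ?_
      refine (enorm_add_le _ _).trans (add_le_add ((enorm_add_le _ _).trans (add_le_add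
        ((enorm_add_le _ _).trans (add_le_add ?_ ?_)) ?_)) ?_) <;>
      · simp only [enorm_mul]
        exact le_rfl
    refine (lintegral_mono key).trans ?_
    have mm := measurable_fourth
    rw [lintegral_const_mul' _ _ ENNReal.ofReal_ne_top]
    have mQ : Measurable fun q : (ℝ × ℝ) × ℝ => quadMaj k q.1.1 q.1.2 q.2 (fourth q) := by
      unfold quadMaj quadTerm
      fun_prop
    rw [lintegral_add_left (by fun_prop), lintegral_add_left (by fun_prop),
      lintegral_add_left (by fun_prop)]
    have j1 := J_quadMaj_le_of_size mD mF mF mF sD sF sF sF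
    have j2 := J_quadMaj_le_of_size mG mD mF mF sG sD sF sF
    have j3 := J_quadMaj_le_of_size mG mG mD mF sG sG sD sF
    have j4 := J_quadMaj_le_of_size mG mG mG mD sG sG sG sD
    set M := en N f + en N g with hM
    have lf : en N f ≤ M := le_self_add
    have lg : en N g ≤ M := le_add_self
    have hfin : ENNReal.ofReal (symConst α k) * (48 * embConst ^ 2 * (en N (f - g) * M ^ 3))
        = ENNReal.ofReal (symConst α k * 48 * e ^ 2
          * r ^ 4 * (normH N (f - g) * (normH N f + normH N g) ^ 3)) := by
      rw [hM, en_eq hf, en_eq hg, en_eq (hf.sub hg), hee, ← hr]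
      rw [← ENNReal.ofReal_add (by positivity) (by positivity),
        ← ENNReal.ofReal_pow he0, ← ENNReal.ofReal_pow (by positivity),
        show (48 : ℝ≥0∞) = ENNReal.ofReal 48 by simp, ← ENNReal.ofReal_mul (by positivity),
        ← ENNReal.ofReal_mul (by positivity), ← ENNReal.ofReal_mul (by positivity),
        ← ENNReal.ofReal_mul (by positivity)]
      congr 1
      ring
    rw [← hfin]
    refine mul_le_mul_right ?_ _
    calc _ ≤ 12 * embConst ^ 2 * (en N (f - g) * M * (M * M))
          + 12 * embConst ^ 2 * (M * en N (f - g) * (M * M))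
          + 12 * embConst ^ 2 * (M * M * (en N (f - g) * M))
          + 12 * embConst ^ 2 * (M * M * (M * en N (f - g))) := by
          refine add_le_add (add_le_add (add_le_add (j1.trans ?_) (j2.trans ?_)) (j3.trans ?_))
            (j4.trans ?_) <;> gcongr
      _ = _ := by ring
  rw [← ofReal_norm] at hb
  exact (ENNReal.ofReal_le_ofReal_iff (by positivity)).1 hb

end Bounds

/-! ### The cubic form and the regularised energy -/

theorem l2_const_mul {c : ℝ≥0∞} (g : ℝ → ℝ≥0∞) (hc : c ≠ ∞) :
    l2 (fun ξ => c * g ξ) = c * l2 g := by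
  unfold l2
  simp_rw [ENNReal.mul_rpow_of_nonneg _ _ (by norm_num : (0 : ℝ) ≤ 2)]
  rw [lintegral_const_mul' _ _ (ENNReal.rpow_ne_top_of_nonneg (by norm_num) hc),
    ENNReal.mul_rpow_of_nonneg _ _ (by norm_num), ← ENNReal.rpow_mul]
  norm_num

theorem l2_one_add_pow_le (k : ℕ) (f : L2) :
    l2 (fun ξ => ENNReal.ofReal (1 + |ξ| ^ k) * aft f ξ) ≤ 2 * en k f := by
  have e : (fun ξ => ENNReal.ofReal (1 + |ξ| ^ k) * aft f ξ)
      = fun ξ => 2 * (ENNReal.ofReal ((1 + |ξ| ^ k) / 2) * aft f ξ) := by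
    ext ξ
    rw [← mul_assoc]
    congr 1
    rw [show (2 : ℝ≥0∞) = ENNReal.ofReal 2 by simp, ← ENNReal.ofReal_mul (by norm_num)]
    congr 1; ring
  rw [e, l2_const_mul _ (by norm_num)]
  refine mul_le_mul_right (l2_weight_le (fun ξ => by positivity) fun ξ => ?_) _
  have h1 := abs_pow_sq_le k ξ
  have h2 : (1 : ℝ) ≤ (1 + ξ ^ 2) ^ k := one_le_pow₀ (by nlinarith [sq_nonneg ξ])
  nlinarith [sq_nonneg (1 - |ξ| ^ k)]

/-- The modulus of the integrand of a cubic form. -/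
def aft3 (f : L2) (a b c : ℝ) : ℝ≥0∞ := aft f a * (aft f b * aft f c)

theorem lintegral_cubTerm_lt_top {N k : ℕ} (h3 : 3 ≤ N) (hkN : k ≤ N) {f : L2} (hf : MemH N f) :
    ∫⁻ p : ℝ × ℝ, ENNReal.ofReal (cubTerm k p.2 (-(p.1 + p.2)) p.1)
      * aft3 f p.1 p.2 (-(p.1 + p.2)) < ∞ := by
  have mf := measurable_aft f
  have hy := young3 (f := fun ξ => ENNReal.ofReal (1 + ξ ^ 2) * aft f ξ)
    (g := fun ξ => ENNReal.ofReal (1 + |ξ| ^ k) * aft f ξ)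
    (h := fun ξ => ENNReal.ofReal (1 + |ξ| ^ k) * aft f ξ) (by fun_prop) (by fun_prop)
    (by fun_prop)
  refine lt_of_le_of_lt (le_of_eq (lintegral_congr fun p => ?_)) (hy.trans_lt ?_)
  · rw [cubTerm, aft3, ENNReal.ofReal_mul (by positivity), ENNReal.ofReal_mul (by positivity)]
    ring
  · have h1 := l2_one_add_pow_le k f
    have h2 := l1w_le f
    have n1 := en_ne_top (hf.mono hkN)
    have n2 := en_ne_top (hf.mono h3)
    have n3 := embConst_ne_top
    refine lt_of_le_of_lt (mul_le_mul' h2 (mul_le_mul' h1 h1)) ?_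
    finiteness

theorem lintegral_cubMaj_lt_top {N k : ℕ} (h3 : 3 ≤ N) (hkN : k ≤ N) {f : L2} (hf : MemH N f) :
    ∫⁻ p : ℝ × ℝ, ENNReal.ofReal (cubMaj k p.1 p.2 (-(p.1 + p.2)))
      * aft3 f p.1 p.2 (-(p.1 + p.2)) < ∞ := by
  have mf := measurable_aft f
  have h := lintegral_cubTerm_lt_top h3 hkN hf
  have h' := h
  rw [← lintegral3_swap (fun a b c => ENNReal.ofReal (cubTerm k b c a) * aft3 f a b c)] at h'
  have h2 := h'
  rw [← lintegral3_refl (fun a b c => ENNReal.ofReal (cubTerm k a c b) * aft3 f b a c)] at h2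
  have mC : ∀ a b c : ℝ × ℝ → ℝ, Measurable a → Measurable b → Measurable c →
      Measurable fun p => ENNReal.ofReal (cubTerm k (a p) (b p) (c p)) := by
    intro a b c ha hb hc
    unfold cubTerm
    fun_prop
  have mA : Measurable fun p : ℝ × ℝ => aft3 f p.1 p.2 (-(p.1 + p.2)) := by
    unfold aft3; fun_prop
  have e : ∀ p : ℝ × ℝ, ENNReal.ofReal (cubMaj k p.1 p.2 (-(p.1 + p.2)))
      * aft3 f p.1 p.2 (-(p.1 + p.2))
      = ENNReal.ofReal (cubTerm k p.2 (-(p.1 + p.2)) p.1) * aft3 f p.1 p.2 (-(p.1 + p.2))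
      + ENNReal.ofReal (cubTerm k p.1 (-(p.1 + p.2)) p.2) * aft3 f p.2 p.1 (-(p.1 + p.2))
      + ENNReal.ofReal (cubTerm k p.1 p.2 (-(p.1 + p.2))) * aft3 f (-(p.1 + p.2)) p.1 p.2 := by
    intro p
    have n := cubTerm_nonneg k
    rw [cubMaj, ENNReal.ofReal_add (add_nonneg (n _ _ _) (n _ _ _)) (n _ _ _),
      ENNReal.ofReal_add (n _ _ _) (n _ _ _)]
    unfold aft3
    ring
  simp_rw [e]
  have mS : Measurable fun p : ℝ × ℝ => ENNReal.ofReal (cubTerm k p.1 (-(p.1 + p.2)) p.2)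
      * aft3 f p.2 p.1 (-(p.1 + p.2)) := by
    refine (mC _ _ _ (by fun_prop) (by fun_prop) (by fun_prop)).mul ?_
    unfold aft3; fun_prop
  have mT : Measurable fun p : ℝ × ℝ => ENNReal.ofReal (cubTerm k p.2 (-(p.1 + p.2)) p.1)
      * aft3 f p.1 p.2 (-(p.1 + p.2)) :=
    (mC _ _ _ (by fun_prop) (by fun_prop) (by fun_prop)).mul mA
  exact lt_of_eq_of_lt (lintegral_add_left (mT.add mS) _) (ENNReal.add_lt_top.2
    ⟨lt_of_eq_of_lt (lintegral_add_left mT _) (ENNReal.add_lt_top.2 ⟨h, h'⟩), h2⟩)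

/-- The product of three transforms. -/
def ft3 (f : L2) (a b c : ℝ) : ℂ := ft f a * (ft f b * ft f c)

theorem enorm_ft3 (f : L2) (a b c : ℝ) : ‖ft3 f a b c‖ₑ = aft3 f a b c := by
  simp only [ft3, aft3, aft, enorm_mul]

theorem measurable_ft3 {X : Type*} [MeasurableSpace X] (f : L2) {a b c : X → ℝ}
    (ha : Measurable a) (hb : Measurable b) (hc : Measurable c) :
    Measurable fun x => ft3 f (a x) (b x) (c x) := by
  have := measurable_ft f
  unfold ft3
  fun_prop

/-- The integrable majorant of the cubic integrands. -/
theorem integrable_cubMaj {N k : ℕ} (h3 : 3 ≤ N) (hkN : k ≤ N) {f : L2} (hf : MemH N f) :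
    Integrable fun p : ℝ × ℝ =>
      cubMaj k p.1 p.2 (-(p.1 + p.2)) * ‖ft3 f p.1 p.2 (-(p.1 + p.2))‖ := by
  have m1 : Measurable fun p : ℝ × ℝ => cubMaj k p.1 p.2 (-(p.1 + p.2)) := by
    unfold cubMaj cubTerm; fun_prop
  have m2 : Measurable fun p : ℝ × ℝ => ft3 f p.1 p.2 (-(p.1 + p.2)) :=
    measurable_ft3 f (by fun_prop) (by fun_prop) (by fun_prop)
  refine ⟨(m1.mul m2.norm).aestronglyMeasurable, ?_⟩
  refine lt_of_le_of_lt (le_of_eq (lintegral_congr fun p => ?_))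
    (lintegral_cubMaj_lt_top h3 hkN hf)
  have n : 0 ≤ cubMaj k p.1 p.2 (-(p.1 + p.2)) :=
    add_nonneg (add_nonneg (cubTerm_nonneg _ _ _ _) (cubTerm_nonneg _ _ _ _))
      (cubTerm_nonneg _ _ _ _)
  rw [enorm_mul, enorm_norm, enorm_ft3, Real.enorm_of_nonneg n]

theorem one_le_cubMaj (k : ℕ) (a b c : ℝ) : 1 ≤ cubMaj k a b c := by
  have h1 := cubTerm_nonneg k a b c
  have h2 := cubTerm_nonneg k a c b
  have h3 : 1 ≤ cubTerm k b c a := by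
    unfold cubTerm
    have ha : 0 ≤ |b| ^ k := by positivity
    have hb : 0 ≤ |c| ^ k := by positivity
    have hc := sq_nonneg a
    exact one_le_mul_of_one_le_of_one_le
      (one_le_mul_of_one_le_of_one_le (by linarith) (by linarith)) (by linarith)
  unfold cubMaj
  linarith

/-- A symbol dominated by the cubic majorant gives an absolutely convergent cubic form. -/
theorem integrable_mul_ft3 {N k : ℕ} (h3 : 3 ≤ N) (hkN : k ≤ N) {f : L2} (hf : MemH N f)
    {σ : ℝ × ℝ → ℝ} (hσ : Measurable σ) {C : ℝ}
    (hb : ∀ p : ℝ × ℝ, |σ p| ≤ C * cubMaj k p.1 p.2 (-(p.1 + p.2))) :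
    Integrable fun p : ℝ × ℝ => (σ p : ℂ) * ft3 f p.1 p.2 (-(p.1 + p.2)) := by
  refine Integrable.mono' ((integrable_cubMaj h3 hkN hf).const_mul C) ?_ ?_
  · exact ((Complex.measurable_ofReal.comp hσ).mul (measurable_ft3 f (by fun_prop) (by fun_prop)
      (by fun_prop))).aestronglyMeasurable
  · refine Eventually.of_forall fun p => ?_
    rw [norm_mul, Complex.norm_real, Real.norm_eq_abs, ← mul_assoc]
    exact mul_le_mul_of_nonneg_right (hb p) (norm_nonneg _)

/-- Symmetrisation over the choice of the distinguished one of three frequencies. -/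
theorem integral3_symm {Ψ : ℝ → ℝ → ℝ → ℂ}
    (h : Integrable fun p : ℝ × ℝ => Ψ p.1 p.2 (-(p.1 + p.2))) :
    3 * ∫ p : ℝ × ℝ, Ψ p.1 p.2 (-(p.1 + p.2)) = ∫ p : ℝ × ℝ, (Ψ p.1 p.2 (-(p.1 + p.2))
      + Ψ p.2 p.1 (-(p.1 + p.2)) + Ψ (-(p.1 + p.2)) p.1 p.2) := by
  have i2 := integrable3_swap h
  have i3 := integrable3_refl (f := fun a b c => Ψ b a c) i2
  have e2 := integral3_swap Ψ
  have e3 := integral3_refl (fun a b c => Ψ b a c)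
  refine Eq.trans ?_ (integral_add (h.add i2) i3).symm
  rw [e3, integral_add' h i2, e2]
  ring

theorem sym_num_eq_zero {W : ℝ → ℝ} (hW : ∀ x, W (-x) = -W x) {a b c : ℝ} (h : a + b + c = 0)
    (h0 : a = 0 ∨ b = 0 ∨ c = 0) : W a + W b + W c = 0 := by
  have hz : W 0 = 0 := by have := hW 0; rw [neg_zero] at this; linarith
  rcases h0 with rfl | rfl | rfl
  · have : c = -b := by linarith
    rw [this, hW, hz]; ring
  · have : c = -a := by linarith
    rw [this, hW, hz]; ring
  · have : b = -a := by linarith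
    rw [this, hW, hz]; ring

/-- The cubic form in the modified energy. -/
def tri (α : ℝ) (k : ℕ) (δ : ℝ) (f : L2) : ℂ :=
  ∫ p : ℝ × ℝ, (sym α (Wt k δ) p.1 p.2 (-(p.1 + p.2)) : ℂ) * ft3 f p.1 p.2 (-(p.1 + p.2))

/-- The modified energy with the weight `ξ^(2k)` damped at high frequencies. The factor `-1/3` is
`2 · (-1/2) · (1/3)`, from the pairing, the symbol `m` and the symmetrisation of the numerator
`W(ξ)` to `(W(a) + W(b) + W(c)) / 3`. -/
def En (α : ℝ) (k : ℕ) (δ : ℝ) (f : L2) : ℝ :=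
  (1 / (2 * Real.pi)) * (∫ ξ : ℝ, wt k δ ξ * ‖ft f ξ‖ ^ 2)
    - (1 / 3) * (1 / (2 * Real.pi)) ^ 2 * (tri α k δ f).re

theorem wt_nonneg (k : ℕ) {δ : ℝ} (hδ : 0 ≤ δ) (x : ℝ) : 0 ≤ wt k δ x := by
  unfold wt; rw [pow_mul]; positivity

theorem wt_le (k : ℕ) {δ : ℝ} (hδ : 0 ≤ δ) (x : ℝ) : wt k δ x ≤ (1 + x ^ 2) ^ k := by
  unfold wt
  have h1 : (1 : ℝ) ≤ (1 + δ * x ^ 2) ^ (k + 1) := one_le_pow₀ (by nlinarith [sq_nonneg x])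
  refine (div_le_self (by rw [pow_mul]; positivity) h1).trans ?_
  rw [pow_mul]
  gcongr
  linarith

theorem tendsto_wt (k : ℕ) (x : ℝ) : Tendsto (fun δ => wt k δ x) (𝓝[>] 0) (𝓝 (wt k 0 x)) := by
  refine Tendsto.mono_left ?_ nhdsWithin_le_nhds
  have : ContinuousAt (fun δ => wt k δ x) 0 := by
    unfold wt
    refine ContinuousAt.div (by fun_prop) (by fun_prop) (by simp)
  exact this

theorem tendsto_Wt (k : ℕ) (x : ℝ) : Tendsto (fun δ => Wt k δ x) (𝓝[>] 0) (𝓝 (Wt k 0 x)) :=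
  (tendsto_wt k x).const_mul x

theorem tendsto_sym (α : ℝ) (k : ℕ) (a b c : ℝ) :
    Tendsto (fun δ => sym α (Wt k δ) a b c) (𝓝[>] 0) (𝓝 (sym α (Wt k 0) a b c)) :=
  (((tendsto_Wt k a).add (tendsto_Wt k b)).add (tendsto_Wt k c)).div_const _

theorem measurable_wt (k : ℕ) (δ : ℝ) : Measurable (wt k δ) := by unfold wt; fun_prop

theorem measurable_sym3 (α : ℝ) (k : ℕ) (δ : ℝ) :
    Measurable fun p : ℝ × ℝ => sym α (Wt k δ) p.1 p.2 (-(p.1 + p.2)) :=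
  measurable_sym α k δ (by fun_prop) (by fun_prop) (by fun_prop)

section Limits

variable {α : ℝ} (hm : -1 < α) (h1 : α < 1) (h0 : α ≠ 0) {k : ℕ} (hk : 1 ≤ k)

include hm h1 h0 hk

theorem abs_sym_Wt_le_cubMaj {δ : ℝ} (hδ : 0 ≤ δ) (p : ℝ × ℝ) :
    |sym α (Wt k δ) p.1 p.2 (-(p.1 + p.2))|
      ≤ 2 / gapConst α * wtConst k * 2 ^ k * cubMaj k p.1 p.2 (-(p.1 + p.2)) :=
  abs_sym_le_cubMaj hm h1 h0 (wtConst_nonneg k) hk (isWeight_Wt' hδ) _ _ _ (by ring)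

theorem tendsto_En {N : ℕ} (h3 : 3 ≤ N) (hkN : k ≤ N) {f : L2} (hf : MemH N f) :
    Tendsto (fun δ => En α k δ f) (𝓝[>] 0) (𝓝 (En α k 0 f)) := by
  have hpos : ∀ᶠ δ : ℝ in 𝓝[>] 0, 0 ≤ δ := by
    filter_upwards [self_mem_nhdsWithin] with δ hδ using le_of_lt hδ
  have hquad : Tendsto (fun δ => ∫ ξ : ℝ, wt k δ ξ * ‖ft f ξ‖ ^ 2) (𝓝[>] 0)
      (𝓝 (∫ ξ : ℝ, wt k 0 ξ * ‖ft f ξ‖ ^ 2)) := by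
    refine tendsto_integral_filter_of_dominated_convergence
      (fun ξ => (1 + ξ ^ 2) ^ k * ‖ft f ξ‖ ^ 2) ?_ ?_ (hf.mono hkN) ?_
    · refine Eventually.of_forall fun δ => ?_
      have := measurable_wt k δ
      have := measurable_ft f
      exact Measurable.aestronglyMeasurable (by fun_prop)
    · filter_upwards [hpos] with δ hδ
      refine Eventually.of_forall fun ξ => ?_
      have := wt_nonneg k hδ ξ
      rw [Real.norm_of_nonneg (by positivity)]
      exact mul_le_mul_of_nonneg_right (wt_le k hδ ξ) (by positivity)
    · exact Eventually.of_forall fun ξ => (tendsto_wt k ξ).mul_const _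
  have htri : Tendsto (fun δ => tri α k δ f) (𝓝[>] 0) (𝓝 (tri α k 0 f)) := by
    refine tendsto_integral_filter_of_dominated_convergence
      (fun p : ℝ × ℝ => 2 / gapConst α * wtConst k * 2 ^ k
        * (cubMaj k p.1 p.2 (-(p.1 + p.2)) * ‖ft3 f p.1 p.2 (-(p.1 + p.2))‖)) ?_ ?_
      ((integrable_cubMaj h3 hkN hf).const_mul _) ?_
    · refine Eventually.of_forall fun δ => ?_
      exact ((Complex.measurable_ofReal.comp (measurable_sym3 α k δ)).mul
        (measurable_ft3 f (by fun_prop) (by fun_prop) (by fun_prop))).aestronglyMeasurable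
    · filter_upwards [hpos] with δ hδ
      refine Eventually.of_forall fun p => ?_
      rw [norm_mul, Complex.norm_real, Real.norm_eq_abs, ← mul_assoc]
      exact mul_le_mul_of_nonneg_right (abs_sym_Wt_le_cubMaj hm h1 h0 hk hδ p) (norm_nonneg _)
    · exact Eventually.of_forall fun p =>
        (Complex.continuous_ofReal.tendsto _ |>.comp (tendsto_sym α k _ _ _)).mul_const _
  have hre : Tendsto (fun δ => (tri α k δ f).re) (𝓝[>] 0) (𝓝 (tri α k 0 f).re) :=
    (Complex.continuous_re.tendsto _).comp htri
  exact (hquad.const_mul _).sub (hre.const_mul _)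

theorem tendsto_quadForm {N : ℕ} (h3 : 3 ≤ N) (hkN : k ≤ N) {f : L2} (hf : MemH N f) :
    Tendsto (fun δ => quadForm α k δ f) (𝓝[>] 0) (𝓝 (quadForm α k 0 f)) := by
  have hpos : ∀ᶠ δ : ℝ in 𝓝[>] 0, 0 ≤ δ := by
    filter_upwards [self_mem_nhdsWithin] with δ hδ using le_of_lt hδ
  set P : (ℝ × ℝ) × ℝ → ℂ := fun q => ft f q.1.1 * ft f q.1.2 * (ft f q.2 * ft f (fourth q))
    with hP
  have mP : Measurable P := by
    have := measurable_ft f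
    have := measurable_fourth
    fun_prop
  have mM : Measurable fun q : (ℝ × ℝ) × ℝ => quadMaj k q.1.1 q.1.2 q.2 (fourth q) := by
    have := measurable_fourth
    unfold quadMaj quadTerm
    fun_prop
  have nM : ∀ a b c d, 0 ≤ quadMaj k a b c d := fun a b c d => by
    have n := quadTerm_nonneg k
    exact add_nonneg (add_nonneg (add_nonneg (add_nonneg (add_nonneg (n _ _ _ _) (n _ _ _ _))
      (n _ _ _ _)) (n _ _ _ _)) (n _ _ _ _)) (n _ _ _ _)
  have hint : Integrable fun q : (ℝ × ℝ) × ℝ =>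
      quadMaj k q.1.1 q.1.2 q.2 (fourth q) * ‖P q‖ := by
    refine ⟨(mM.mul mP.norm).aestronglyMeasurable, ?_⟩
    have mf := measurable_aft f
    have hs := sizeLe_aft h3 hkN f
    have := J_quadMaj_le_of_size mf mf mf mf hs hs hs hs
    refine lt_of_le_of_lt ((lintegral_congr fun q => ?_).trans_le this) ?_
    · rw [enorm_mul, enorm_norm, Real.enorm_of_nonneg (nM _ _ _ _)]
      simp only [hP, enorm_mul, aft]
    · have := embConst_ne_top
      have := en_ne_top hf
      finiteness
  refine tendsto_integral_filter_of_dominated_convergence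
    (fun q => symConst α k * (quadMaj k q.1.1 q.1.2 q.2 (fourth q) * ‖P q‖)) ?_ ?_
    (hint.const_mul _) ?_
  · exact Eventually.of_forall fun δ => (measurable_quadInt α k δ f).aestronglyMeasurable
  · filter_upwards [hpos] with δ hδ
    refine Eventually.of_forall fun q => ?_
    rw [quadInt, norm_mul, Complex.norm_real, Real.norm_eq_abs, ← mul_assoc (symConst α k)]
    exact mul_le_mul_of_nonneg_right (abs_quadSym_Wt_le hm h1 h0 hk hδ q) (norm_nonneg _)
  · refine Eventually.of_forall fun q => ?_
    have hp : ∀ a b, Tendsto (fun δ => pairSym α (Wt k δ) a b) (𝓝[>] 0)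
        (𝓝 (pairSym α (Wt k 0) a b)) := fun a b => (tendsto_sym α k _ _ _).mul_const _
    have hq := (((((hp q.1.1 q.1.2).add (hp q.1.1 q.2)).add (hp q.1.1 (fourth q))).add
      (hp q.1.2 q.2)).add (hp q.1.2 (fourth q))).add (hp q.2 (fourth q))
    exact ((Complex.continuous_ofReal.tendsto _).comp hq).mul_const _

end Limits

/-! ### The principal value -/

open Classical in
/-- The indicator of the frequencies `ε < |x| < 1/ε`. -/
def cutInd (ε x : ℝ) : ℝ := if ε < |x| ∧ |x| < 1 / ε then 1 else 0

/-- The symmetric cut-off of three frequencies. -/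
def cut3 (ε a b c : ℝ) : ℝ := cutInd ε a * cutInd ε b * cutInd ε c

theorem cutInd_neg (ε x : ℝ) : cutInd ε (-x) = cutInd ε x := by
  unfold cutInd; rw [abs_neg]

theorem cutInd_mem (ε x : ℝ) : 0 ≤ cutInd ε x ∧ cutInd ε x ≤ 1 := by
  unfold cutInd; split_ifs <;> norm_num

theorem cut3_mem (ε a b c : ℝ) : 0 ≤ cut3 ε a b c ∧ cut3 ε a b c ≤ 1 := by
  obtain ⟨ha, ha'⟩ := cutInd_mem ε a
  obtain ⟨hb, hb'⟩ := cutInd_mem ε b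
  obtain ⟨hc, hc'⟩ := cutInd_mem ε c
  refine ⟨mul_nonneg (mul_nonneg ha hb) hc, ?_⟩
  exact mul_le_one₀ (mul_le_one₀ ha' hb hb') hc hc'

theorem measurable_cutInd (ε : ℝ) : Measurable (cutInd ε) := by
  classical
  unfold cutInd
  refine Measurable.ite ?_ measurable_const measurable_const
  have ha : Measurable fun x : ℝ => |x| := by fun_prop
  exact (measurableSet_lt measurable_const ha).inter (measurableSet_lt ha measurable_const)

theorem mCut_eq (α ε a b : ℝ) : mCut α ε a b = cut3 ε a b (a + b) * m α a b := by
  unfold mCut cut3 cutInd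
  by_cases ha : ε < |a| ∧ |a| < 1 / ε <;> by_cases hb : ε < |b| ∧ |b| < 1 / ε <;>
    by_cases hc : ε < |a + b| ∧ |a + b| < 1 / ε <;>
    simp only [ha, hb, hc, and_self, and_true, and_false, if_true, if_false,
      mul_one, one_mul, mul_zero, zero_mul]

theorem tendsto_cutInd {x : ℝ} (hx : x ≠ 0) :
    Tendsto (fun ε => cutInd ε x) (𝓝[>] 0) (𝓝 1) := by
  refine tendsto_const_nhds.congr' ?_
  have hp : 0 < |x| := abs_pos.2 hx
  have h1 : ∀ᶠ ε : ℝ in 𝓝[>] 0, ε < min |x| (1 / (|x|)) :=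
    nhdsWithin_le_nhds (eventually_lt_nhds (by positivity))
  filter_upwards [h1, self_mem_nhdsWithin] with ε he hε
  have hε : 0 < ε := hε
  obtain ⟨h2, h3⟩ := lt_min_iff.1 he
  unfold cutInd
  rw [if_pos]
  refine ⟨h2, ?_⟩
  rw [lt_div_iff₀ hp] at h3
  rw [lt_div_iff₀ hε]
  linarith

theorem Wt_zero (k : ℕ) (x : ℝ) : Wt k 0 x = x ^ (2 * k) * x := by
  simp [Wt, wt, mul_comm]

/-- The symbol of the truncated pairing, where `a` is the frequency of `∂ₓ^k f` and the numerator
`b + c` of `m` is `-a`. -/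
def pairSymCut (α : ℝ) (k : ℕ) (ε a b c : ℝ) : ℝ :=
  -(1 / 2) * cut3 ε a b c * (Wt k 0 a / (om α a + om α b + om α c))

theorem pow_mul_mCut (α : ℝ) (k : ℕ) (ε : ℝ) {a b c : ℝ} (h : a + b + c = 0) :
    a ^ (2 * k) * mCut α ε c b = pairSymCut α k ε a b c := by
  have hcb : c + b = -a := by linarith
  rw [mCut_eq, m_eq, pairSymCut, Wt_zero, hcb, neg_neg]
  unfold cut3
  rw [cutInd_neg]
  rw [show om α c + om α b + om α a = om α a + om α b + om α c by ring]
  rw [mul_comm 2, ← div_div]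
  ring

theorem mCut_neg (α ε a b : ℝ) : mCut α ε (-a) (-b) = mCut α ε a b := by
  rw [mCut_eq, mCut_eq, m_eq, m_eq, show -a + -b = -(a + b) by ring]
  unfold cut3
  rw [cutInd_neg, cutInd_neg, cutInd_neg, neg_neg, om_neg, om_neg, om_neg]
  congr 1
  rw [← neg_div_neg_eq, neg_neg]
  congr 1
  ring

theorem measurable_pairSymCut (α : ℝ) (k : ℕ) (ε : ℝ) :
    Measurable fun p : ℝ × ℝ => pairSymCut α k ε p.1 p.2 (-(p.1 + p.2)) := by
  have := measurable_cutInd ε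
  have := measurable_om α
  have := measurable_Wt k 0
  unfold pairSymCut cut3
  fun_prop

section Pairing

variable {α : ℝ} (hm : -1 < α) (h1 : α < 1) (h0 : α ≠ 0) {k : ℕ} (hk : 1 ≤ k)

include hm h1 h0 in
theorem abs_pairSymCut_le {ε : ℝ} (hε : 0 < ε) : ∃ K : ℝ, ∀ p : ℝ × ℝ,
    |pairSymCut α k ε p.1 p.2 (-(p.1 + p.2))| ≤ K * cubMaj k p.1 p.2 (-(p.1 + p.2)) := by
  obtain ⟨K, hK0, hK⟩ := abs_mCut_le hm h1 h0 hε
  refine ⟨(1 / ε) ^ (2 * k) * K, fun p => ?_⟩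
  have hb : |pairSymCut α k ε p.1 p.2 (-(p.1 + p.2))| ≤ (1 / ε) ^ (2 * k) * K := by
    by_cases hp : |p.1| < 1 / ε
    · rw [← pow_mul_mCut α k ε (by ring : p.1 + p.2 + -(p.1 + p.2) = 0), abs_mul, abs_pow]
      exact mul_le_mul (pow_le_pow_left₀ (abs_nonneg _) hp.le _) (hK _ _) (abs_nonneg _)
        (by positivity)
    · have : cutInd ε p.1 = 0 := by
        unfold cutInd; rw [if_neg]; tauto
      simp only [pairSymCut, cut3, this]
      simp only [zero_mul, mul_zero, abs_zero]
      positivity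
  exact hb.trans (le_mul_of_one_le_right (by positivity) (one_le_cubMaj _ _ _ _))

/-- For real `f` the conjugate of `PCutHat` is the convolution at the opposite frequency. -/
theorem conj_PCutHat (α ε : ℝ) {f : L2} (hF : ∀ᵐ ξ : ℝ, ft f (-ξ) = conj (ft f ξ)) (ξ : ℝ) :
    conj (PCutHat α ε f f ξ)
      = (1 / (2 * Real.pi) : ℂ) * ∫ η : ℝ, (mCut α ε (-(ξ + η)) η : ℂ)
          * (ft f η * ft f (-(ξ + η))) := by
  unfold PCutHat
  rw [map_mul, ← integral_conj, ← integral_neg_eq_self]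
  congr 1
  · simp [Complex.conj_ofNat]
  refine integral_congr_ae ?_
  have hq : ∀ᵐ η : ℝ, ft f (-(ξ + η)) = conj (ft f (ξ + η)) :=
    (measurePreserving_add_left volume ξ).quasiMeasurePreserving.ae hF
  have hr : ∀ᵐ η : ℝ, ft f η = conj (ft f (-η)) := by
    filter_upwards [hF] with η h
    rw [h, Complex.conj_conj]
  filter_upwards [hq, hr] with η h1 h2
  rw [h1, h2]
  simp only [map_mul, sub_neg_eq_add, Complex.conj_ofReal]
  rw [← mCut_neg α ε (ξ + η) (-η), neg_neg]
  ring

include hm h1 h0 in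
/-- The truncated pairing in symmetrised form. For each `ε` the integral converges absolutely, so
that the frequencies may be permuted; the symmetrised symbol is no longer singular. -/
theorem pairingCut_eq {N : ℕ} (h3 : 3 ≤ N) (hkN : k ≤ N) {f : L2} (hf : MemH N f) {ε : ℝ}
    (hε : 0 < ε) : pairingCut α k ε f = -(1 / 6) * (1 / (2 * Real.pi)) ^ 2
      * (∫ p : ℝ × ℝ, ((cut3 ε p.1 p.2 (-(p.1 + p.2))
          * sym α (Wt k 0) p.1 p.2 (-(p.1 + p.2)) : ℝ) : ℂ)
          * ft3 f p.1 p.2 (-(p.1 + p.2))).re := by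
  have hF := ft_neg (integrable_ft (hf.mono (by omega)))
  obtain ⟨K, hK⟩ := abs_pairSymCut_le (k := k) hm h1 h0 hε
  set Ψ : ℝ → ℝ → ℝ → ℂ := fun a b c => (pairSymCut α k ε a b c : ℂ) * ft3 f a b c with hΨ
  have hint : Integrable fun p : ℝ × ℝ => Ψ p.1 p.2 (-(p.1 + p.2)) :=
    integrable_mul_ft3 h3 hkN hf (measurable_pairSymCut α k ε) hK
  have e1 : ∀ ξ : ℝ, (Complex.I * (ξ : ℂ)) ^ k * ft f ξ
      * conj ((Complex.I * (ξ : ℂ)) ^ k * PCutHat α ε f f ξ)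
      = (1 / (2 * Real.pi) : ℂ) * ∫ η : ℝ, Ψ ξ η (-(ξ + η)) := by
    intro ξ
    have hpow : (Complex.I * (ξ : ℂ)) ^ k * conj ((Complex.I * (ξ : ℂ)) ^ k)
        = ((ξ ^ (2 * k) : ℝ) : ℂ) := by
      rw [map_pow, ← mul_pow, map_mul, Complex.conj_I, Complex.conj_ofReal, pow_mul]
      push_cast
      congr 1
      linear_combination (-(ξ : ℂ) ^ 2) * Complex.I_sq
    rw [map_mul, conj_PCutHat α ε hF]
    calc _ = ((Complex.I * (ξ : ℂ)) ^ k * conj ((Complex.I * (ξ : ℂ)) ^ k)) * ft f ξ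
          * ((1 / (2 * Real.pi) : ℂ) * ∫ η : ℝ, (mCut α ε (-(ξ + η)) η : ℂ)
          * (ft f η * ft f (-(ξ + η)))) := by ring
      _ = (1 / (2 * Real.pi) : ℂ) * ((((ξ ^ (2 * k) : ℝ) : ℂ) * ft f ξ)
          * ∫ η : ℝ, (mCut α ε (-(ξ + η)) η : ℂ) * (ft f η * ft f (-(ξ + η)))) := by
          rw [hpow]; ring
      _ = _ := by
          rw [← integral_const_mul]
          congr 2
          ext η
          simp only [hΨ]
          rw [← pow_mul_mCut α k ε (by ring : ξ + η + -(ξ + η) = 0), ft3]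
          push_cast
          ring
  have e2 : ∫ p : ℝ × ℝ, Ψ p.1 p.2 (-(p.1 + p.2)) = ∫ ξ : ℝ, ∫ η : ℝ, Ψ ξ η (-(ξ + η)) :=
    integral_prod _ hint
  have e3 := integral3_symm hint
  have e4 : ∫ p : ℝ × ℝ, (Ψ p.1 p.2 (-(p.1 + p.2))
      + Ψ p.2 p.1 (-(p.1 + p.2)) + Ψ (-(p.1 + p.2)) p.1 p.2)
      = (-(1 / 2) : ℂ) * ∫ p : ℝ × ℝ, ((cut3 ε p.1 p.2 (-(p.1 + p.2))
          * sym α (Wt k 0) p.1 p.2 (-(p.1 + p.2)) : ℝ) : ℂ)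
          * ft3 f p.1 p.2 (-(p.1 + p.2)) := by
    rw [← integral_const_mul]
    congr 1
    ext p
    simp only [hΨ, pairSymCut, sym, cut3, ft3]
    generalize -(p.1 + p.2) = c
    push_cast
    rw [show (om α p.2 : ℂ) + om α p.1 + om α c = om α p.1 + om α p.2 + om α c by ring,
      show (om α c : ℂ) + om α p.1 + om α p.2 = om α p.1 + om α p.2 + om α c by ring]
    ring
  unfold pairingCut
  simp_rw [e1]
  rw [integral_const_mul, ← e2]
  set X := ∫ p : ℝ × ℝ, Ψ p.1 p.2 (-(p.1 + p.2)) with hX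
  set Y := ∫ p : ℝ × ℝ, ((cut3 ε p.1 p.2 (-(p.1 + p.2))
          * sym α (Wt k 0) p.1 p.2 (-(p.1 + p.2)) : ℝ) : ℂ)
          * ft3 f p.1 p.2 (-(p.1 + p.2)) with hY
  have e5 : (1 / (2 * Real.pi) : ℂ) * ((1 / (2 * Real.pi) : ℂ) * X)
      = ((-(1 / 6) * (1 / (2 * Real.pi)) ^ 2 : ℝ) : ℂ) * Y := by
    have : X = (-(1 / 6) : ℂ) * Y := by
      rw [e4] at e3
      linear_combination (1 / 3 : ℂ) * e3
    rw [this]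
    push_cast
    ring
  rw [e5, Complex.re_ofReal_mul]

include hm h1 h0 hk

/-- The principal value defining the modified energy exists: the symmetrised symbol has an integrable
majorant independent of `ε`. -/
theorem isPairing_tri {N : ℕ} (h3 : 3 ≤ N) (hkN : k ≤ N) {f : L2} (hf : MemH N f) :
    IsPairing α k f (-(1 / 6) * (1 / (2 * Real.pi)) ^ 2 * (tri α k 0 f).re) := by
  unfold IsPairing
  have hlim : Tendsto (fun ε => ∫ p : ℝ × ℝ, ((cut3 ε p.1 p.2 (-(p.1 + p.2))
          * sym α (Wt k 0) p.1 p.2 (-(p.1 + p.2)) : ℝ) : ℂ)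
          * ft3 f p.1 p.2 (-(p.1 + p.2))) (𝓝[>] 0) (𝓝 (tri α k 0 f)) := by
    refine tendsto_integral_filter_of_dominated_convergence
      (fun p : ℝ × ℝ => 2 / gapConst α * wtConst k * 2 ^ k
        * (cubMaj k p.1 p.2 (-(p.1 + p.2)) * ‖ft3 f p.1 p.2 (-(p.1 + p.2))‖)) ?_ ?_
      ((integrable_cubMaj h3 hkN hf).const_mul _) ?_
    · refine Eventually.of_forall fun ε => ?_
      have hs : Measurable fun p : ℝ × ℝ => cut3 ε p.1 p.2 (-(p.1 + p.2))
          * sym α (Wt k 0) p.1 p.2 (-(p.1 + p.2)) := by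
        refine Measurable.mul ?_ (measurable_sym3 α k 0)
        have := measurable_cutInd ε
        unfold cut3
        fun_prop
      exact ((Complex.measurable_ofReal.comp hs).mul
        (measurable_ft3 f (by fun_prop) (by fun_prop) (by fun_prop))).aestronglyMeasurable
    · refine Eventually.of_forall fun ε => Eventually.of_forall fun p => ?_
      rw [norm_mul, Complex.norm_real, Real.norm_eq_abs, ← mul_assoc, abs_mul]
      refine mul_le_mul_of_nonneg_right ?_ (norm_nonneg _)
      obtain ⟨c0, c1⟩ := cut3_mem ε p.1 p.2 (-(p.1 + p.2))
      rw [abs_of_nonneg c0]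
      exact (mul_le_of_le_one_left (abs_nonneg _) c1).trans
        (abs_sym_Wt_le_cubMaj hm h1 h0 hk le_rfl p)
    · refine Eventually.of_forall fun p => ?_
      refine Tendsto.mul_const _ ((Complex.continuous_ofReal.tendsto _).comp ?_)
      by_cases hz : p.1 = 0 ∨ p.2 = 0 ∨ -(p.1 + p.2) = 0
      · have : sym α (Wt k 0) p.1 p.2 (-(p.1 + p.2)) = 0 := by
          unfold sym
          rw [sym_num_eq_zero (Wt_neg k 0) (by ring) hz, zero_div]
        simp only [this, mul_zero]
        exact tendsto_const_nhds
      · push Not at hz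
        obtain ⟨ha, hb, hc⟩ := hz
        have := ((tendsto_cutInd ha).mul (tendsto_cutInd hb)).mul (tendsto_cutInd hc)
        have := this.mul_const (sym α (Wt k 0) p.1 p.2 (-(p.1 + p.2)))
        simpa only [one_mul, cut3] using this
  have hre := ((Complex.continuous_re.tendsto _).comp hlim).const_mul
    (-(1 / 6) * (1 / (2 * Real.pi)) ^ 2)
  refine hre.congr' ?_
  filter_upwards [self_mem_nhdsWithin] with ε hε
  exact (pairingCut_eq hm h1 h0 h3 hkN hf hε).symm

theorem modifiedEnergy_eq_En {N : ℕ} (h3 : 3 ≤ N) (hkN : k ≤ N) {f : L2} (hf : MemH N f) :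
    modifiedEnergy α k f = En α k 0 f := by
  have hl : limUnder (𝓝[>] 0) (fun ε => pairingCut α k ε f)
      = -(1 / 6) * (1 / (2 * Real.pi)) ^ 2 * (tri α k 0 f).re :=
    (isPairing_tri hm h1 h0 hk h3 hkN hf).limUnder_eq
  have hd : derivNormSq k f = (1 / (2 * Real.pi)) * ∫ ξ : ℝ, wt k 0 ξ * ‖ft f ξ‖ ^ 2 := by
    unfold derivNormSq
    congr 2
    ext ξ
    simp only [wt, norm_mul, norm_pow, Complex.norm_I, Complex.norm_real, Real.norm_eq_abs]
    rw [one_mul, mul_pow, ← pow_mul, mul_comm k 2, pow_mul, sq_abs, ← pow_mul]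
    simp
  rw [modifiedEnergy, hl, hd, En]
  ring

end Pairing

/-! ### Polarised forms and the time derivative of the regularised energy -/

theorem l2_mono_ae {f g : ℝ → ℝ≥0∞} (h : ∀ᵐ ξ : ℝ, f ξ ≤ g ξ) : l2 f ≤ l2 g := by
  unfold l2
  refine ENNReal.rpow_le_rpow (lintegral_mono_ae ?_) (by norm_num)
  filter_upwards [h] with ξ hξ
  exact ENNReal.rpow_le_rpow hξ (by norm_num)

theorem en_eq_l2 (s : ℕ) (f : L2) :
    en s f = l2 (fun ξ => ENNReal.ofReal (Real.sqrt ((1 + ξ ^ 2) ^ s)) * aft f ξ) := by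
  unfold en l2
  congr 1
  refine lintegral_congr fun ξ => ?_
  rw [ENNReal.mul_rpow_of_nonneg _ _ (by norm_num),
    ENNReal.ofReal_rpow_of_nonneg (by positivity) (by norm_num)]
  congr 2
  have := Real.sq_sqrt (show 0 ≤ (1 + ξ ^ 2) ^ s by positivity)
  exact_mod_cast this.symm

theorem en_le_add (s : ℕ) (f g : L2) : en s f ≤ en s (f - g) + en s g := by
  have mf := measurable_aft (f - g)
  have mg := measurable_aft g
  rw [en_eq_l2, en_eq_l2, en_eq_l2]
  have key := ENNReal.lintegral_Lp_add_le (μ := (volume : Measure ℝ)) (p := 2)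
    (f := fun ξ => ENNReal.ofReal (Real.sqrt ((1 + ξ ^ 2) ^ s)) * aft (f - g) ξ)
    (g := fun ξ => ENNReal.ofReal (Real.sqrt ((1 + ξ ^ 2) ^ s)) * aft g ξ)
    (by fun_prop) (by fun_prop) (by norm_num)
  refine le_trans (l2_mono_ae ?_) key
  filter_upwards [ft_sub f g] with ξ hξ
  rw [Pi.add_apply, ← mul_add]
  refine mul_le_mul_right ?_ _
  unfold aft
  rw [hξ]
  calc ‖ft f ξ‖ₑ = ‖(ft f ξ - ft g ξ) + ft g ξ‖ₑ := by rw [sub_add_cancel]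
    _ ≤ _ := enorm_add_le _ _

theorem normH_le_add {s : ℕ} {f g : L2} (hf : MemH s f) (hg : MemH s g) :
    normH s f ≤ normH s (f - g) + normH s g := by
  have h := en_le_add s f g
  have n1 := normH_nonneg s (f - g)
  have n2 := normH_nonneg s g
  rw [en_eq hf, en_eq hg, en_eq (hf.sub hg), ← ENNReal.ofReal_add (by positivity) (by positivity),
    ENNReal.ofReal_le_ofReal_iff (by positivity), ← mul_add] at h
  exact le_of_mul_le_mul_left h (by positivity)

theorem ae_third {P : ℝ → Prop} (h : ∀ᵐ ξ : ℝ, P ξ) : ∀ᵐ p : ℝ × ℝ, P (-(p.1 + p.2)) := by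
  have h1 : ∀ᵐ p : ℝ × ℝ, P p.2 := Measure.quasiMeasurePreserving_snd.ae h
  exact measurePreserving_refl3.quasiMeasurePreserving.ae h1

/-- The integrand of the polarised cubic form. -/
def tri3Int (α : ℝ) (k : ℕ) (δ : ℝ) (f g h : L2) (p : ℝ × ℝ) : ℂ :=
  (sym α (Wt k δ) p.1 p.2 (-(p.1 + p.2)) : ℂ) * (ft h p.1 * (ft g p.2 * ft f (-(p.1 + p.2))))

/-- The polarised cubic form; its first argument is taken at the third frequency. -/
def tri3 (α : ℝ) (k : ℕ) (δ : ℝ) (f g h : L2) : ℂ := ∫ p : ℝ × ℝ, tri3Int α k δ f g h p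

theorem tri_eq_tri3 (α : ℝ) (k : ℕ) (δ : ℝ) (f : L2) : tri α k δ f = tri3 α k δ f f f := rfl

theorem measurable_tri3Int (α : ℝ) (k : ℕ) (δ : ℝ) (f g h : L2) :
    Measurable (tri3Int α k δ f g h) := by
  have := measurable_ft f
  have := measurable_ft g
  have := measurable_ft h
  exact (Complex.measurable_ofReal.comp (measurable_sym3 α k δ)).mul (by fun_prop)

theorem tri3_comm (α : ℝ) (k : ℕ) (δ : ℝ) (f g h : L2) :
    tri3 α k δ f g h = tri3 α k δ f h g := by
  have := integral3_swap (fun a b c => (sym α (Wt k δ) b a c : ℂ) * (ft h b * (ft g a * ft f c)))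
  unfold tri3 tri3Int
  rw [this]
  congr 1
  ext p
  rw [sym_swap]
  ring

theorem tri3_comm' (α : ℝ) (k : ℕ) (δ : ℝ) (f g h : L2) :
    tri3 α k δ f g h = tri3 α k δ g f h := by
  have := integral3_refl (fun a b c => (sym α (Wt k δ) a c b : ℂ) * (ft h a * (ft g c * ft f b)))
  unfold tri3 tri3Int
  rw [this]
  congr 1
  ext p
  rw [sym_swap']
  ring

/-- The polarised quadratic form. -/
def quad2 (k : ℕ) (δ : ℝ) (f g : L2) : ℝ := ∫ ξ : ℝ, wt k δ ξ * (conj (ft f ξ) * ft g ξ).re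

theorem quad2_comm (k : ℕ) (δ : ℝ) (f g : L2) : quad2 k δ f g = quad2 k δ g f := by
  unfold quad2
  congr 1
  ext ξ
  simp only [Complex.mul_re, Complex.conj_re, Complex.conj_im]
  ring

theorem quad2_self (k : ℕ) (δ : ℝ) (f : L2) :
    quad2 k δ f f = ∫ ξ : ℝ, wt k δ ξ * ‖ft f ξ‖ ^ 2 := by
  unfold quad2
  congr 1
  ext ξ
  rw [Complex.sq_norm, Complex.normSq_apply]
  simp only [Complex.mul_re, Complex.conj_re, Complex.conj_im]
  ring

theorem wt_le_of_pos (k : ℕ) {δ : ℝ} (hδ : 0 < δ) (x : ℝ) : wt k δ x ≤ (δ ^ k)⁻¹ := by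
  unfold wt
  have hD : 1 ≤ 1 + δ * x ^ 2 := by nlinarith [sq_nonneg x]
  rw [div_le_iff₀ (by positivity), inv_mul_eq_div, le_div_iff₀ (by positivity)]
  calc x ^ (2 * k) * δ ^ k = (δ * x ^ 2) ^ k := by rw [mul_pow, pow_mul]; ring
    _ ≤ (1 + δ * x ^ 2) ^ k := by gcongr; linarith
    _ ≤ _ := pow_le_pow_right₀ hD (by omega)

theorem lintegral_aft_mul_le (f g : L2) : ∫⁻ ξ : ℝ, aft f ξ * aft g ξ ≤ en 0 f * en 0 g := by
  refine (lintegral_mul_le_l2 (measurable_aft f) (measurable_aft g)).trans_eq ?_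
  rw [en_eq_l2, en_eq_l2]
  simp

theorem enorm_quad2Int_le (k : ℕ) {δ : ℝ} (hδ : 0 < δ) (f g : L2) (ξ : ℝ) :
    ‖wt k δ ξ * (conj (ft f ξ) * ft g ξ).re‖ₑ
      ≤ ENNReal.ofReal (δ ^ k)⁻¹ * (aft f ξ * aft g ξ) := by
  rw [enorm_mul, Real.enorm_of_nonneg (wt_nonneg k hδ.le ξ)]
  refine mul_le_mul' (ENNReal.ofReal_le_ofReal (wt_le_of_pos k hδ ξ)) ?_
  unfold aft
  rw [← enorm_mul, ← ofReal_norm, ← ofReal_norm]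
  refine ENNReal.ofReal_le_ofReal ((Complex.abs_re_le_norm _).trans ?_)
  rw [norm_mul, norm_mul, Complex.norm_conj]

theorem lintegral_quad2_le (k : ℕ) {δ : ℝ} (hδ : 0 < δ) (f g : L2) :
    ∫⁻ ξ : ℝ, ‖wt k δ ξ * (conj (ft f ξ) * ft g ξ).re‖ₑ
      ≤ ENNReal.ofReal (δ ^ k)⁻¹ * (en 0 f * en 0 g) := by
  refine (lintegral_mono (enorm_quad2Int_le k hδ f g)).trans ?_
  rw [lintegral_const_mul' _ _ ENNReal.ofReal_ne_top]
  exact mul_le_mul_right (lintegral_aft_mul_le f g) _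

theorem integrable_quad2 (k : ℕ) {δ : ℝ} (hδ : 0 < δ) (f g : L2) :
    Integrable fun ξ : ℝ => wt k δ ξ * (conj (ft f ξ) * ft g ξ).re := by
  constructor
  · have := measurable_wt k δ
    have mf := measurable_ft f
    have := measurable_ft g
    have hc : Measurable fun ξ : ℝ => conj (ft f ξ) := Complex.continuous_conj.measurable.comp mf
    exact Measurable.aestronglyMeasurable (by fun_prop)
  · refine (lintegral_quad2_le k hδ f g).trans_lt ?_
    have := en_ne_top (memH_zero f)
    have := en_ne_top (memH_zero g)
    finiteness

theorem abs_quad2_le (k : ℕ) {δ : ℝ} (hδ : 0 < δ) : ∃ K : ℝ, 0 ≤ K ∧ ∀ f g : L2,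
    |quad2 k δ f g| ≤ K * (normH 0 f * normH 0 g) := by
  set r := Real.sqrt (2 * Real.pi) with hr
  refine ⟨(δ ^ k)⁻¹ * r ^ 2, by positivity, fun f g => ?_⟩
  have nf := normH_nonneg 0 f
  have ng := normH_nonneg 0 g
  have h := (enorm_integral_le_lintegral_enorm _).trans (lintegral_quad2_le k hδ f g)
  rw [en_eq (memH_zero f), en_eq (memH_zero g), ← hr, ← ENNReal.ofReal_mul (by positivity),
    ← ENNReal.ofReal_mul (by positivity), ← ofReal_norm,
    ENNReal.ofReal_le_ofReal_iff (by positivity)] at h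
  refine h.trans (le_of_eq ?_)
  ring

theorem quad2_sub_right (k : ℕ) {δ : ℝ} (hδ : 0 < δ) (f g h : L2) :
    quad2 k δ f (g - h) = quad2 k δ f g - quad2 k δ f h := by
  unfold quad2
  rw [← integral_sub (integrable_quad2 k hδ f g) (integrable_quad2 k hδ f h)]
  refine integral_congr_ae ?_
  filter_upwards [ft_sub g h] with ξ hξ
  rw [hξ, mul_sub, Complex.sub_re, mul_sub]

theorem quad2_smul_right (k : ℕ) (δ c : ℝ) (f g : L2) :
    quad2 k δ f (c • g) = c * quad2 k δ f g := by
  unfold quad2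
  rw [← integral_const_mul]
  refine integral_congr_ae ?_
  filter_upwards [ft_smul c g] with ξ hξ
  rw [hξ, show conj (ft f ξ) * (c * ft g ξ) = c * (conj (ft f ξ) * ft g ξ) by ring,
    Complex.re_ofReal_mul]
  ring

theorem tendsto_quad2 (k : ℕ) {δ : ℝ} (hδ : 0 < δ) {l : Filter ℝ} {f g : L2} {fs gs : ℝ → L2}
    (tf : Tendsto (fun τ => normH 0 (fs τ - f)) l (𝓝 0))
    (tg : Tendsto (fun τ => normH 0 (gs τ - g)) l (𝓝 0)) :
    Tendsto (fun τ => quad2 k δ (fs τ) (gs τ)) l (𝓝 (quad2 k δ f g)) := by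
  obtain ⟨K, hK0, hK⟩ := abs_quad2_le k hδ
  rw [tendsto_iff_norm_sub_tendsto_zero]
  have hlim : Tendsto (fun τ => K * ((normH 0 (fs τ - f) + normH 0 f) * normH 0 (gs τ - g))
      + K * (normH 0 g * normH 0 (fs τ - f))) l (𝓝 0) := by
    have := (((tf.add_const (normH 0 f)).mul tg).const_mul K).add
      ((tf.const_mul (normH 0 g)).const_mul K)
    simpa using this
  refine squeeze_zero (fun τ => norm_nonneg _) (fun τ => ?_) hlim
  have e : quad2 k δ (fs τ) (gs τ) - quad2 k δ f g
      = quad2 k δ (fs τ) (gs τ - g) + quad2 k δ g (fs τ - f) := by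
    rw [quad2_sub_right k hδ, quad2_sub_right k hδ, quad2_comm k δ g, quad2_comm k δ g]
    ring
  have b := normH_le_add (memH_zero (fs τ)) (memH_zero f)
  have n := normH_nonneg 0 (gs τ - g)
  rw [e]
  refine (norm_add_le _ _).trans (add_le_add ((hK _ _).trans ?_) (hK _ _))
  gcongr

section Tri

variable {α : ℝ} (hm : -1 < α) (h1 : α < 1) (h0 : α ≠ 0) {k : ℕ} (hk : 1 ≤ k)

include hm h1 h0 hk

theorem lintegral_tri3_le {δ : ℝ} (hδ : 0 < δ) : ∃ K : ℝ, 0 ≤ K ∧ ∀ f g h : L2,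
    ∫⁻ p : ℝ × ℝ, ‖tri3Int α k δ f g h p‖ₑ
      ≤ ENNReal.ofReal K * (embConst * en 1 h * (2 * en 1 g * en 0 f)) := by
  obtain ⟨K, hK0, hK⟩ := abs_sym_Wt_le hm h1 h0 hk hδ
  refine ⟨K, hK0, fun f g h => ?_⟩
  have mf := measurable_aft f
  have mg := measurable_aft g
  have hy := young3 (f := aft h) (g := fun ξ => ENNReal.ofReal (1 + |ξ| ^ 1) * aft g ξ)
    (h := aft f) (measurable_aft h) (by fun_prop) mf
  have e0 : l2 (aft f) = en 0 f := by rw [en_eq_l2]; simp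
  calc _ ≤ ∫⁻ p : ℝ × ℝ, ENNReal.ofReal K * (aft h p.1
          * ((ENNReal.ofReal (1 + |p.2| ^ 1) * aft g p.2) * aft f (-(p.1 + p.2)))) := by
        refine lintegral_mono fun p => ?_
        rw [tri3Int, enorm_mul, enorm_mul, enorm_mul]
        have : ‖(sym α (Wt k δ) p.1 p.2 (-(p.1 + p.2)) : ℂ)‖ₑ
            ≤ ENNReal.ofReal K * ENNReal.ofReal (1 + |p.2| ^ 1) := by
          rw [← ofReal_norm, Complex.norm_real, ← ENNReal.ofReal_mul hK0, pow_one]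
          exact ENNReal.ofReal_le_ofReal (hK _ _ _ (by ring))
        refine (mul_le_mul_left this _).trans (le_of_eq ?_)
        unfold aft
        ring
    _ ≤ _ := by
        rw [lintegral_const_mul' _ _ ENNReal.ofReal_ne_top]
        refine mul_le_mul_right (hy.trans ?_) _
        refine mul_le_mul' (l1_le h) (mul_le_mul' (l2_one_add_pow_le 1 g) e0.le)

theorem integrable_tri3 {δ : ℝ} (hδ : 0 < δ) (f : L2) {g h : L2} (hg : MemH 1 g)
    (hh : MemH 1 h) : Integrable (tri3Int α k δ f g h) := by
  obtain ⟨K, hK0, hK⟩ := lintegral_tri3_le hm h1 h0 hk hδ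
  refine ⟨(measurable_tri3Int α k δ f g h).aestronglyMeasurable, (hK f g h).trans_lt ?_⟩
  have := en_ne_top (memH_zero f)
  have := en_ne_top hg
  have := en_ne_top hh
  have := embConst_ne_top
  finiteness

/-- With damping, the polarised cubic form is bounded with one argument in `L²` only, the space in
which the difference quotients converge. -/
theorem norm_tri3_le {δ : ℝ} (hδ : 0 < δ) : ∃ K : ℝ, 0 ≤ K ∧ ∀ f g h : L2, MemH 1 g → MemH 1 h →
    ‖tri3 α k δ f g h‖ ≤ K * (normH 0 f * normH 1 g * normH 1 h) := by
  obtain ⟨K, hK0, hK⟩ := lintegral_tri3_le hm h1 h0 hk hδ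
  set e := embConst.toReal with he
  set r := Real.sqrt (2 * Real.pi) with hr
  have he0 : 0 ≤ e := ENNReal.toReal_nonneg
  have hee : embConst = ENNReal.ofReal e := (ENNReal.ofReal_toReal embConst_ne_top).symm
  refine ⟨K * e * 2 * r ^ 3, by positivity, fun f g h hg hh => ?_⟩
  have nf := normH_nonneg 0 f
  have ng := normH_nonneg 1 g
  have nh := normH_nonneg 1 h
  have b := (enorm_integral_le_lintegral_enorm _).trans (hK f g h)
  rw [en_eq (memH_zero f), en_eq hg, en_eq hh, ← hr, hee,
    show (2 : ℝ≥0∞) = ENNReal.ofReal 2 by simp, ← ENNReal.ofReal_mul (by positivity),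
    ← ENNReal.ofReal_mul (by positivity), ← ENNReal.ofReal_mul (by positivity),
    ← ENNReal.ofReal_mul (by positivity), ← ENNReal.ofReal_mul (by positivity), ← ofReal_norm,
    ENNReal.ofReal_le_ofReal_iff (by positivity)] at b
  refine b.trans (le_of_eq ?_)
  ring

theorem tri3_sub_left {δ : ℝ} (hδ : 0 < δ) (f f' : L2) {g h : L2} (hg : MemH 1 g)
    (hh : MemH 1 h) :
    tri3 α k δ (f - f') g h = tri3 α k δ f g h - tri3 α k δ f' g h := by
  unfold tri3
  rw [← integral_sub (integrable_tri3 hm h1 h0 hk hδ f hg hh)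
    (integrable_tri3 hm h1 h0 hk hδ f' hg hh)]
  refine integral_congr_ae ?_
  filter_upwards [ae_third (ft_sub f f')] with p hp
  rw [tri3Int, tri3Int, tri3Int, hp]
  ring

omit hm h1 h0 hk in
theorem tri3_smul_left (δ c : ℝ) (f g h : L2) :
    tri3 α k δ (c • f) g h = c * tri3 α k δ f g h := by
  unfold tri3
  rw [← integral_const_mul]
  refine integral_congr_ae ?_
  filter_upwards [ae_third (ft_smul c f)] with p hp
  rw [tri3Int, tri3Int, hp]
  ring

/-- Joint continuity of the polarised cubic form. -/
theorem tendsto_tri3 {δ : ℝ} (hδ : 0 < δ) {l : Filter ℝ} {f g h : L2} {fs gs hs : ℝ → L2}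
    (hg : MemH 1 g) (hh : MemH 1 h) (mg : ∀ᶠ τ in l, MemH 1 (gs τ))
    (mh : ∀ᶠ τ in l, MemH 1 (hs τ)) (tf : Tendsto (fun τ => normH 0 (fs τ - f)) l (𝓝 0))
    (tg : Tendsto (fun τ => normH 1 (gs τ - g)) l (𝓝 0))
    (th : Tendsto (fun τ => normH 1 (hs τ - h)) l (𝓝 0)) :
    Tendsto (fun τ => tri3 α k δ (fs τ) (gs τ) (hs τ)) l (𝓝 (tri3 α k δ f g h)) := by
  obtain ⟨K, hK0, hK⟩ := norm_tri3_le hm h1 h0 hk hδ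
  rw [tendsto_iff_norm_sub_tendsto_zero]
  have hlim : Tendsto (fun τ => K * (normH 0 (fs τ - f) * (normH 1 (gs τ - g) + normH 1 g)
        * (normH 1 (hs τ - h) + normH 1 h))
      + K * (normH 0 f * normH 1 (gs τ - g) * (normH 1 (hs τ - h) + normH 1 h))
      + K * (normH 0 f * normH 1 g * normH 1 (hs τ - h))) l (𝓝 0) := by
    have := (((tf.mul (tg.add_const (normH 1 g))).mul (th.add_const (normH 1 h))).const_mul K).add
      (((tg.const_mul (normH 0 f)).mul (th.add_const (normH 1 h))).const_mul K)
    have := this.add ((th.const_mul (normH 0 f * normH 1 g)).const_mul K)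
    simpa using this
  refine squeeze_zero' (Eventually.of_forall fun τ => norm_nonneg _) ?_ hlim
  filter_upwards [mg, mh] with τ hgs hhs
  have e : tri3 α k δ (fs τ) (gs τ) (hs τ) - tri3 α k δ f g h
      = tri3 α k δ (fs τ - f) (gs τ) (hs τ) + tri3 α k δ f (gs τ - g) (hs τ)
        + tri3 α k δ f g (hs τ - h) := by
    rw [tri3_sub_left hm h1 h0 hk hδ _ _ hgs hhs]
    have e2 : tri3 α k δ f (gs τ - g) (hs τ)
        = tri3 α k δ f (gs τ) (hs τ) - tri3 α k δ f g (hs τ) := by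
      have i1 := integrable_tri3 hm h1 h0 hk hδ f hgs hhs
      have i2 := integrable_tri3 hm h1 h0 hk hδ f hg hhs
      unfold tri3
      rw [← integral_sub i1 i2]
      refine integral_congr_ae ?_
      filter_upwards [Measure.quasiMeasurePreserving_snd.ae (ft_sub (gs τ) g)] with p hp
      rw [tri3Int, tri3Int, tri3Int, hp]
      ring
    have e3 : tri3 α k δ f g (hs τ - h) = tri3 α k δ f g (hs τ) - tri3 α k δ f g h := by
      have i1 := integrable_tri3 hm h1 h0 hk hδ f hg hhs
      have i2 := integrable_tri3 hm h1 h0 hk hδ f hg hh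
      unfold tri3
      rw [← integral_sub i1 i2]
      refine integral_congr_ae ?_
      filter_upwards [Measure.quasiMeasurePreserving_fst.ae (ft_sub (hs τ) h)] with p hp
      rw [tri3Int, tri3Int, tri3Int, hp]
      ring
    rw [e2, e3]
    ring
  have a1 := hK (fs τ - f) (gs τ) (hs τ) hgs hhs
  have a2 := hK f (gs τ - g) (hs τ) (hgs.sub hg) hhs
  have a3 := hK f g (hs τ - h) hg (hhs.sub hh)
  have b1 := normH_le_add hgs hg
  have b2 := normH_le_add hhs hh
  have n1 := normH_nonneg 0 (fs τ - f)
  have n2 := normH_nonneg 0 f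
  have n3 := normH_nonneg 1 (gs τ - g)
  have n4 := normH_nonneg 1 (hs τ)
  have n5 := normH_nonneg 1 g
  rw [e]
  refine (norm_add₃_le).trans (add_le_add (add_le_add (a1.trans ?_) (a2.trans ?_)) a3)
  · gcongr
  · gcongr

/-- The time derivative of the regularised energy along a curve that is continuous in `H¹` and
differentiable in `L²`. -/
theorem hasDerivWithinAt_En {δ : ℝ} (hδ : 0 < δ) {u : ℝ → L2} {u' : L2} {s : Set ℝ} {t : ℝ}
    (ht : t ∈ s) (hu : ∀ τ ∈ s, MemH 1 (u τ))
    (hc : Tendsto (fun τ => normH 1 (u τ - u t)) (𝓝[s] t) (𝓝 0))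
    (hd : Tendsto (fun τ => normH 0 ((τ - t)⁻¹ • (u τ - u t) - u')) (𝓝[s \ {t}] t) (𝓝 0)) :
    HasDerivWithinAt (fun τ => En α k δ (u τ))
      ((1 / (2 * Real.pi)) * (2 * quad2 k δ u' (u t))
        - (1 / (2 * Real.pi)) ^ 2 * (tri3 α k δ u' (u t) (u t)).re) s t := by
  -- the slope of the cubic form is the sum of three polarised forms with the difference quotient as
  -- one argument and `u τ` or `u t` as the other two
  rw [hasDerivWithinAt_iff_tendsto_slope]
  have hut := hu t ht
  have hmem : ∀ᶠ τ in 𝓝[s \ {t}] t, τ ∈ s \ {t} := self_mem_nhdsWithin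
  have mu : ∀ᶠ τ in 𝓝[s \ {t}] t, MemH 1 (u τ) := hmem.mono fun τ h => hu τ h.1
  have mc : ∀ᶠ τ in 𝓝[s \ {t}] t, MemH 1 (u t) := Eventually.of_forall fun _ => hut
  have hc' : Tendsto (fun τ => normH 1 (u τ - u t)) (𝓝[s \ {t}] t) (𝓝 0) :=
    hc.mono_left (nhdsWithin_mono _ Set.sdiff_subset)
  have hz : Tendsto (fun _ : ℝ => normH 1 (u t - u t)) (𝓝[s \ {t}] t) (𝓝 0) := by
    have : normH 1 (u t - u t) = 0 := by
      have e : ∀ᵐ ξ : ℝ, (1 + ξ ^ 2) ^ 1 * ‖ft (u t - u t) ξ‖ ^ 2 = (0 : ℝ) := by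
        filter_upwards [ft_sub (u t) (u t)] with ξ hξ
        rw [hξ]; simp
      rw [normH, integral_congr_ae e]; simp
    rw [this]; exact tendsto_const_nhds
  have T1 := tendsto_tri3 hm h1 h0 hk hδ hut hut mu mu hd hc' hc'
  have T2 := tendsto_tri3 hm h1 h0 hk hδ hut hut mc mu hd hz hc'
  have T3 := tendsto_tri3 hm h1 h0 hk hδ hut hut mc mc hd hz hz
  have hc0 : Tendsto (fun τ => normH 0 (u τ - u t)) (𝓝[s \ {t}] t) (𝓝 0) := by
    refine squeeze_zero' (Eventually.of_forall fun τ => normH_nonneg _ _) ?_ hc'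
    filter_upwards [mu] with τ hτ
    exact normH_mono (by norm_num) (hτ.sub hut)
  have hz0 : Tendsto (fun _ : ℝ => normH 0 (u t - u t)) (𝓝[s \ {t}] t) (𝓝 0) := by
    refine squeeze_zero (fun τ => normH_nonneg _ _) (fun _ => ?_) hz
    exact normH_mono (by norm_num) (hut.sub hut)
  have S1 := tendsto_quad2 k hδ hd hc0
  have S2 := tendsto_quad2 k hδ hd hz0
  have main := ((S1.add S2).const_mul (1 / (2 * Real.pi))).sub
    ((Complex.continuous_re.continuousAt.tendsto.comp ((T1.add T2).add T3)).const_mul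
      ((1 / 3) * (1 / (2 * Real.pi)) ^ 2))
  have elim : (1 / (2 * Real.pi)) * (2 * quad2 k δ u' (u t))
        - (1 / (2 * Real.pi)) ^ 2 * (tri3 α k δ u' (u t) (u t)).re
      = 1 / (2 * Real.pi) * (quad2 k δ u' (u t) + quad2 k δ u' (u t))
        - (1 / 3) * (1 / (2 * Real.pi)) ^ 2 * (tri3 α k δ u' (u t) (u t)
          + tri3 α k δ u' (u t) (u t) + tri3 α k δ u' (u t) (u t)).re := by
    simp only [Complex.add_re]
    ring
  rw [elim]
  refine main.congr' ?_
  filter_upwards [mu] with τ hτ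
  set c := (τ - t)⁻¹ with hcdef
  simp only [Function.comp]
  rw [quad2_comm k δ (c • _) (u τ), quad2_comm k δ (c • _) (u t), quad2_smul_right,
    quad2_smul_right, quad2_sub_right k hδ, quad2_sub_right k hδ, tri3_smul_left, tri3_smul_left,
    tri3_smul_left, tri3_sub_left hm h1 h0 hk hδ _ _ hτ hτ,
    tri3_sub_left hm h1 h0 hk hδ _ _ hut hτ, tri3_sub_left hm h1 h0 hk hδ _ _ hut hut,
    tri3_comm' α k δ (u t) (u τ) (u τ), tri3_comm α k δ (u t) (u t) (u τ),
    tri3_comm' α k δ (u t) (u τ) (u t), quad2_comm k δ (u t) (u τ), slope_def_field]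
  unfold En
  rw [← quad2_self, ← quad2_self, tri_eq_tri3, tri_eq_tri3, div_eq_inv_mul, ← hcdef]
  simp only [← mul_add, Complex.re_ofReal_mul, Complex.sub_re, Complex.add_re]
  ring

end Tri

/-! ### Cancellation of the cubic terms -/

/-- On the Fourier side, `f' = |D|^α ∂ₓ f - (1/2) ∂ₓ (f²)`: the equation written as an evolution
equation. -/
def IsVelocity (α : ℝ) (f f' : L2) : Prop :=
  ∀ᵐ ξ : ℝ, ft f' ξ = Complex.I * om α ξ * ft f ξ
    - Complex.I * ξ / 2 * ((1 / (2 * Real.pi) : ℂ) * ∫ η : ℝ, ft f (ξ - η) * ft f η)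

/-- The cubic form with the symbol `Wt k δ` in the first frequency. -/
def wtForm (k : ℕ) (δ : ℝ) (f : L2) : ℂ :=
  ∫ p : ℝ × ℝ, (Wt k δ p.1 : ℂ) * ft3 f p.1 p.2 (-(p.1 + p.2))

/-- The integrand of the quartic form before symmetrisation. -/
def pairInt (α : ℝ) (k : ℕ) (δ : ℝ) (f : L2) (a b c d : ℝ) : ℂ :=
  (pairSym α (Wt k δ) a b : ℂ) * (ft f a * ft f b * (ft f c * ft f d))

theorem integrable_wt_mul_ft3 {N k : ℕ} (h3 : 3 ≤ N) (hkN : k ≤ N) {δ : ℝ} (hδ : 0 < δ) {f : L2}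
    (hf : MemH N f) :
    Integrable fun p : ℝ × ℝ => (Wt k δ p.1 : ℂ) * ft3 f p.1 p.2 (-(p.1 + p.2)) := by
  refine integrable_mul_ft3 h3 hkN hf ((measurable_Wt k δ).comp measurable_fst)
    (C := (δ ^ k)⁻¹) fun p => ?_
  have hw := wt_le_of_pos k hδ p.1
  have hw0 := wt_nonneg k hδ.le p.1
  have h1 := cubTerm_nonneg k p.1 p.2 (-(p.1 + p.2))
  have h2 := cubTerm_nonneg k p.1 (-(p.1 + p.2)) p.2
  have h4 : |p.1| ≤ cubTerm k p.2 (-(p.1 + p.2)) p.1 := by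
    unfold cubTerm
    have a1 : 1 ≤ (1 + |p.2| ^ k) * (1 + |-(p.1 + p.2)| ^ k) :=
      one_le_mul_of_one_le_of_one_le (le_add_of_nonneg_right (by positivity))
        (le_add_of_nonneg_right (by positivity))
    have a2 : |p.1| ≤ 1 + p.1 ^ 2 := by
      rw [← sq_abs]; nlinarith [sq_nonneg (|p.1| - 1)]
    nlinarith [sq_nonneg p.1]
  rw [Wt, abs_mul, abs_of_nonneg hw0, mul_comm]
  unfold cubMaj
  have hd : 0 ≤ (δ ^ k)⁻¹ := by positivity
  exact mul_le_mul hw (by linarith) (abs_nonneg _) hd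

theorem Int4.add {f g : ℝ → ℝ → ℝ → ℝ → ℂ} (hf : Int4 f) (hg : Int4 g) :
    Int4 fun a b c d => f a b c d + g a b c d :=
  Integrable.add hf hg

theorem I4_add {f g : ℝ → ℝ → ℝ → ℝ → ℂ} (hf : Int4 f) (hg : Int4 g) :
    I4 (fun a b c d => f a b c d + g a b c d) = I4 f + I4 g :=
  integral_add hf hg

/-- The quadratic part of the energy against the velocity: the dispersive term drops out. -/
theorem quad2_velocity {α : ℝ} {N k : ℕ} (h3 : 3 ≤ N) (hkN : k ≤ N) {δ : ℝ} (hδ : 0 < δ)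
    {f f' : L2} (hf : MemH N f) (hv : IsVelocity α f f') :
    quad2 k δ f f'
      = (Complex.I / 2 * ((1 / (2 * Real.pi) : ℂ) * wtForm k δ f)).re := by
  have hint := integrable_wt_mul_ft3 h3 hkN hδ hf
  have hF := ft_neg (integrable_ft (hf.mono (show 1 ≤ N by omega)))
  set G : ℝ → ℂ := fun ξ => Complex.I / 2 * ((1 / (2 * Real.pi) : ℂ)
    * ∫ η : ℝ, (Wt k δ ξ : ℂ) * ft3 f ξ η (-(ξ + η))) with hG
  have hGi : Integrable G := (hint.integral_prod_left.const_mul _).const_mul _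
  -- `conj (f̂ (ξ)) = f̂ (-ξ)`, and the dispersive term is `i` times a real function
  have e1 : ∀ᵐ ξ : ℝ, wt k δ ξ * (conj (ft f ξ) * ft f' ξ).re = (G (-ξ)).re := by
    filter_upwards [hv, hF] with ξ h1 h2
    have e2 : G (-ξ) = Complex.I / 2 * ((1 / (2 * Real.pi) : ℂ) * ((Wt k δ (-ξ) : ℂ)
        * (ft f (-ξ) * ∫ η : ℝ, ft f (ξ - η) * ft f η))) := by
      have e : ∫ η : ℝ, (Wt k δ (-ξ) : ℂ) * ft3 f (-ξ) η (-(-ξ + η))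
          = (Wt k δ (-ξ) : ℂ) * (ft f (-ξ) * ∫ η : ℝ, ft f (ξ - η) * ft f η) := by
        rw [← integral_const_mul, ← integral_const_mul]
        congr 1
        ext η
        rw [ft3, show -(-ξ + η) = ξ - η by ring, mul_comm (ft f η)]
      rw [hG, ← e]
    rw [e2, h1, Wt_neg, ← Complex.re_ofReal_mul, h2, ← sub_eq_zero, ← Complex.sub_re, Wt]
    have e3 : ((wt k δ ξ : ℝ) : ℂ) * (conj (ft f ξ) * (Complex.I * om α ξ * ft f ξ
        - Complex.I * ξ / 2 * ((1 / (2 * Real.pi) : ℂ) * ∫ η : ℝ, ft f (ξ - η) * ft f η)))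
        - Complex.I / 2 * ((1 / (2 * Real.pi) : ℂ) * (((-(ξ * wt k δ ξ) : ℝ) : ℂ)
        * (conj (ft f ξ) * ∫ η : ℝ, ft f (ξ - η) * ft f η)))
        = ((wt k δ ξ * om α ξ : ℝ) : ℂ) * (Complex.I * (conj (ft f ξ) * ft f ξ)) := by
      push_cast
      ring
    rw [e3, Complex.re_ofReal_mul, mul_comm (conj (ft f ξ)), Complex.mul_conj, Complex.I_mul_re,
      Complex.ofReal_im]
    simp
  unfold quad2
  rw [integral_congr_ae e1, integral_neg_eq_self (fun ξ => (G ξ).re)]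
  have e4 : ∫ ξ : ℝ, (G ξ).re = (∫ ξ : ℝ, G ξ).re := Complex.reCLM.integral_comp_comm hGi
  rw [e4, hG, integral_const_mul, integral_const_mul, wtForm]
  congr 3
  rw [Measure.volume_eq_prod, integral_prod _ hint]

section Algebra

variable {α : ℝ} (hm : -1 < α) (h1 : α < 1) (h0 : α ≠ 0)

include hm h1 h0

/-- Away from the resonances the symbol times the resonance function is the numerator; on the
resonances, where one frequency vanishes, the numerator is zero as well. -/
theorem sym_mul_om {k : ℕ} {δ : ℝ} {a b c : ℝ} (h : a + b + c = 0) :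
    sym α (Wt k δ) a b c * (om α a + om α b + om α c) = Wt k δ a + Wt k δ b + Wt k δ c := by
  by_cases hz : om α a + om α b + om α c = 0
  · rw [hz, mul_zero]
    refine (sym_num_eq_zero (Wt_neg k δ) h ?_).symm
    by_contra! hne
    obtain ⟨ha, hb, hc⟩ := hne
    have pa := abs_pos.2 ha
    have pb := abs_pos.2 hb
    have pc := abs_pos.2 hc
    set s := min |a| (min |b| |c|) with hs
    have hs0 : 0 < s := lt_min pa (lt_min pb pc)
    have hτ : Between |a| a b c := ⟨pa, Or.inl (by linarith), Or.inl (by linarith)⟩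
    have g := om_gap hm h1 h0 a b c h s |a| hs0.le (min_le_left _ _)
      ((min_le_right _ _).trans (min_le_left _ _)) ((min_le_right _ _).trans (min_le_right _ _)) hτ
    rw [hz, abs_zero] at g
    have := mul_pos (mul_pos (gapConst_pos h0) hs0) (Real.rpow_pos_of_pos pa α)
    linarith
  · rw [sym, div_mul_cancel₀ _ hz]

variable {k : ℕ} (hk : 1 ≤ k)

include hk

theorem integrable_sym_om_mul_ft3 {N : ℕ} (h3 : 3 ≤ N) (hkN : k ≤ N) {δ : ℝ} (hδ : 0 < δ) {f : L2}
    (hf : MemH N f) : Integrable fun p : ℝ × ℝ =>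
      ((sym α (Wt k δ) p.1 p.2 (-(p.1 + p.2)) * om α p.1 : ℝ) : ℂ)
        * ft3 f p.1 p.2 (-(p.1 + p.2)) := by
  obtain ⟨K, hK0, hK⟩ := abs_sym_Wt_le hm h1 h0 hk hδ
  refine integrable_mul_ft3 h3 hkN hf
    ((measurable_sym3 α k δ).mul ((measurable_om α).comp measurable_fst)) (C := 2 * K) fun p => ?_
  have c1 := cubTerm_nonneg k p.1 p.2 (-(p.1 + p.2))
  have c2 := cubTerm_nonneg k p.1 (-(p.1 + p.2)) p.2
  have b1 : |om α p.1| ≤ 1 + p.1 ^ 2 := by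
    have := rpow_le_one_add_sq (abs_nonneg p.1) (show 0 ≤ α + 1 by linarith) (by linarith)
    rw [om, abs_mul, abs_of_nonneg (by positivity : 0 ≤ |p.1| ^ α)]
    rw [Real.rpow_add' (abs_nonneg _) (by linarith), Real.rpow_one, sq_abs] at this
    exact this
  have b2 : 1 + |p.2| ≤ 2 * (1 + |p.2| ^ k) := by
    rcases le_total |p.2| 1 with h | h
    · have : 0 ≤ |p.2| ^ k := by positivity
      linarith
    · have := le_self_pow₀ h (by omega : k ≠ 0)
      linarith
  have b3 : (1 : ℝ) ≤ 1 + |-(p.1 + p.2)| ^ k := le_add_of_nonneg_right (by positivity)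
  rw [abs_mul]
  calc _ ≤ K * (1 + |p.2|) * (1 + p.1 ^ 2) := by
        have := hK p.1 p.2 (-(p.1 + p.2)) (by ring)
        gcongr
    _ ≤ K * (2 * (1 + |p.2| ^ k)) * (1 + p.1 ^ 2) := by gcongr
    _ ≤ K * (2 * (1 + |p.2| ^ k)) * (1 + p.1 ^ 2) * (1 + |-(p.1 + p.2)| ^ k) :=
        le_mul_of_one_le_right (by positivity) b3
    _ = 2 * K * cubTerm k p.2 (-(p.1 + p.2)) p.1 := by unfold cubTerm; ring
    _ ≤ _ := by
        unfold cubMaj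
        gcongr
        linarith

/-- The dispersive part of the derivative of the cubic term reproduces the form that the
quadratic part of the energy leaves behind. -/
theorem integral_sym_om {N : ℕ} (h3 : 3 ≤ N) (hkN : k ≤ N) {δ : ℝ} (hδ : 0 < δ) {f : L2}
    (hf : MemH N f) :
    ∫ p : ℝ × ℝ, ((sym α (Wt k δ) p.1 p.2 (-(p.1 + p.2)) * om α p.1 : ℝ) : ℂ)
        * ft3 f p.1 p.2 (-(p.1 + p.2)) = wtForm k δ f := by
  have i1 := integrable_sym_om_mul_ft3 hm h1 h0 hk h3 hkN hδ hf
  have i2 := integrable_wt_mul_ft3 h3 hkN hδ hf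
  have s1 := integral3_symm
    (Ψ := fun a b c => ((sym α (Wt k δ) a b c * om α a : ℝ) : ℂ) * ft3 f a b c) i1
  have s2 := integral3_symm (Ψ := fun a b c => (Wt k δ a : ℂ) * ft3 f a b c) i2
  refine mul_left_cancel₀ (three_ne_zero' ℂ) (s1.trans (Eq.trans ?_ s2.symm))
  congr 1
  ext p
  have key := sym_mul_om hm h1 h0 (k := k) (δ := δ)
    (show p.1 + p.2 + (-(p.1 + p.2)) = 0 by ring)
  set c := -(p.1 + p.2)
  rw [sym_swap α _ p.1 p.2, sym_swap α _ p.1 c, sym_swap' α _ p.1 p.2 c]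
  have key' := congrArg (fun x : ℝ => (x : ℂ)) key
  push_cast at key' ⊢
  unfold ft3
  linear_combination (ft f p.1 * ft f p.2 * ft f c) * key'

/-- With damping, the quartic form converges absolutely before symmetrisation. -/
theorem int4_pairInt {N : ℕ} (h3 : 3 ≤ N) {δ : ℝ} (hδ : 0 < δ) {f : L2}
    (hf : MemH N f) : Int4 (pairInt α k δ f) := by
  obtain ⟨K, hK0, hK⟩ := abs_sym_Wt_le hm h1 h0 hk hδ
  have mf := measurable_aft f
  have mF := measurable_ft f
  have m4 := measurable_fourth
  have mp := measurable_pairSym α k δ (X := (ℝ × ℝ) × ℝ) (a := fun q => q.1.1)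
    (b := fun q => q.1.2) (by fun_prop) (by fun_prop)
  have hy := young4 (f := fun ξ => ENNReal.ofReal (1 + ξ ^ 2) * aft f ξ)
    (g := fun ξ => ENNReal.ofReal (1 + ξ ^ 2) * aft f ξ) (h := aft f) (i := aft f)
    (by fun_prop) (by fun_prop) mf mf
  unfold Int4 pairInt
  refine ⟨Measurable.aestronglyMeasurable ((Complex.measurable_ofReal.comp mp).mul (by fun_prop)),
    ?_⟩
  have hb : ∀ a b : ℝ, |pairSym α (Wt k δ) a b| ≤ 4 * K * ((1 + a ^ 2) * (1 + b ^ 2)) := by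
    intro a b
    have := hK a b (-(a + b)) (by ring)
    rw [pairSym, abs_mul]
    have h5 : (1 + |b|) * |a + b| ≤ 4 * ((1 + a ^ 2) * (1 + b ^ 2)) := by
      have := abs_add_le a b
      have a0 := abs_nonneg a
      have b0 := abs_nonneg b
      rw [← sq_abs a, ← sq_abs b]
      set x := |a|
      set y := |b|
      have : (1 + y) * |a + b| ≤ (1 + y) * (x + y) := by gcongr
      nlinarith [sq_nonneg (x - 1), sq_nonneg (y - 1), sq_nonneg (x * y - x), sq_nonneg (x * y),
        sq_nonneg (x - y), mul_nonneg a0 b0]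
    calc _ ≤ K * (1 + |b|) * |a + b| := by gcongr
      _ = K * ((1 + |b|) * |a + b|) := by ring
      _ ≤ K * (4 * ((1 + a ^ 2) * (1 + b ^ 2))) := by gcongr
      _ = _ := by ring
  refine lt_of_le_of_lt (b := ENNReal.ofReal (4 * K)
    * J (fun a b c d => (ENNReal.ofReal (1 + a ^ 2) * aft f a) * (ENNReal.ofReal (1 + b ^ 2) * aft f b)
      * (aft f c * aft f d))) ?_ ?_
  · unfold J
    rw [← lintegral_const_mul' _ _ ENNReal.ofReal_ne_top]
    refine lintegral_mono fun q => ?_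
    have : ‖(pairSym α (Wt k δ) q.1.1 q.1.2 : ℂ)‖ₑ ≤ ENNReal.ofReal (4 * K)
        * (ENNReal.ofReal (1 + q.1.1 ^ 2) * ENNReal.ofReal (1 + q.1.2 ^ 2)) := by
      rw [← ofReal_norm, Complex.norm_real, ← ENNReal.ofReal_mul (by positivity),
        ← ENNReal.ofReal_mul (by positivity)]
      exact ENNReal.ofReal_le_ofReal (hb _ _)
    rw [enorm_mul]
    refine (mul_le_mul_left this _).trans (le_of_eq ?_)
    simp only [aft, enorm_mul]
    ring
  · have n1 := en_ne_top (hf.mono h3)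
    have n2 := embConst_ne_top
    have n3 := en_ne_top (memH_zero f)
    have e0 : l2 (aft f) = en 0 f := by rw [en_eq_l2]; simp
    refine lt_of_le_of_lt (mul_le_mul_right (hy.trans (mul_le_mul' (mul_le_mul' (l1w_le f) (l1w_le f))
      le_rfl)) _) ?_
    rw [e0]
    finiteness

/-- The quartic form is six copies of its unsymmetrised version. -/
theorem quadForm_eq_six_mul {N : ℕ} (h3 : 3 ≤ N) {δ : ℝ} (hδ : 0 < δ) {f : L2}
    (hf : MemH N f) : quadForm α k δ f = 6 * I4 (pairInt α k δ f) := by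
  have i1 := int4_pairInt hm h1 h0 hk h3 hδ hf
  -- the pairs `13`, `14`, `23`, `24`, `34` are reached from `12` by adjacent transpositions
  have i2 := i1.swap23
  have i3 := i2.swap34
  have i4 := i2.swap12
  have i5 := i4.swap34
  have i6 := i5.swap23
  have j2 := I4_swap23 (pairInt α k δ f)
  have j3 := I4_swap34 fun a b c d => pairInt α k δ f a c b d
  have j4 := I4_swap12 fun a b c d => pairInt α k δ f a c b d
  have j5 := I4_swap34 fun a b c d => pairInt α k δ f b c a d
  have j6 := I4_swap23 fun a b c d => pairInt α k δ f b d a c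
  have e : quadForm α k δ f = I4 (pairInt α k δ f) + I4 (fun a b c d => pairInt α k δ f a c b d)
      + I4 (fun a b c d => pairInt α k δ f a d b c) + I4 (fun a b c d => pairInt α k δ f b c a d)
      + I4 (fun a b c d => pairInt α k δ f b d a c)
      + I4 (fun a b c d => pairInt α k δ f c d a b) := by
    unfold quadForm
    rw [← I4_add i1 i2, ← I4_add (i1.add i2) i3, ← I4_add ((i1.add i2).add i3) i4,
      ← I4_add (((i1.add i2).add i3).add i4) i5,
      ← I4_add ((((i1.add i2).add i3).add i4).add i5) i6]
    congr 1
    ext a b c d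
    simp only [quadInt, quadSym, pairInt]
    push_cast
    ring
  rw [e, j6, j5, j4, j3, j2]
  ring

/-- The cubic part of the energy against the velocity. -/
theorem tri3_velocity {N : ℕ} (h3 : 3 ≤ N) (hkN : k ≤ N) {δ : ℝ} (hδ : 0 < δ)
    {f f' : L2} (hf : MemH N f) (hv : IsVelocity α f f') :
    tri3 α k δ f' f f = Complex.I * wtForm k δ f
      + Complex.I / 2 * ((1 / (2 * Real.pi) : ℂ) * I4 (pairInt α k δ f)) := by
  have i1 := integrable_sym_om_mul_ft3 hm h1 h0 hk h3 hkN hδ hf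
  have i4 := int4_pairInt hm h1 h0 hk h3 hδ hf
  have e1 := integral_sym_om hm h1 h0 hk h3 hkN hδ hf
  set Ψ : ℝ → ℝ → ℝ → ℂ :=
    fun a b c => ((sym α (Wt k δ) a b c * om α a : ℝ) : ℂ) * ft3 f a b c with hΨ
  have i2 := integrable3_refl (f := fun a b c => Ψ b a c) (integrable3_swap i1)
  have e2 : ∫ p : ℝ × ℝ, Ψ (-(p.1 + p.2)) p.1 p.2 = wtForm k δ f := by
    rw [integral3_refl (fun a b c => Ψ b a c), integral3_swap Ψ]
    exact e1
  have i5 := i4.integral_prod_left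
  have e3 : I4 (pairInt α k δ f)
      = ∫ p : ℝ × ℝ, ∫ η : ℝ, pairInt α k δ f p.1 p.2 η (fourth (p, η)) := by
    unfold I4
    rw [Measure.volume_eq_prod, integral_prod _ i4]
  rw [← e2, e3, ← integral_const_mul, ← integral_const_mul, ← integral_const_mul]
  refine Eq.trans ?_ (integral_add (i2.const_mul _) ((i5.const_mul _).const_mul _))
  unfold tri3
  refine integral_congr_ae ?_
  filter_upwards [ae_third hv] with p hp
  have e5 : ∫ η : ℝ, pairInt α k δ f p.1 p.2 η (fourth (p, η))
      = (pairSym α (Wt k δ) p.1 p.2 : ℂ) * (ft f p.1 * ft f p.2)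
        * ∫ η : ℝ, ft f (-(p.1 + p.2) - η) * ft f η := by
    rw [← integral_const_mul]
    congr 1
    ext η
    rw [pairInt, show fourth (p, η) = -(p.1 + p.2) - η by unfold fourth; ring]
    ring
  rw [tri3Int, hp, hΨ]
  simp only
  rw [e5, pairSym, sym_swap α _ p.1 (-(p.1 + p.2)), sym_swap' α _ p.1 p.2]
  unfold ft3
  push_cast
  ring

/-- Along the equation the derivative of the regularised energy is quartic: the cubic forms from the
quadratic part and from the dispersive term cancel. -/
theorem deriv_En_eq {N : ℕ} (h3 : 3 ≤ N) (hkN : k ≤ N) {δ : ℝ} (hδ : 0 < δ)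
    {f f' : L2} (hf : MemH N f) (hv : IsVelocity α f f') :
    (1 / (2 * Real.pi)) * (2 * quad2 k δ f' f) - (1 / (2 * Real.pi)) ^ 2 * (tri3 α k δ f' f f).re
      = -(1 / 12) * (1 / (2 * Real.pi)) ^ 3 * (Complex.I * quadForm α k δ f).re := by
  rw [quad2_comm, quad2_velocity h3 hkN hδ hf hv, tri3_velocity hm h1 h0 hk h3 hkN hδ hf hv,
    quadForm_eq_six_mul hm h1 h0 hk h3 hδ hf]
  set A := wtForm k δ f
  set B := I4 (pairInt α k δ f)
  have c1 : (1 / (2 * Real.pi) : ℂ) = ((1 / (2 * Real.pi) : ℝ) : ℂ) := by push_cast; rfl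
  set r := 1 / (2 * Real.pi)
  rw [c1, show Complex.I / 2 * ((r : ℂ) * A) = ((r / 2 : ℝ) : ℂ) * (Complex.I * A) by push_cast; ring,
    show Complex.I / 2 * ((r : ℂ) * B) = ((r / 2 : ℝ) : ℂ) * (Complex.I * B) by push_cast; ring,
    show Complex.I * (6 * B) = ((6 : ℝ) : ℂ) * (Complex.I * B) by push_cast; ring, Complex.add_re,
    Complex.re_ofReal_mul, Complex.re_ofReal_mul, Complex.re_ofReal_mul]
  ring

end Algebra

/-! ### Solutions -/

/-- One derivative costs one Sobolev exponent. -/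
theorem memH_one_of_deriv {f g : L2} (hf : MemH 2 f)
    (hg : IsMultiplier (fun ξ => Complex.I * (ξ : ℂ)) f g) : MemH 1 g := by
  have mg := measurable_ft g
  refine Integrable.mono' hf (Measurable.aestronglyMeasurable (by fun_prop)) ?_
  filter_upwards [hg] with ξ hξ
  rw [Real.norm_eq_abs, abs_of_nonneg (by positivity), hξ, norm_mul, norm_mul, Complex.norm_I,
    one_mul, Complex.norm_real, mul_pow, Real.norm_eq_abs, sq_abs]
  have : 0 ≤ ‖ft f ξ‖ ^ 2 := by positivity
  nlinarith [mul_nonneg this (sq_nonneg ξ)]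

/-- The transform of the nonlinearity `f ∂ₓf = ∂ₓ(f²)/2`. -/
theorem ft_mul_deriv {f g h : L2} (hf : MemH 2 f)
    (hg : IsMultiplier (fun ξ => Complex.I * (ξ : ℂ)) f g) (hh : ∀ᵐ x : ℝ, h x = f x * g x) :
    ∀ᵐ ξ : ℝ, ft h ξ
      = Complex.I * ξ / 2 * ((1 / (2 * Real.pi) : ℂ) * ∫ η : ℝ, ft f (ξ - η) * ft f η) := by
  have if1 := integrable_ft (hf.mono (show 1 ≤ 2 by norm_num))
  have ig := integrable_ft (memH_one_of_deriv hf hg)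
  have if2 : Integrable fun η : ℝ => Complex.I * η * ft f η := ig.congr hg
  filter_upwards [ft_mul if1 ig hh,
    if2.ae_convolution_exists (ContinuousLinearMap.mul ℝ ℂ) if1] with ξ h1 h2
  have h2 : Integrable fun η : ℝ => Complex.I * η * ft f η * ft f (ξ - η) := h2
  have e1 : ∫ η : ℝ, ft f (ξ - η) * ft g η = ∫ η : ℝ, Complex.I * η * ft f η * ft f (ξ - η) := by
    refine integral_congr_ae ?_
    filter_upwards [hg] with η hη
    rw [hη]; ring
  have e2 := integral_sub_left_eq_self
    (fun η : ℝ => Complex.I * η * ft f η * ft f (ξ - η)) volume ξ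
  have h3 := h2.comp_sub_left ξ
  -- the mean of the factor `i η` and its image `i (ξ - η)` under `η ↦ ξ - η` is `i ξ / 2`
  have e3 : ∫ η : ℝ, Complex.I * ξ * (ft f (ξ - η) * ft f η)
      = (∫ η : ℝ, Complex.I * η * ft f η * ft f (ξ - η))
        + ∫ η : ℝ, Complex.I * (ξ - η : ℝ) * ft f (ξ - η) * ft f (ξ - (ξ - η)) := by
    rw [← integral_add h2 h3]
    congr 1
    ext η
    rw [sub_sub_cancel]
    push_cast
    ring
  rw [e2, integral_const_mul] at e3
  rw [h1, e1]
  linear_combination (-(1 / (2 * Real.pi) : ℂ) / 2) * e3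

theorem isVelocity_of_equation {α : ℝ} {f f' fx w : L2} (hf : MemH 2 f)
    (hx : IsMultiplier (fun ξ => Complex.I * (ξ : ℂ)) f fx)
    (hw : IsMultiplier (fun ξ => Complex.I * (ξ : ℂ) * ((|ξ| ^ α : ℝ) : ℂ)) f w)
    (h : ∀ᵐ x : ℝ, f' x + f x * fx x - w x = 0) : IsVelocity α f f' := by
  have hh : ∀ᵐ x : ℝ, (w - f') x = f x * fx x := by
    filter_upwards [h, Lp.coeFn_sub w f'] with x h1 h2
    rw [h2, Pi.sub_apply]
    linarith
  filter_upwards [ft_mul_deriv hf hx hh, ft_sub w f', hw] with ξ h1 h2 h3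
  rw [← h1, h2, h3, om]
  push_cast
  ring

/-- The derivative of the modified energy along the equation; `δ > 0` regularises it. -/
def energyFlux (α : ℝ) (k : ℕ) (δ : ℝ) (f : L2) : ℝ :=
  -(1 / 12) * (1 / (2 * Real.pi)) ^ 3 * (Complex.I * quadForm α k δ f).re

theorem abs_energyFlux_le (α : ℝ) (k : ℕ) (δ : ℝ) (f : L2) :
    |energyFlux α k δ f| ≤ (1 / 12) * (1 / (2 * Real.pi)) ^ 3 * ‖quadForm α k δ f‖ := by
  unfold energyFlux
  rw [abs_mul, neg_mul, abs_neg, abs_of_nonneg (by positivity)]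
  gcongr
  refine (Complex.abs_re_le_norm _).trans_eq ?_
  rw [norm_mul, Complex.norm_I, one_mul]

theorem abs_energyFlux_sub_le (α : ℝ) (k : ℕ) (δ : ℝ) (f g : L2) :
    |energyFlux α k δ f - energyFlux α k δ g|
      ≤ (1 / 12) * (1 / (2 * Real.pi)) ^ 3 * ‖quadForm α k δ f - quadForm α k δ g‖ := by
  unfold energyFlux
  rw [← mul_sub, ← Complex.sub_re, ← mul_sub, abs_mul, neg_mul, abs_neg,
    abs_of_nonneg (by positivity)]
  gcongr
  refine (Complex.abs_re_le_norm _).trans_eq ?_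
  rw [norm_mul, Complex.norm_I, one_mul]

/-- Differentiability passes to a pointwise limit when the derivatives are equicontinuous at the
point in question, uniformly in the parameter. -/
theorem hasDerivWithinAt_of_tendsto {g g' : ℝ → ℝ → ℝ} {G b : ℝ → ℝ} {G' t : ℝ} {s : Set ℝ}
    (hs : Convex ℝ s) (ht : t ∈ s)
    (hg : ∀ δ, 0 < δ → ∀ τ ∈ s, HasDerivWithinAt (g δ) (g' δ τ) s τ)
    (hG : ∀ τ ∈ s, Tendsto (fun δ => g δ τ) (𝓝[>] 0) (𝓝 (G τ)))
    (hG' : Tendsto (fun δ => g' δ t) (𝓝[>] 0) (𝓝 G')) (hb : Tendsto b (𝓝[s] t) (𝓝 0))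
    (hbd : ∀ δ, 0 < δ → ∀ τ ∈ s, |g' δ τ - g' δ t| ≤ b τ) : HasDerivWithinAt G G' s t := by
  rw [hasDerivWithinAt_iff_isLittleO, Asymptotics.isLittleO_iff]
  intro ε hε
  obtain ⟨ρ, hρ, hball⟩ := Metric.mem_nhdsWithin_iff.1 (hb.eventually_lt_const hε)
  have hmem : s ∩ Metric.ball t ρ ∈ 𝓝[s] t :=
    inter_mem self_mem_nhdsWithin (mem_nhdsWithin_of_mem_nhds (Metric.ball_mem_nhds t hρ))
  filter_upwards [hmem] with τ hτ
  have hpos : ∀ᶠ δ : ℝ in 𝓝[>] 0, 0 < δ := self_mem_nhdsWithin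
  have hlim : Tendsto (fun δ => ‖g δ τ - g δ t - (τ - t) • g' δ t‖) (𝓝[>] 0)
      (𝓝 ‖G τ - G t - (τ - t) • G'‖) :=
    (((hG τ hτ.1).sub (hG t ht)).sub (hG'.const_smul _)).norm
  refine le_of_tendsto hlim (hpos.mono fun δ hδ => ?_)
  have hmvt := (hs.inter (convex_ball t ρ)).norm_image_sub_le_of_norm_hasDerivWithin_le
    (f := fun τ => g δ τ - τ * g' δ t) (f' := fun τ => g' δ τ - g' δ t) (C := ε) (x := t) (y := τ)
    (fun x hx => by
      have h1 := (hg δ hδ x hx.1).mono (Set.inter_subset_left (t := Metric.ball t ρ))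
      have h2 := ((hasDerivWithinAt_id x (s ∩ Metric.ball t ρ)).mul_const (g' δ t))
      rw [one_mul] at h2
      exact h1.sub h2)
    (fun x hx => ((hbd δ hδ x hx.1).trans (hball ⟨hx.2, hx.1⟩).le))
    ⟨ht, Metric.mem_ball_self hρ⟩ hτ
  refine le_trans (le_of_eq ?_) hmvt
  rw [smul_eq_mul]
  congr 1
  ring

section Solution

variable {α : ℝ} (hm : -1 < α) (h1 : α < 1) (h0 : α ≠ 0) {k : ℕ} (hk : 1 ≤ k) {N : ℕ} (h3 : 3 ≤ N)
  (hkN : k ≤ N) {T : ℝ} {u : ℝ → L2} (hu : IsSolution α N T u)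

include hm h1 h0 hk h3 hkN hu

theorem hasDerivWithinAt_En_solution {δ : ℝ} (hδ : 0 < δ) {t : ℝ} (ht : t ∈ Set.Icc 0 T) :
    HasDerivWithinAt (fun τ => En α k δ (u τ)) (energyFlux α k δ (u t)) (Set.Icc 0 T) t := by
  obtain ⟨hc, ut, hct, hd, heq⟩ := hu
  obtain ⟨fx, w, hx, hw, he⟩ := heq t ht
  have hut := (hc t ht).1
  have hv := isVelocity_of_equation (hut.mono (show 2 ≤ N by omega)) hx hw he
  have key := deriv_En_eq hm h1 h0 hk h3 hkN hδ hut hv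
  unfold energyFlux
  rw [← key]
  refine hasDerivWithinAt_En hm h1 h0 hk hδ ht (fun τ hτ => (hc τ hτ).1.mono (by omega)) ?_ ?_
  · refine squeeze_zero' (Eventually.of_forall fun _ => normH_nonneg _ _) ?_ (hc t ht).2
    filter_upwards [self_mem_nhdsWithin] with τ hτ
    exact normH_mono (by omega) ((hc τ hτ).1.sub hut)
  · refine squeeze_zero' (Eventually.of_forall fun _ => normH_nonneg _ _) ?_ (hd t ht)
    filter_upwards [self_mem_nhdsWithin] with τ hτ
    refine normH_mono (by omega) (MemH.sub (MemH.smul (MemH.mono (Nat.sub_le N 2) ?_) _) (hct t ht).1)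
    exact (hc τ hτ.1).1.sub hut

/-- The modified energy is differentiable along a solution. This is not read off from the equation
directly, since without damping `∂ₜu ∈ H^(N-2)` is too rough for the energy of order `k = N`;
the derivative is obtained in the limit `δ → 0`. -/
theorem hasDerivWithinAt_modifiedEnergy {t : ℝ} (ht : t ∈ Set.Icc 0 T) :
    HasDerivWithinAt (fun τ => modifiedEnergy α k (u τ)) (energyFlux α k 0 (u t))
      (Set.Icc 0 T) t := by
  have hc := hu.1
  have hut := (hc t ht).1
  obtain ⟨C, hC0, hC⟩ := norm_quadForm_sub_le hm h1 h0 hk h3 hkN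
  have hE : ∀ τ ∈ Set.Icc 0 T, modifiedEnergy α k (u τ) = En α k 0 (u τ) := fun τ hτ =>
    modifiedEnergy_eq_En hm h1 h0 hk h3 hkN (hc τ hτ).1
  refine HasDerivWithinAt.congr (f := fun τ => En α k 0 (u τ)) ?_ hE (hE t ht)
  have hlim : Tendsto (fun τ => (1 / 12) * (1 / (2 * Real.pi)) ^ 3 * (C * (normH N (u τ - u t)
      * (normH N (u τ - u t) + normH N (u t) + normH N (u t)) ^ 3))) (𝓝[Set.Icc 0 T] t) (𝓝 0) := by
    have hn := (hc t ht).2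
    have := ((hn.mul (((hn.add_const (normH N (u t))).add_const (normH N (u t))).pow 3)).const_mul
      C).const_mul ((1 / 12) * (1 / (2 * Real.pi)) ^ 3)
    simpa using this
  refine hasDerivWithinAt_of_tendsto (convex_Icc 0 T) ht
    (fun δ hδ τ hτ => hasDerivWithinAt_En_solution hm h1 h0 hk h3 hkN hu hδ hτ)
    (fun τ hτ => tendsto_En hm h1 h0 hk h3 hkN (hc τ hτ).1) ?_ hlim fun δ hδ τ hτ => ?_
  · have := tendsto_quadForm hm h1 h0 hk h3 hkN hut
    exact (Complex.continuous_re.continuousAt.tendsto.comp (this.const_mul Complex.I)).const_mul _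
  · refine (abs_energyFlux_sub_le _ _ _ _ _).trans ?_
    have hb := hC δ hδ.le (u τ) (u t) (hc τ hτ).1 hut
    have n1 := normH_nonneg N (u τ - u t)
    have n2 := normH_nonneg N (u τ)
    have n3 := normH_nonneg N (u t)
    have b1 := normH_le_add (hc τ hτ).1 hut
    refine mul_le_mul_of_nonneg_left (hb.trans ?_) (by positivity)
    gcongr

end Solution

end FKdV

end

theorem proposition4p1 (α : ℝ) (hα₁ : -1 < α) (hα₂ : α < 1) (hα₀ : α ≠ 0)
    (k : ℕ) (hk : 1 ≤ k) :
    ∃ C : ℝ, 0 < C ∧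
      ∀ (N : ℕ), 3 ≤ N → k ≤ N → ∀ (T : ℝ), 0 < T → ∀ u : ℝ → FKdV.L2,
        FKdV.IsSolution α N T u →
          ∀ t ∈ Set.Icc 0 T,
            (∃ L : ℝ, FKdV.IsPairing α k (u t) L) ∧
            DifferentiableWithinAt ℝ (fun τ => FKdV.modifiedEnergy α k (u τ)) (Set.Icc 0 T) t ∧
            derivWithin (fun τ => FKdV.modifiedEnergy α k (u τ)) (Set.Icc 0 T) t ≤
              C * (FKdV.normH 2 (u t) * FKdV.normH 3 (u t) * FKdV.normH k (u t) ^ 2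
                + FKdV.normH k (u t) ^ 4) := by
  obtain ⟨K, hK0, hK⟩ := FKdV.norm_quadForm_le hα₁ hα₂ hα₀ hk
  -- `K + 1` only makes the constant positive; the first term on the right suffices
  refine ⟨(1 / 12) * (1 / (2 * Real.pi)) ^ 3 * (K + 1), by positivity, ?_⟩
  intro N h3 hkN T hT u hu t ht
  have hut := (hu.1 t ht).1
  have hD := FKdV.hasDerivWithinAt_modifiedEnergy hα₁ hα₂ hα₀ hk h3 hkN hu ht
  refine ⟨⟨_, FKdV.isPairing_tri hα₁ hα₂ hα₀ hk h3 hkN hut⟩, hD.differentiableWithinAt, ?_⟩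
  rw [hD.derivWithin (uniqueDiffOn_Icc hT t ht)]
  have hq := hK N h3 hkN 0 le_rfl (u t) hut
  have n2 := FKdV.normH_nonneg 2 (u t)
  have n3 := FKdV.normH_nonneg 3 (u t)
  have nk := FKdV.normH_nonneg k (u t)
  refine (le_abs_self _).trans ((FKdV.abs_energyFlux_le _ _ _ _).trans ?_)
  rw [mul_assoc _ (K + 1)]
  refine mul_le_mul_of_nonneg_left (hq.trans ?_) (by positivity)
  gcongr
  · linarith
  · exact le_add_of_nonneg_right (by positivity)
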